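/- **Setting.** Let $m>0$, $\alpha>-1$, $\zeta\in(0,2]$, $\langle v,I\rangle=\sqrt{1+\tfrac12|v|^2+\tfrac1m I}$ on $\mathbb R^3\times\mathbb R_+$, and $\|g\|_{L^1_k}=\int_{\mathbb R^3\times\mathbb R_+}|g|\,\langle v,I\rangle^k\,dv\,dI$. For two molecules $(v,I),(v_*,I_*)$ put $E=\frac m4|v-v_*|^2+I+I_*$, $\hat u=\frac{v-v_*}{|v-v_*|}$, and for $\sigma\in\mathbb S^2$, $r,R\in[0,1]$ $$v'=\tfrac{v+v_*}2+\sqrt{\tfrac{RE}m}\,\sigma,\quad I'=r(1-R)E,\qquad v'_*=\tfrac{v+v_*}2-\sqrt{\tfrac{RE}m}\,\sigma,\quad I'_*=(1-r)(1-R)E .$$ With $d_\alpha(r,R)=r^\alpha(1-r)^\alpha(1-R)^{2\alpha+1}\sqrt R$ and $\mathbb S^2_+=\{\sigma:\hat u\cdot\sigma\ge0\}$ let $$Q(f,g)(v,I)=\int_{\mathbb R^3\times\mathbb R_+}\int_{\mathbb S^2_+\times[0,1]^2}\Big\{f(v',I')g(v'_*,I'_*)\Big(\tfrac{II_*}{I'I'_*}\Big)^{\alpha}-f(v,I)g(v_*,I_*)\Big\}\,\tilde{\mathcal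 B}\; b(\hat u\cdot\sigma)\,d_\alpha(r,R)\,d\sigma\,dR\,dr\,dv_*\,dI_* ,$$ where $b\ge0$ is integrable on $[0,1]$, and $\tilde{\mathcal B}=\tilde{\mathcal B}(v,v_*,I,I_*,r,R)\ge0$ is invariant under $(v,v_*,I,I_*,r,R)\to(v',v'_*,I',I'_*,\frac{I}{I+I_*},\frac{m|v-v_*|^2}{4E})$ (for every $\sigma\in\mathbb S^2_+$) and under $(v,v_*,I,I_*,r,R)\to(v_*,v,I_*,I,1-r,R)$, and satisfies $$\tilde b^{lb}(r,R)\,(E/m)^{\zeta/2}\le\tilde{\mathcal B}\le\tilde b^{ub}(r,R)\,(E/m)^{\zeta/2},\qquad \tilde b^{lb},\tilde b^{ub}\in L^1([0,1]^2;d_\alpha\,dr\,dR).$$ Put $\kappa^{lb}=2\pi\int_0^1 b\,\cdot\int_{[0,1]^2}\tilde b^{lb}d_\alpha\,dr\,dR$, define $\kappa^{ub}$ in the same way from $\tilde b^{ub}$, and assume $\kappa^{lb}>0$. **Solutions.** A solution is a nonnegative $f\in C([0,\infty),L^1_2)\cap C^1((0,\infty),L^1_2)$ with $\partial_tf=Q(f,f)$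 for $t>0$ in $L^1_2$, with conserved energy $\|f(t)\|_{L^1_2}=\|f_0\|_{L^1_2}$, whose initial datum $f_0=f(0)$ satisfies $\|f_0\|_{L^1}>0$ and $f_0\in L^1_{2+\varepsilon}$ for some $\varepsilon>0$. Write $M_0=\|f_0\|_{L^1}$, $M_2=\|f_0\|_{L^1_2}$. **Constants.** A family of averaging constants is a nonincreasing function $k\mapsto\mathcal C_k\ge0$ on $[0,\infty)$ with $\mathcal C_k\to0$ as $k\to\infty$ and, for all $k\ge0$ and all states with $v\neq v_*$ and $I,I_*>0$, $$\int_{\mathbb S^2_+\times[0,1]^2}\big(\langle v',I'\rangle^k+\langle v'_*,I'_*\rangle^k\big)b(\hat u\cdot\sigma)\,\tilde b^{ub}d_\alpha\,d\sigma\,dR\,dr\le\mathcal C_k\big(\langle v,I\rangle^2+\langle v_*,I_*\rangle^2\big)^{k/2}.$$ A threshold is a number $k_*>2$ with $\mathcal C_k<\kappa^{lb}$ for all $k\ge k_*$. Put $$A_k=2^{-\zeta-1}\min\{1,2^{1-\zeta}\}(\kappa^{lb}-\mathcal C_k)\,M_0M_2^{-\zeta/(k-2)},\qquad D_k=2^{\frac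 k2+2}\kappa^{ub}M_2,$$ let $B_k$ be the smallest constant $\beta\ge0$ such that $\int Q(g,g)\langle v,I\rangle^k\,dv\,dI\le-A_k\|g\|_{L^1_k}^{1+\zeta/(k-2)}+\beta$ for all $0\le g\in L^1_{k+\zeta}$ with $\|g\|_{L^1}=M_0$, $\|g\|_{L^1_2}=M_2$, and put $$E_k=\Big(\frac{B_k}{A_k}\Big)^{\frac{k-2}{k-2+\zeta}},\quad a_k=\Big(\frac{k-2}{\zeta A_k}\Big)^{\frac{k-2}\zeta},\quad \mathcal E_k=M_2^{\frac{k_*-k+1}{k_*-1}}E_{k_*+1}^{\frac{k-2}{k_*-1}},$$ $$a_k^*=M_2^{\frac{k_*-k+1}{k_*-1}}\Big(\frac{k_*-1}{\zeta A_{k_*+1}}\Big)^{\frac{k-2}\zeta},\quad \tilde{\mathcal E}_k=\mathcal E_k+M_2^{\frac{k_*-k+1}{k_*-1}}\Big(\frac{k_*-1}{\zeta A_{k_*+1}}D_k\Big)^{\frac{k-2}\zeta}.$$ **Theorem ($L^1$-theory for the Boltzmann equation).** Families of averaging constants exist, and each of them has a threshold $k_*$. For every such family and every threshold $k_*$, there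 are admissible constants $\beta$ in the definition of $B_k$ for all $k\ge k_*$ (and all values $M_0>0$, $M_2$ of mass and energy), and for every solution $f$ and every $t>0$ the following holds. 1. (Generation.) $f(t)\in L^1_k$ for all $k>2$, and (a) if $k\ge k_*$, then $\|f\|_{L^1_k}(t)\le E_k+a_k\,t^{-\frac{k-2}\zeta}$; (b) if $2<k<k_*$, then $\|f\|_{L^1_k}(t)\le\mathcal E_k+a^*_k\,t^{-\frac{k-2}\zeta}$. 2. (Propagation.) If $\|f_0\|_{L^1_k}<\infty$, then (a) if $k\ge k_*$, then $\|f\|_{L^1_k}(t)\le\max\{E_k,\|f_0\|_{L^1_k}\}$; (b) if $2<k<k_*$, then $\|f\|_{L^1_k}(t)\le\max\{\tilde{\mathcal E}_k,e\,\|f_0\|_{L^1_k}\}$. -/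

import Mathlib

open MeasureTheory Filter Topology Set

noncomputable section

namespace Polyatomic

/-- Velocities. -/
abbrev Vel : Type := EuclideanSpace ℝ (Fin 3)

/-- Molecular states `(v, I)`; the internal energy `I` is weighed by Lebesgue measure on `(0, ∞)`. -/
abbrev State : Type := Vel × ℝ

/-- Collision parameters `(σ, r, R)`. -/
abbrev Param : Type := Metric.sphere (0 : Vel) 1 × ℝ × ℝ

/-- The measure `dv dI` on `ℝ³ × ℝ₊`. -/
def stateMeasure : Measure State :=
  (volume : Measure Vel).prod ((volume : Measure ℝ).restrict (Ioi 0))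

/-- The measure `dσ dr dR` on `S² × [0,1]²` (`dσ` is the surface measure, of total mass `4π`). -/
def paramMeasure : Measure Param :=
  (volume : Measure Vel).toSphere.prod
    (((volume : Measure ℝ).restrict (Ioo 0 1)).prod ((volume : Measure ℝ).restrict (Ioo 0 1)))

/-- The bracket `⟨v, I⟩ = √(1 + |v|²/2 + I/m)`. -/
def bracket (m : ℝ) (x : State) : ℝ := √(1 + ‖x.1‖ ^ 2 / 2 + x.2 / m)

/-- Membership in `L¹_k(ℝ³ × ℝ₊)`. -/
def MemL1 (m k : ℝ) (g : State → ℝ) : Prop :=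
  Integrable (fun x => g x * bracket m x ^ k) stateMeasure

/-- The norm of `L¹_k(ℝ³ × ℝ₊)` (meaningful on `L¹_k`). -/
def normL1 (m k : ℝ) (g : State → ℝ) : ℝ :=
  ∫ x, |g x| * bracket m x ^ k ∂stateMeasure

/-- The collisional energy `E = (m/4)|v - v_*|² + I + I_*`. -/
def collEnergy (m : ℝ) (x y : State) : ℝ := m / 4 * ‖x.1 - y.1‖ ^ 2 + x.2 + y.2

/-- The post-collisional state `(v', I')` of the first molecule (Borgnakke-Larsen). -/
def post (m : ℝ) (x y : State) (p : Param) : State :=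
  ((1 / 2 : ℝ) • (x.1 + y.1) + √(p.2.2 * collEnergy m x y / m) • (p.1 : Vel),
    p.2.1 * (1 - p.2.2) * collEnergy m x y)

/-- The post-collisional state `(v'_*, I'_*)` of the second molecule. -/
def postStar (m : ℝ) (x y : State) (p : Param) : State :=
  ((1 / 2 : ℝ) • (x.1 + y.1) - √(p.2.2 * collEnergy m x y / m) • (p.1 : Vel),
    (1 - p.2.1) * (1 - p.2.2) * collEnergy m x y)

/-- The cosine `û · σ`, where `û = (v - v_*)/|v - v_*|`. -/
def cosDev (x y : State) (p : Param) : ℝ :=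
  inner ℝ (‖x.1 - y.1‖⁻¹ • (x.1 - y.1)) (p.1 : Vel)

/-- The weight `d_α(r, R)`. -/
def dWeight (α r R : ℝ) : ℝ :=
  r ^ α * (1 - r) ^ α * (1 - R) ^ (2 * α + 1) * √R

/-- A factorised cut-off collision kernel `b(û · σ) B̃(v, v_*, I, I_*, r, R)` of hard potentials
type, together with the physical parameters `m`, `α` and the rate `ζ`. -/
structure CollisionKernel where
  m : ℝ
  m_pos : 0 < m
  α : ℝ
  α_gt : -1 < α
  ζ : ℝ
  ζ_pos : 0 < ζ
  ζ_le : ζ ≤ 2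
  /-- the angular part, a function of the cosine in `[0, 1]` -/
  b : ℝ → ℝ
  b_measurable : Measurable b
  b_nonneg : ∀ c ∈ Icc (0 : ℝ) 1, 0 ≤ b c
  b_integrable : IntegrableOn b (Icc 0 1)
  /-- the part `B̃(v, v_*, I, I_*, r, R)`, written as a function of `(v, I)`, `(v_*, I_*)`, `r`, `R` -/
  B : State → State → ℝ → ℝ → ℝ
  B_measurable : Measurable fun q : State × State × ℝ × ℝ => B q.1 q.2.1 q.2.2.1 q.2.2.2
  B_nonneg : ∀ x y : State, 0 < x.2 → 0 < y.2 → ∀ r ∈ Ioo (0 : ℝ) 1, ∀ R ∈ Ioo (0 : ℝ) 1,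
    0 ≤ B x y r R
  /-- micro-reversibility -/
  B_reversible : ∀ x y : State, 0 < x.2 → 0 < y.2 → x.1 ≠ y.1 → ∀ p : Param,
    p.2.1 ∈ Ioo (0 : ℝ) 1 → p.2.2 ∈ Ioo (0 : ℝ) 1 → 0 ≤ cosDev x y p →
    B (post m x y p) (postStar m x y p) (x.2 / (x.2 + y.2))
      (m * ‖x.1 - y.1‖ ^ 2 / (4 * collEnergy m x y)) = B x y p.2.1 p.2.2
  /-- exchange of the two molecules -/
  B_symm : ∀ x y : State, 0 < x.2 → 0 < y.2 → ∀ r ∈ Ioo (0 : ℝ) 1, ∀ R ∈ Ioo (0 : ℝ) 1,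
    B y x (1 - r) R = B x y r R
  /-- the lower and upper bounds `b̃^{lb}(r, R)`, `b̃^{ub}(r, R)` -/
  lb : ℝ → ℝ → ℝ
  ub : ℝ → ℝ → ℝ
  lb_le : ∀ x y : State, 0 < x.2 → 0 < y.2 → ∀ r ∈ Ioo (0 : ℝ) 1, ∀ R ∈ Ioo (0 : ℝ) 1,
    lb r R * (collEnergy m x y / m) ^ (ζ / 2) ≤ B x y r R
  le_ub : ∀ x y : State, 0 < x.2 → 0 < y.2 → ∀ r ∈ Ioo (0 : ℝ) 1, ∀ R ∈ Ioo (0 : ℝ) 1,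
    B x y r R ≤ ub r R * (collEnergy m x y / m) ^ (ζ / 2)
  lb_integrable : IntegrableOn (fun q : ℝ × ℝ => lb q.1 q.2 * dWeight α q.1 q.2)
    (Ioo 0 1 ×ˢ Ioo 0 1)
  ub_integrable : IntegrableOn (fun q : ℝ × ℝ => ub q.1 q.2 * dWeight α q.1 q.2)
    (Ioo 0 1 ×ˢ Ioo 0 1)

namespace CollisionKernel

variable (K : CollisionKernel)

/-- `‖b‖_{L¹(S²₊)} = 2π ∫₀¹ b`. -/
def bNorm : ℝ := 2 * Real.pi * ∫ c in Icc (0 : ℝ) 1, K.b c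

/-- `κ^{lb}`. -/
def kappaLb : ℝ :=
  K.bNorm * ∫ q in Ioo (0 : ℝ) 1 ×ˢ Ioo (0 : ℝ) 1, K.lb q.1 q.2 * dWeight K.α q.1 q.2

/-- `κ^{ub}`. -/
def kappaUb : ℝ :=
  K.bNorm * ∫ q in Ioo (0 : ℝ) 1 ×ˢ Ioo (0 : ℝ) 1, K.ub q.1 q.2 * dWeight K.α q.1 q.2

open Classical in
/-- `b(û · σ)`, supported on the half sphere `û · σ ≥ 0`. -/
def angular (x y : State) (p : Param) : ℝ :=
  if 0 ≤ cosDev x y p then K.b (cosDev x y p) else 0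

/-- `B̃(v, v_*, I, I_*, r, R) b(û · σ) d_α(r, R)`. -/
def rate (x y : State) (p : Param) : ℝ :=
  K.B x y p.2.1 p.2.2 * K.angular x y p * dWeight K.α p.2.1 p.2.2

/-- The gain operator `Q⁺(f, g)`. -/
def gain (f g : State → ℝ) (x : State) : ℝ :=
  ∫ q : State × Param,
    f (post K.m x q.1 q.2) * g (postStar K.m x q.1 q.2)
      * ((x.2 * q.1.2) / ((post K.m x q.1 q.2).2 * (postStar K.m x q.1 q.2).2)) ^ K.α
      * K.rate x q.1 q.2 ∂(stateMeasure.prod paramMeasure)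

/-- The collision frequency `ν[g]`. -/
def freq (g : State → ℝ) (x : State) : ℝ :=
  ∫ q : State × Param, g q.1 * K.rate x q.1 q.2 ∂(stateMeasure.prod paramMeasure)

/-- The collision operator `Q(f, g) = Q⁺(f, g) - f ν[g]`. -/
def collOp (f g : State → ℝ) (x : State) : ℝ := K.gain f g x - f x * K.freq g x

/-- The Dirichlet form `𝒬₁[g, g] = ∫ Q(g, g) ⟨v, I⟩^k dv dI`. -/
def dirichlet (k : ℝ) (g : State → ℝ) : ℝ :=
  ∫ x, K.collOp g g x * bracket K.m x ^ k ∂stateMeasure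

/-- The averaging operator `𝒮_k`. -/
def avg (k : ℝ) (x y : State) : ℝ :=
  ∫ p, (bracket K.m (post K.m x y p) ^ k + bracket K.m (postStar K.m x y p) ^ k)
    * K.angular x y p * K.ub p.2.1 p.2.2 * dWeight K.α p.2.1 p.2.2 ∂paramMeasure

/-- `k ↦ 𝒞_k` is a family of averaging (Povzner) constants for the kernel. -/
structure IsAveragingConst (C : ℝ → ℝ) : Prop where
  nonneg : ∀ k, 0 ≤ k → 0 ≤ C k
  antitone : AntitoneOn C (Ici 0)
  tendsto : Tendsto C atTop (𝓝 0)
  bound : ∀ k, 0 ≤ k → ∀ x y : State, 0 < x.2 → 0 < y.2 → x.1 ≠ y.1 →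
    K.avg k x y ≤ C k * (bracket K.m x ^ 2 + bracket K.m y ^ 2) ^ (k / 2)

/-- `k_* > 2` and `𝒞_k < κ^{lb}` for all `k ≥ k_*`. -/
def IsThreshold (C : ℝ → ℝ) (kstar : ℝ) : Prop :=
  2 < kstar ∧ ∀ k, kstar ≤ k → C k < K.kappaLb

/-- `Ã_k = (L/2)(κ^{lb} - 𝒞_k)` with `L = 2^{-ζ} min{1, 2^{1-ζ}}`. -/
def constATilde (C : ℝ → ℝ) (k : ℝ) : ℝ :=
  (2 : ℝ) ^ (-K.ζ) * min 1 ((2 : ℝ) ^ (1 - K.ζ)) / 2 * (K.kappaLb - C k)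

/-- `A_k`, for mass `M₀ = ‖f‖_{L¹}` and energy `M₂ = ‖f‖_{L¹_2}`. -/
def constA (C : ℝ → ℝ) (k M₀ M₂ : ℝ) : ℝ :=
  K.constATilde C k * M₀ * M₂ ^ (-K.ζ / (k - 2))

/-- `D_k = 2^{k/2+2} κ^{ub} ‖f‖_{L¹_2}`. -/
def constD (k M₂ : ℝ) : ℝ := (2 : ℝ) ^ (k / 2 + 2) * K.kappaUb * M₂

/-- The non-negative constants `β` for which
`𝒬₁[g, g] ≤ -A_k ‖g‖_{L¹_k}^{1+ζ/(k-2)} + β` holds for all `0 ≤ g ∈ L¹_{k+ζ}` with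
mass `M₀` and energy `M₂`. -/
def dirichletBounds (C : ℝ → ℝ) (k M₀ M₂ : ℝ) : Set ℝ :=
  {β | 0 ≤ β ∧ ∀ g : State → ℝ, Measurable g → (∀ x, 0 ≤ g x) → MemL1 K.m (k + K.ζ) g →
    normL1 K.m 0 g = M₀ → normL1 K.m 2 g = M₂ →
    K.dirichlet k g ≤ -K.constA C k M₀ M₂ * normL1 K.m k g ^ (1 + K.ζ / (k - 2)) + β}

/-- `B_k`, the best constant of the previous estimate. -/
def constB (C : ℝ → ℝ) (k M₀ M₂ : ℝ) : ℝ := sInf (K.dirichletBounds C k M₀ M₂)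

/-- `E_k`. -/
def constE (C : ℝ → ℝ) (k M₀ M₂ : ℝ) : ℝ :=
  (K.constB C k M₀ M₂ / K.constA C k M₀ M₂) ^ ((k - 2) / (k - 2 + K.ζ))

/-- `a_k`. -/
def consta (C : ℝ → ℝ) (k M₀ M₂ : ℝ) : ℝ :=
  ((k - 2) / (K.ζ * K.constA C k M₀ M₂)) ^ ((k - 2) / K.ζ)

/-- `ℰ_k`. -/
def constELow (C : ℝ → ℝ) (kstar k M₀ M₂ : ℝ) : ℝ :=
  M₂ ^ ((kstar - k + 1) / (kstar - 1))
    * K.constE C (kstar + 1) M₀ M₂ ^ ((k - 2) / (kstar - 1))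

/-- `a_k^*`. -/
def constaLow (C : ℝ → ℝ) (kstar k M₀ M₂ : ℝ) : ℝ :=
  M₂ ^ ((kstar - k + 1) / (kstar - 1))
    * ((kstar - 1) / (K.ζ * K.constA C (kstar + 1) M₀ M₂)) ^ ((k - 2) / K.ζ)

/-- `ℰ̃_k`. -/
def constETildeLow (C : ℝ → ℝ) (kstar k M₀ M₂ : ℝ) : ℝ :=
  K.constELow C kstar k M₀ M₂
    + M₂ ^ ((kstar - k + 1) / (kstar - 1))
      * ((kstar - 1) / (K.ζ * K.constA C (kstar + 1) M₀ M₂) * K.constD k M₂) ^ ((k - 2) / K.ζ)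

/-- `f` is an energy-conserving solution of `∂ₜ f = Q(f, f)` in
`C([0, ∞), L¹_2) ∩ C¹((0, ∞), L¹_2)`, `f ≥ 0`, whose initial datum `f 0` has positive mass and
lies in `L¹_{2+ε}` for some `ε > 0`. -/
structure IsSolution (f : ℝ → State → ℝ) : Prop where
  measurable : ∀ t, 0 ≤ t → Measurable (f t)
  nonneg : ∀ t, 0 ≤ t → ∀ x, 0 ≤ f t x
  mem_two : ∀ t, 0 ≤ t → MemL1 K.m 2 (f t)
  mass_pos : 0 < normL1 K.m 0 (f 0)
  mem_two_plus : ∃ ε : ℝ, 0 < ε ∧ MemL1 K.m (2 + ε) (f 0)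
  continuous : ∀ t, 0 ≤ t →
    Tendsto (fun s => normL1 K.m 2 (fun x => f s x - f t x)) (𝓝[Ici 0] t) (𝓝 0)
  mem_collOp : ∀ t, 0 < t → MemL1 K.m 2 (K.collOp (f t) (f t))
  hasDeriv : ∀ t, 0 < t →
    Tendsto (fun h => normL1 K.m 2
      (fun x => h⁻¹ * (f (t + h) x - f t x) - K.collOp (f t) (f t) x)) (𝓝[≠] 0) (𝓝 0)
  continuous_deriv : ∀ t, 0 < t →
    Tendsto (fun s => normL1 K.m 2
      (fun x => K.collOp (f s) (f s) x - K.collOp (f t) (f t) x)) (𝓝 t) (𝓝 0)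
  energy : ∀ t, 0 ≤ t → normL1 K.m 2 (f t) = normL1 K.m 2 (f 0)

end CollisionKernel

end Polyatomic

end

/-!
Moments of a solution are governed by the weak form of the collision operator,
`∫ Q(f, f) φ = ½ ∫ f f_* (φ' + φ'_* - φ - φ_*)` against the collision rate (`collOp_weakForm`). It
rests on the change of variables between incoming and outgoing states. In coordinates consisting of
the centre of mass velocity, the energy `E` of the pair and the parameters `(σ, r, R)`, a pair of
molecules is parametrised by the very formulas that give the outgoing pair (`lintegral_pair`), so
that the reversal of a collision is the exchange of two sets of parameters with the same centre of
mass velocity and energy, and the kernel is symmetric under it (`rate_reversible`,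
`lintegral_reversible`).

*Averaging constants.* For fixed `(r, R)`, each outgoing molecule takes at least a fixed fraction of
the conserved quantity `⟨v, I⟩² + ⟨v_*, I_*⟩²`, whatever `σ` and the incoming states are
(`fraction_mul_le_post`). Neither of them therefore takes all of it, and the average of the `k`-th
powers tends to zero by dominated convergence (`isAveragingConst_averagingConst`).

*A priori estimate.* Beyond a threshold the gain in the weak form for `φ = ⟨v, I⟩^k` is dominated by
the loss, up to products of lower order (`integral_collDiff_le`). As `(E / m)^{ζ/2}` is large for an
encounter of a fast molecule with a slow one (`le_speed`), the loss controls the moment of order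
`k + ζ`; the rest is absorbed, and the interpolation of the order `k` between `2` and `k + ζ` gives
the bound by `-A_k ‖g‖^{1 + ζ/(k - 2)}` plus a constant (`dirichletBounds_nonempty`).

*Finiteness of moments.* For a solution it is not known beforehand that these moments are finite.
The power `z ^ p`, `z = ⟨v, I⟩²`, is replaced by `truncPow p n z = z min(z, n)^{p - 1}`, which is
linear in `z` for large `z`. A multiple of the conserved energy minus the truncated moment is the
average of a bounded function, for which the evolution equation may be used. The truncated powers
satisfy a Povzner inequality uniformly in the level `n`, so that truncated moments grow at most
exponentially, and in addition some of the moment of order `k + ζ` is dissipated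
(`collOp_truncDefect`). The first fact shows that finite moments stay finite (`IsSolution.growth`).
By the second one, there is for each `n` a time in a given interval at which the truncated moment of
order `k + ζ` is bounded independently of `n`; these sets of times are compact and decrease with
`n`, so there is a time at which the moment itself is finite (`IsSolution.exists_memL1_add`).
Iteration from the order `2 + ε` shows that all moments are finite at positive times
(`IsSolution.memL1_of_pos`). They are then differentiable, with the derivative given by the
Dirichlet form (`IsSolution.hasDerivAt_normL1`).

*Conclusion.* For `k ≥ k_*` the moment `y` of order `k` satisfies
`y' ≤ -A_k y^{1 + ζ/(k - 2)} + B_k` at positive times. Comparison with the barriers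
`max {E_k, y(s)}` and `E_k + a_k (t - s)^{-(k - 2)/ζ}` gives the bounds for these orders
(`le_max_of_deriv_le`, `le_add_rpow_of_deriv_le`). Orders between `2` and `k_*` are interpolated
between the energy and the order `k_* + 1`; this bound is singular at `t = 0`, and to propagate the
moment it is combined with the exponential growth bound up to the time `1 / D_k`.
-/

noncomputable section

namespace Polyatomic

open scoped ENNReal Pointwise

/-! ### Changes of variables on the half line and on the sphere -/

theorem setLIntegral_Ioo_scale {E : ℝ} (hE : 0 < E) (F : ℝ → ℝ≥0∞) :
    ∫⁻ a in Ioo 0 E, F a = ∫⁻ r in Ioo (0 : ℝ) 1, ENNReal.ofReal E * F (r * E) := by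
  have h := lintegral_image_eq_lintegral_abs_deriv_mul (s := Ioo (0 : ℝ) 1) (f := fun r => r * E)
    (f' := fun _ => E) measurableSet_Ioo
    (fun x _ => (hasDerivAt_mul_const E).hasDerivWithinAt)
    (fun x _ y _ hxy => mul_right_cancel₀ hE.ne' hxy) F
  have himg : (fun r : ℝ => r * E) '' Ioo 0 1 = Ioo 0 E := by
    rw [image_mul_right_Ioo _ _ hE]; simp
  rw [himg] at h
  rw [h, abs_of_pos hE]

/-- Integration over a quadrant in the coordinates `a + b = E`, `a = r E`. -/
theorem setLIntegral_triangle {F : ℝ → ℝ → ℝ≥0∞} (hF : Measurable (Function.uncurry F)) :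
    ∫⁻ a in Ioi (0 : ℝ), ∫⁻ b in Ioi (0 : ℝ), F a b =
      ∫⁻ E in Ioi (0 : ℝ), ∫⁻ r in Ioo (0 : ℝ) 1,
        ENNReal.ofReal E * F (r * E) ((1 - r) * E) := by
  have h1 : ∀ a : ℝ, ∫⁻ b in Ioi (0 : ℝ), F a b
      = ∫⁻ E, (Ioi a).indicator (fun E => F a (E - a)) E := by
    intro a
    rw [← lintegral_indicator measurableSet_Ioi,
      ← lintegral_sub_right_eq_self _ a]
    refine lintegral_congr fun E => ?_
    by_cases h : a < E
    · simp [h]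
    · simp [h]
  have hm : Measurable (Function.uncurry fun a E : ℝ => (Ioi a).indicator
      (fun E => F a (E - a)) E) := by
    have : (Function.uncurry fun a E : ℝ => (Ioi a).indicator (fun E => F a (E - a)) E)
        = {q : ℝ × ℝ | q.1 < q.2}.indicator
          (fun q => Function.uncurry F (q.1, q.2 - q.1)) := by
      ext q; rcases q with ⟨a, E⟩
      by_cases h : a < E <;> simp [h]
    rw [this]
    refine Measurable.indicator (hF.comp (by fun_prop)) ?_
    exact measurableSet_lt measurable_fst measurable_snd
  simp_rw [h1]
  rw [lintegral_lintegral_swap hm.aemeasurable, ← lintegral_indicator measurableSet_Ioi]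
  refine lintegral_congr fun E => ?_
  by_cases hE : 0 < E
  · have e1 : (Ioi (0 : ℝ)).indicator (fun E => ∫⁻ r in Ioo (0 : ℝ) 1,
        ENNReal.ofReal E * F (r * E) ((1 - r) * E)) E
        = ∫⁻ r in Ioo (0 : ℝ) 1, ENNReal.ofReal E * F (r * E) (E - r * E) := by
      rw [indicator_of_mem (by exact hE)]
      refine lintegral_congr fun r => ?_
      ring_nf
    rw [e1, ← setLIntegral_Ioo_scale hE (fun a => F a (E - a)),
      ← lintegral_indicator measurableSet_Ioi, ← lintegral_indicator measurableSet_Ioo]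
    refine lintegral_congr fun a => ?_
    by_cases h1 : 0 < a <;> by_cases h2 : a < E <;> simp [h1, h2]
  · rw [indicator_of_notMem (by exact hE)]
    rw [← lintegral_indicator measurableSet_Ioi, ← lintegral_zero (μ := (volume : Measure ℝ))]
    refine lintegral_congr fun a => ?_
    by_cases h1 : 0 < a
    · have : ¬ a < E := by linarith
      simp [this]
    · simp [h1]

theorem setLIntegral_Ioi_scale {c : ℝ} (hc : 0 < c) (F : ℝ → ℝ≥0∞) :
    ∫⁻ a in Ioi 0, F a = ∫⁻ r in Ioi (0 : ℝ), ENNReal.ofReal c * F (c * r) := by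
  have h := lintegral_image_eq_lintegral_abs_deriv_mul (s := Ioi (0 : ℝ)) (f := fun r => c * r)
    (f' := fun _ => c) measurableSet_Ioi
    (fun x _ => (hasDerivAt_const_mul c).hasDerivWithinAt)
    (fun x _ y _ hxy => mul_left_cancel₀ hc.ne' hxy) F
  have himg : (fun r : ℝ => c * r) '' Ioi 0 = Ioi 0 := by
    rw [image_mul_left_Ioi hc]; simp
  rw [himg] at h
  rw [h, abs_of_pos hc]

theorem setLIntegral_Ioi_sq (F : ℝ → ℝ≥0∞) :
    ∫⁻ q in Ioi (0 : ℝ), F q = ∫⁻ s in Ioi (0 : ℝ), ENNReal.ofReal (2 * s) * F (s ^ 2) := by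
  have h := lintegral_image_eq_lintegral_abs_deriv_mul (s := Ioi (0 : ℝ)) (f := fun r => r ^ 2)
    (f' := fun s => 2 * s) measurableSet_Ioi
    (fun x _ => by simpa using (hasDerivAt_pow 2 x).hasDerivWithinAt)
    (fun x hx y hy hxy => (sq_eq_sq₀ (show 0 ≤ x from le_of_lt hx)
      (show 0 ≤ y from le_of_lt hy)).1 hxy) F
  have himg : (fun r : ℝ => r ^ 2) '' Ioi 0 = Ioi 0 := by
    ext y
    constructor
    · rintro ⟨x, hx, rfl⟩
      have hx' : (0 : ℝ) < x := hx
      exact mem_Ioi.2 (show (0 : ℝ) < x ^ 2 by positivity)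
    · intro hy
      exact ⟨√y, Real.sqrt_pos.2 hy, Real.sq_sqrt (le_of_lt hy)⟩
  rw [himg] at h
  rw [h]
  refine setLIntegral_congr_fun measurableSet_Ioi fun s hs => ?_
  rw [abs_of_pos (by have : (0:ℝ) < s := hs; positivity)]

/-- Polar coordinates in velocity space. -/
theorem lintegral_polar {G : Vel → ℝ≥0∞} (hG : Measurable G) :
    ∫⁻ w, G w = ∫⁻ σ : Metric.sphere (0 : Vel) 1, (∫⁻ s in Ioi (0 : ℝ),
      ENNReal.ofReal (s ^ 2) * G (s • (σ : Vel)))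
      ∂(volume : Measure Vel).toSphere := by
  have h0 : ∫⁻ w, G w = ∫⁻ w : ({(0 : Vel)}ᶜ : Set Vel), G w
      ∂(Measure.comap Subtype.val (volume : Measure Vel)) := by
    rw [lintegral_subtype_comap (measurableSet_singleton _).compl, restrict_compl_singleton]
  have hmp := (volume : Measure Vel).measurePreserving_homeomorphUnitSphereProd
  have hmp' := hmp.symm (homeomorphUnitSphereProd Vel).toMeasurableEquiv
  rw [h0, ← hmp'.lintegral_comp_emb (MeasurableEquiv.measurableEmbedding _)
      (fun w : ({(0 : Vel)}ᶜ : Set Vel) => G w), lintegral_prod]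
  swap
  · refine (hG.comp (measurable_subtype_coe.comp ?_)).aemeasurable
    exact MeasurableEquiv.measurable _
  refine lintegral_congr fun σ => ?_
  have hd : Module.finrank ℝ Vel - 1 = 2 := by simp
  rw [Measure.volumeIoiPow, lintegral_withDensity_eq_lintegral_mul]
  · rw [hd, ← lintegral_subtype_comap measurableSet_Ioi]
    rfl
  · fun_prop
  · refine hG.comp (measurable_subtype_coe.comp ?_)
    exact (MeasurableEquiv.measurable _).comp measurable_prodMk_left

/-- The surface measure of the sphere is invariant under the antipodal map. -/
theorem measurePreserving_neg_sphere :
    MeasurePreserving (fun σ : Metric.sphere (0 : Vel) 1 => -σ)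
      (volume : Measure Vel).toSphere (volume : Measure Vel).toSphere := by
  refine ⟨measurable_neg, ?_⟩
  ext s hs
  rw [Measure.map_apply measurable_neg hs, Measure.toSphere_apply' _ hs,
    Measure.toSphere_apply' _ (measurable_neg hs)]
  congr 1
  have : (Ioo (0:ℝ) 1 • (Subtype.val '' ((fun σ : Metric.sphere (0 : Vel) 1 => -σ) ⁻¹' s)) :
      Set Vel)
      = (fun v => -v) ⁻¹' (Ioo (0:ℝ) 1 • (Subtype.val '' s)) := by
    ext v
    simp only [Set.mem_smul, mem_preimage]
    constructor
    · rintro ⟨r, hr, _, ⟨σ, hσ, rfl⟩, rfl⟩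
      exact ⟨r, hr, _, ⟨-σ, hσ, rfl⟩, by simp⟩
    · rintro ⟨r, hr, _, ⟨σ, hσ, rfl⟩, h⟩
      refine ⟨r, hr, _, ⟨-σ, by simpa using hσ, rfl⟩, ?_⟩
      rw [← neg_neg v, ← h]; simp
  rw [this]
  exact Measure.measure_preimage_neg volume _

/-! ### Collisions in centre of mass coordinates -/

instance : SigmaFinite stateMeasure := by unfold stateMeasure; infer_instance

instance : IsFiniteMeasure paramMeasure := by unfold paramMeasure; infer_instance

/-- Passage to the centre of mass: `(v, v_*) = (V + w, V - w)`. -/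
theorem lintegral_centerOfMass {G : Vel × Vel → ℝ≥0∞} (hG : Measurable G) :
    ∫⁻ v, ∫⁻ v', G (v, v') = ∫⁻ V, ∫⁻ w, 8 * G (V + w, V - w) := by
  have h1 : ∀ v : Vel, ∫⁻ v', G (v, v') = ∫⁻ w, 8 * G (v, v - (2 : ℝ) • w) := by
    intro v
    have hm : Measurable fun w => G (v, v - w) := hG.comp (by fun_prop)
    have hmap := Measure.map_addHaar_smul (volume : Measure Vel) (r := (2 : ℝ)) two_ne_zero
    rw [lintegral_const_mul (f := fun w => G (v, v - (2 : ℝ) • w)) _ (hG.comp (by fun_prop)),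
      ← lintegral_map (f := fun w => G (v, v - w)) hm (measurable_const_smul (2 : ℝ)),
      hmap, lintegral_smul_measure, lintegral_sub_left_eq_self (fun w => G (v, w)) v]
    have : (8 : ℝ≥0∞) * ENNReal.ofReal |((2:ℝ) ^ Module.finrank ℝ Vel)⁻¹| = 1 := by
      have e : |((2:ℝ) ^ Module.finrank ℝ Vel)⁻¹| = 8⁻¹ := by
        rw [abs_of_pos (by positivity)]; norm_num
      rw [e, ENNReal.ofReal_inv_of_pos (by norm_num)]
      norm_num
      exact ENNReal.mul_inv_cancel (by norm_num) (by norm_num)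
    rw [smul_eq_mul, ← mul_assoc, this, one_mul]
  simp_rw [h1]
  refine (lintegral_lintegral_swap ?_).trans
    (Eq.trans ?_ (lintegral_lintegral_swap ?_).symm)
  rotate_left
  · refine lintegral_congr fun w => ?_
    rw [← lintegral_add_right_eq_self (fun v => 8 * G (v, v - (2 : ℝ) • w)) w]
    refine lintegral_congr fun V => ?_
    have : V + w - (2 : ℝ) • w = V - w := by rw [two_smul]; abel
    rw [this]
  · exact ((hG.comp (by fun_prop)).const_mul _).aemeasurable
  · exact ((hG.comp (by fun_prop)).const_mul _).aemeasurable

/-- The state of the first molecule with centre of mass velocity `V`, collisional energy `E` and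
parameters `p = (σ, r, R)`; for `V`, `E` taken from a pair this is `post`. -/
def outState (m : ℝ) (V : Vel) (E : ℝ) (p : Param) : State :=
  (V + √(p.2.2 * E / m) • (p.1 : Vel), p.2.1 * (1 - p.2.2) * E)

/-- The state of the second molecule in centre of mass coordinates, see `outState`. -/
def outStateStar (m : ℝ) (V : Vel) (E : ℝ) (p : Param) : State :=
  (V - √(p.2.2 * E / m) • (p.1 : Vel), (1 - p.2.1) * (1 - p.2.2) * E)

/-- The Jacobian factor depending on the energy in centre of mass coordinates. -/
def energyWeight (m E : ℝ) : ℝ := 4 * E ^ 2 * √E / (m * √m)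

/-- The Jacobian factor depending on the parameters in centre of mass coordinates. -/
def paramWeight (p : Param) : ℝ := √p.2.2 * (1 - p.2.2)

/-- The three energies `m s², I, I_*` in terms of total energy and the two fractions. -/
theorem lintegral_energies {m : ℝ} (hm : 0 < m) {K : ℝ × ℝ × ℝ → ℝ≥0∞} (hK : Measurable K) :
    ∫⁻ s in Ioi (0 : ℝ), ENNReal.ofReal (s ^ 2) *
        (8 * ∫⁻ I in Ioi (0 : ℝ), ∫⁻ J in Ioi (0 : ℝ), K (s, I, J)) =
      ∫⁻ E in Ioi (0 : ℝ), ∫⁻ R in Ioo (0 : ℝ) 1, ∫⁻ r in Ioo (0 : ℝ) 1,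
        ENNReal.ofReal (energyWeight m E * (√R * (1 - R))) *
          K (√(R * E / m), r * (1 - R) * E, (1 - r) * (1 - R) * E) := by
  -- the kinetic energy `e = m s²` as a coordinate; then `setLIntegral_triangle` is used twice, for
  -- `r` and for `R`
  have h1 : ∀ g : ℝ → ℝ≥0∞, ∫⁻ s in Ioi (0 : ℝ), ENNReal.ofReal (s ^ 2) * (8 * g s)
      = ∫⁻ e in Ioi (0 : ℝ), ENNReal.ofReal (4 * √e / (m * √m)) * g (√(e / m)) := by
    intro g
    have a1 := setLIntegral_Ioi_sq (fun q => ENNReal.ofReal (4 * √q) * g (√q))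
    have a2 := setLIntegral_Ioi_scale (inv_pos.2 hm) (fun q => ENNReal.ofReal (4 * √q) * g (√q))
    have a3 : ∫⁻ s in Ioi (0 : ℝ), ENNReal.ofReal (s ^ 2) * (8 * g s) =
        ∫⁻ s in Ioi (0 : ℝ), ENNReal.ofReal (2 * s) *
          (ENNReal.ofReal (4 * √(s ^ 2)) * g √(s ^ 2)) := by
      refine setLIntegral_congr_fun measurableSet_Ioi fun s hs => ?_
      have hs' : 0 < s := hs
      simp only [Real.sqrt_sq hs'.le]
      rw [← mul_assoc, ← mul_assoc, ← ENNReal.ofReal_mul (by positivity),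
        show (8 : ℝ≥0∞) = ENNReal.ofReal 8 by simp, ← ENNReal.ofReal_mul (by positivity)]
      congr 2; ring
    rw [a3, ← a1, a2]
    refine setLIntegral_congr_fun measurableSet_Ioi fun s hs => ?_
    have hs' : 0 < s := hs
    rw [← mul_assoc, ← ENNReal.ofReal_mul (by positivity)]
    have : m⁻¹ * s = s / m := by rw [div_eq_inv_mul]
    rw [this, Real.sqrt_div hs'.le]
    congr 2
    field_simp
  rw [h1]
  have h2 : ∀ s : ℝ, ∫⁻ I in Ioi (0 : ℝ), ∫⁻ J in Ioi (0 : ℝ), K (s, I, J) =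
      ∫⁻ J in Ioi (0 : ℝ), ∫⁻ r in Ioo (0 : ℝ) 1,
        ENNReal.ofReal J * K (s, r * J, (1 - r) * J) := fun s =>
    setLIntegral_triangle (F := fun I J => K (s, I, J)) (hK.comp (by fun_prop))
  simp_rw [h2]
  have hm3 : Measurable fun q : (ℝ × ℝ) × ℝ => ENNReal.ofReal q.1.2 *
      K (√(q.1.1 / m), q.2 * q.1.2, (1 - q.2) * q.1.2) :=
    Measurable.mul (by fun_prop) (hK.comp (by fun_prop))
  have hm4 : Measurable fun q : ℝ × ℝ => ∫⁻ r in Ioo (0 : ℝ) 1, ENNReal.ofReal q.2 *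
      K (√(q.1 / m), r * q.2, (1 - r) * q.2) := hm3.lintegral_prod_right'
  have h3 := setLIntegral_triangle (F := fun e J => ENNReal.ofReal (4 * √e / (m * √m)) *
    ∫⁻ r in Ioo (0 : ℝ) 1, ENNReal.ofReal J * K (√(e / m), r * J, (1 - r) * J))
    (Measurable.mul (by fun_prop) hm4)
  have h4 : ∀ e : ℝ, ENNReal.ofReal (4 * √e / (m * √m)) * ∫⁻ J in Ioi (0 : ℝ),
      ∫⁻ r in Ioo (0 : ℝ) 1, ENNReal.ofReal J * K (√(e / m), r * J, (1 - r) * J)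
      = ∫⁻ J in Ioi (0 : ℝ), ENNReal.ofReal (4 * √e / (m * √m)) *
    ∫⁻ r in Ioo (0 : ℝ) 1, ENNReal.ofReal J * K (√(e / m), r * J, (1 - r) * J) := fun e => by
    rw [lintegral_const_mul]
    exact hm4.comp (measurable_prodMk_left (x := e))
  simp_rw [h4]
  rw [h3]
  refine setLIntegral_congr_fun measurableSet_Ioi fun E hE => ?_
  refine setLIntegral_congr_fun measurableSet_Ioo fun R hR => ?_
  have hE' : 0 < E := hE
  have hR0 : 0 < R := hR.1
  have hR1 : 0 < 1 - R := sub_pos.2 hR.2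
  rw [← mul_assoc, ← ENNReal.ofReal_mul (by positivity), ← lintegral_const_mul']
  swap; · exact ENNReal.ofReal_ne_top
  refine lintegral_congr fun r => ?_
  rw [← mul_assoc, ← ENNReal.ofReal_mul (by positivity)]
  congr 2
  · rw [energyWeight, Real.sqrt_mul hR0.le]; ring
  · rw [mul_assoc, mul_assoc]

/-- Integration over pairs of molecules in centre of mass coordinates: the pair with centre of mass
velocity `V` and energy `E` is parametrised by the same formulas as the outgoing pair. -/
theorem lintegral_pair {m : ℝ} (hm : 0 < m) {F : State × State → ℝ≥0∞} (hF : Measurable F) :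
    ∫⁻ x, ∫⁻ y, F (x, y) ∂stateMeasure ∂stateMeasure =
      ∫⁻ V : Vel, ∫⁻ E in Ioi (0 : ℝ), ∫⁻ q, ENNReal.ofReal (energyWeight m E * paramWeight q) *
        F (outState m V E q, outStateStar m V E q) ∂paramMeasure := by
  have h1 : ∫⁻ x, ∫⁻ y, F (x, y) ∂stateMeasure ∂stateMeasure
      = ∫⁻ v : Vel, ∫⁻ v' : Vel, ∫⁻ I in Ioi (0 : ℝ), ∫⁻ J in Ioi (0 : ℝ),
        F ((v, I), (v', J)) := by
    unfold stateMeasure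
    rw [lintegral_prod _ (Measurable.aemeasurable (Measurable.lintegral_prod_right' hF))]
    refine lintegral_congr fun v => ?_
    have h2 : ∀ I : ℝ, ∫⁻ y, F ((v, I), y) ∂(volume : Measure Vel).prod (volume.restrict (Ioi 0))
        = ∫⁻ v' : Vel, ∫⁻ J in Ioi (0 : ℝ), F ((v, I), (v', J)) := fun I =>
      lintegral_prod _ (hF.comp (by fun_prop)).aemeasurable
    simp_rw [h2]
    refine lintegral_lintegral_swap (Measurable.aemeasurable ?_)
    have : Measurable fun q : (ℝ × Vel) × ℝ => F ((v, q.1.1), (q.1.2, q.2)) :=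
      hF.comp (by fun_prop)
    exact this.lintegral_prod_right'
  have hm1 : Measurable fun q : Vel × Vel => ∫⁻ I in Ioi (0 : ℝ), ∫⁻ J in Ioi (0 : ℝ),
      F ((q.1, I), (q.2, J)) := by
    have : Measurable fun q : ((Vel × Vel) × ℝ) × ℝ => F ((q.1.1.1, q.1.2), (q.1.1.2, q.2)) :=
      hF.comp (by fun_prop)
    exact this.lintegral_prod_right'.lintegral_prod_right'
  rw [h1, lintegral_centerOfMass hm1]
  refine lintegral_congr fun V => ?_
  refine (lintegral_polar (G := fun w => 8 * ∫⁻ I in Ioi (0 : ℝ), ∫⁻ J in Ioi (0 : ℝ),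
    F ((V + w, I), (V - w, J))) (Measurable.const_mul (hm1.comp
      (f := fun w : Vel => (V + w, V - w)) (by fun_prop)) 8)).trans ?_
  have h3 : ∀ σ : Metric.sphere (0 : Vel) 1, _ := fun σ => lintegral_energies hm
    (K := fun k => F ((V + k.1 • (σ : Vel), k.2.1), (V - k.1 • (σ : Vel), k.2.2)))
    (hF.comp (by fun_prop))
  simp_rw [h3]
  have hm2 : Measurable fun q : ((Metric.sphere (0 : Vel) 1 × ℝ) × ℝ) × ℝ =>
      ENNReal.ofReal (energyWeight m q.1.1.2 * (√q.1.2 * (1 - q.1.2))) *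
        F ((V + √(q.1.2 * q.1.1.2 / m) • (q.1.1.1 : Vel), q.2 * (1 - q.1.2) * q.1.1.2),
          (V - √(q.1.2 * q.1.1.2 / m) • (q.1.1.1 : Vel), (1 - q.2) * (1 - q.1.2) * q.1.1.2)) := by
    unfold energyWeight
    exact Measurable.mul (by fun_prop) (hF.comp (by fun_prop))
  rw [lintegral_lintegral_swap
    (hm2.lintegral_prod_right'.lintegral_prod_right').aemeasurable]
  refine lintegral_congr fun E => ?_
  have hm3 : Measurable fun q : Param =>
      ENNReal.ofReal (energyWeight m E * paramWeight q) *
        F (outState m V E q, outStateStar m V E q) := by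
    unfold paramWeight outState outStateStar
    exact Measurable.mul (by fun_prop) (hF.comp (by fun_prop))
  unfold paramMeasure
  rw [lintegral_prod _ hm3.aemeasurable]
  refine lintegral_congr fun σ => ?_
  exact (lintegral_prod_symm _ (hm3.comp measurable_prodMk_left).aemeasurable).symm

/-! ### Integrals of zonal functions over the half sphere -/

theorem lintegral_plane_radial {h : ℝ → ℝ≥0∞} (hh : Measurable h) :
    ∫⁻ p : ℝ × ℝ, h (p.1 ^ 2 + p.2 ^ 2) = ENNReal.ofReal Real.pi * ∫⁻ q in Ioi (0 : ℝ), h q := by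
  rw [← lintegral_comp_polarCoord_symm, setLIntegral_Ioi_sq]
  have e : ∀ p : ℝ × ℝ, (polarCoord.symm p).1 ^ 2 + (polarCoord.symm p).2 ^ 2 = p.1 ^ 2 := by
    intro p
    simp only [polarCoord_symm_apply]
    linear_combination p.1 ^ 2 * Real.sin_sq_add_cos_sq p.2
  simp_rw [e]
  have ht : (volume : Measure (ℝ × ℝ)).restrict polarCoord.target
      = ((volume : Measure ℝ).restrict (Ioi 0)).prod
        ((volume : Measure ℝ).restrict (Ioo (-Real.pi) Real.pi)) := by
    rw [Measure.prod_restrict]; rfl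
  rw [ht, lintegral_prod _ (by fun_prop), ← lintegral_const_mul _ (by fun_prop)]
  refine setLIntegral_congr_fun measurableSet_Ioi fun s hs => ?_
  have hs' : 0 < s := hs
  simp only [lintegral_const, Measure.restrict_apply_univ, Real.volume_Ioo, smul_eq_mul]
  rw [mul_right_comm, ← ENNReal.ofReal_mul hs'.le, ← mul_assoc,
    ← ENNReal.ofReal_mul Real.pi_pos.le]
  congr 2; ring

/-- Cylindrical coordinates about the axis `u`. -/
theorem lintegral_cylindrical {u : Vel} (hu : ‖u‖ = 1) {k : ℝ × ℝ → ℝ≥0∞} (hk : Measurable k) :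
    ∫⁻ w : Vel, k (inner ℝ u w, ‖w‖ ^ 2) =
      ENNReal.ofReal Real.pi * ∫⁻ z : ℝ, ∫⁻ q in Ioi (0 : ℝ), k (z, z ^ 2 + q) := by
  obtain ⟨b, hb⟩ := Orthonormal.exists_orthonormalBasis_extension_of_card_eq (𝕜 := ℝ) (E := Vel)
    (ι := Fin 3) (by simp) (v := fun _ => u) (s := {0}) (by
      refine ⟨fun i => by simpa using hu, fun i j hij => ?_⟩
      exact absurd (Subsingleton.elim i j) hij)
  have hb0 : b 0 = u := hb 0 rfl
  have e1 : ∫⁻ w : Vel, k (inner ℝ u w, ‖w‖ ^ 2)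
      = ∫⁻ x : EuclideanSpace ℝ (Fin 3), k (x 0, x 0 ^ 2 + (x 1 ^ 2 + x 2 ^ 2)) := by
    rw [← b.measurePreserving_repr.lintegral_comp_emb b.repr.toHomeomorph.measurableEmbedding
      (fun x : EuclideanSpace ℝ (Fin 3) => k (x 0, x 0 ^ 2 + (x 1 ^ 2 + x 2 ^ 2)))]
    refine lintegral_congr fun w => ?_
    have h1 : inner ℝ u w = b.repr w 0 := by rw [← hb0, b.repr_apply_apply]
    have h2 : ‖w‖ ^ 2 = b.repr w 0 ^ 2 + (b.repr w 1 ^ 2 + b.repr w 2 ^ 2) := by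
      rw [← b.repr.norm_map w, EuclideanSpace.norm_sq_eq]
      simp [Fin.sum_univ_three, add_assoc]
    rw [h1, h2]
  have e2 : ∫⁻ x : EuclideanSpace ℝ (Fin 3), k (x 0, x 0 ^ 2 + (x 1 ^ 2 + x 2 ^ 2))
      = ∫⁻ z : ℝ × (Fin 2 → ℝ), k (z.1, z.1 ^ 2 + (z.2 0 ^ 2 + z.2 1 ^ 2)) := by
    rw [← ((volume_preserving_piFinSuccAbove (fun _ : Fin 3 => ℝ) 0).comp
      (EuclideanSpace.volume_preserving_symm_measurableEquiv_toLp (Fin 3))).lintegral_comp]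
    · rfl
    · exact hk.comp (by fun_prop)
  have e3 : ∫⁻ z : ℝ × (Fin 2 → ℝ), k (z.1, z.1 ^ 2 + (z.2 0 ^ 2 + z.2 1 ^ 2))
      = ∫⁻ z : ℝ, ∫⁻ p : ℝ × ℝ, k (z, z ^ 2 + (p.1 ^ 2 + p.2 ^ 2)) := by
    refine (lintegral_prod (fun z : ℝ × (Fin 2 → ℝ) => k (z.1, z.1 ^ 2 + (z.2 0 ^ 2 + z.2 1 ^ 2)))
      (hk.comp (by fun_prop)).aemeasurable).trans ?_
    refine lintegral_congr fun z => ?_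
    exact (volume_preserving_finTwoArrow ℝ).lintegral_comp
      (f := fun p : ℝ × ℝ => k (z, z ^ 2 + (p.1 ^ 2 + p.2 ^ 2))) (hk.comp (by fun_prop))
  have hm : Measurable fun z : ℝ => ∫⁻ q in Ioi (0 : ℝ), k (z, z ^ 2 + q) := by
    have : Measurable fun p : ℝ × ℝ => k (p.1, p.1 ^ 2 + p.2) := hk.comp (by fun_prop)
    exact this.lintegral_prod_right'
  rw [e1, e2, e3, ← lintegral_const_mul _ hm]
  refine lintegral_congr fun z => ?_
  exact lintegral_plane_radial (h := fun q => k (z, z ^ 2 + q)) (hk.comp (by fun_prop))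

open Classical in
/-- Archimedes' hat-box theorem on the half sphere: the height `u · σ` is uniformly distributed. -/
theorem lintegral_sphere_inner {u : Vel} (hu : ‖u‖ = 1) {g : ℝ → ℝ≥0∞} (hg : Measurable g) :
    ∫⁻ σ : Metric.sphere (0 : Vel) 1,
        (if 0 ≤ inner ℝ u (σ : Vel) then g (inner ℝ u (σ : Vel)) else 0)
        ∂(volume : Measure Vel).toSphere
      = ENNReal.ofReal (2 * Real.pi) * ∫⁻ c in Ioo (0 : ℝ) 1, g c := by
  -- both sides are compared through the integral of `g (u · w / |w|)` over the unit half ball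
  set k : ℝ × ℝ → ℝ≥0∞ := fun q => {q : ℝ × ℝ | 0 ≤ q.1 ∧ √q.2 < 1}.indicator
    (fun q => g (q.1 / √q.2)) q with hkdef
  have hk : Measurable k := by
    have hq : Measurable fun q : ℝ × ℝ => q.1 / √q.2 := by fun_prop
    refine Measurable.indicator (hg.comp hq) ?_
    exact (measurableSet_le measurable_const measurable_fst).inter
      (measurableSet_lt (Real.continuous_sqrt.measurable.comp measurable_snd) measurable_const)
  set N : ℝ≥0∞ := ∫⁻ s in Ioo (0 : ℝ) 1, ENNReal.ofReal (s ^ 2) with hN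
  have hN0 : N ≠ 0 := by
    rw [hN]
    refine (setLIntegral_pos_iff (f := fun s : ℝ => ENNReal.ofReal (s ^ 2))
      (by fun_prop)).2 ?_ |>.ne'
    have : (Function.support fun s : ℝ => ENNReal.ofReal (s ^ 2)) ∩ Ioo 0 1 = Ioo 0 1 := by
      refine inter_eq_right.2 fun s hs => ?_
      have : 0 < s := hs.1
      simp [this.ne']
    rw [this]; simp
  have hNt : N ≠ ∞ := by
    refine ne_of_lt (lt_of_le_of_lt (setLIntegral_mono (g := fun _ => 1) measurable_const ?_) ?_)
    · intro s hs
      rw [ENNReal.ofReal_le_one]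
      exact pow_le_one₀ hs.1.le hs.2.le
    · simp
  have hleft : ∫⁻ w : Vel, k (inner ℝ u w, ‖w‖ ^ 2) = N *
      ∫⁻ σ : Metric.sphere (0 : Vel) 1,
        (if 0 ≤ inner ℝ u (σ : Vel) then g (inner ℝ u (σ : Vel)) else 0)
        ∂(volume : Measure Vel).toSphere := by
    rw [lintegral_polar (G := fun w => k (inner ℝ u w, ‖w‖ ^ 2)) (hk.comp (by fun_prop)),
      ← lintegral_const_mul']
    swap; · exact hNt
    refine lintegral_congr fun σ => ?_
    rw [hN, ← lintegral_mul_const _ (by fun_prop), ← lintegral_indicator measurableSet_Ioi,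
      ← lintegral_indicator measurableSet_Ioo]
    refine lintegral_congr fun s => ?_
    by_cases hs : 0 < s
    · have h1 : ‖s • (σ : Vel)‖ = s := by rw [norm_smul]; simp [abs_of_pos hs]
      have h2 : inner ℝ u (s • (σ : Vel)) = s * inner ℝ u (σ : Vel) := inner_smul_right _ _ _
      have hkey : k (inner ℝ u (s • (σ : Vel)), ‖s • (σ : Vel)‖ ^ 2)
          = k (s * inner ℝ u (σ : Vel), s ^ 2) := by rw [h1, h2]
      simp only [indicator, mem_Ioi, hs, if_true]
      rw [hkey]
      by_cases h3 : s < 1 <;> by_cases h4 : 0 ≤ inner ℝ u (σ : Vel) <;>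
        simp [hkdef, hs, h3, h4, indicator, Real.sqrt_sq hs.le, mul_div_cancel_left₀, hs.ne',
          mul_nonneg_iff_of_pos_left]
    · simp [hs]
  have hright : ∫⁻ z : ℝ, ∫⁻ q in Ioi (0 : ℝ), k (z, z ^ 2 + q)
      = 2 * N * ∫⁻ c in Ioo (0 : ℝ) 1, g c := by
    have e1 : ∀ z : ℝ, ∫⁻ q in Ioi (0 : ℝ), k (z, z ^ 2 + q)
        = ∫⁻ e, (Ioi (z ^ 2)).indicator (fun e => k (z, e)) e := by
      intro z
      rw [← lintegral_indicator measurableSet_Ioi,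
        ← lintegral_add_left_eq_self (fun e => (Ioi (z ^ 2)).indicator (fun e => k (z, e)) e)
          (z ^ 2)]
      refine lintegral_congr fun q => ?_
      by_cases h : 0 < q <;> simp [h, indicator]
    simp_rw [e1]
    rw [lintegral_lintegral_swap]
    swap
    · refine Measurable.aemeasurable ?_
      have : (Function.uncurry fun z e : ℝ => (Ioi (z ^ 2)).indicator (fun e => k (z, e)) e)
          = {q : ℝ × ℝ | q.1 ^ 2 < q.2}.indicator k := by
        ext q; rcases q with ⟨z, e⟩
        by_cases h : z ^ 2 < e <;> simp [h, indicator]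
      rw [this]
      exact hk.indicator (measurableSet_lt (by fun_prop) measurable_snd)
    have e2 : ∀ e : ℝ, ∫⁻ z, (Ioi (z ^ 2)).indicator (fun e => k (z, e)) e
        = (Ioi (0 : ℝ)).indicator (fun e => (if √e < 1 then ENNReal.ofReal √e else 0) *
          ∫⁻ c in Ioo (0 : ℝ) 1, g c) e := by
      intro e
      by_cases he : 0 < e
      · have hse : 0 < √e := Real.sqrt_pos.2 he
        rw [indicator_of_mem (by exact he)]
        by_cases h1 : √e < 1
        · rw [if_pos h1, ← lintegral_const_mul _ hg]
          have := setLIntegral_Ioo_scale hse (fun z => g (z / √e))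
          have e3 : ∀ r : ℝ, g (r * √e / √e) = g r := fun r => by
            rw [mul_div_cancel_right₀ _ hse.ne']
          simp_rw [e3] at this
          rw [← this, Measure.restrict_congr_set Ioo_ae_eq_Ico,
            ← lintegral_indicator measurableSet_Ico]
          refine lintegral_congr fun z => ?_
          by_cases hz : 0 ≤ z
          · have : z ^ 2 < e ↔ z < √e := (Real.lt_sqrt hz).symm
            by_cases hz2 : z < √e <;> simp [indicator, hkdef, this, hz, hz2, h1]
          · simp [indicator, hkdef, hz]
        · rw [if_neg h1, zero_mul, ← lintegral_zero (μ := (volume : Measure ℝ))]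
          refine lintegral_congr fun z => ?_
          simp [indicator, hkdef, h1]
      · rw [indicator_of_notMem (by exact he), ← lintegral_zero (μ := (volume : Measure ℝ))]
        refine lintegral_congr fun z => ?_
        rw [indicator_of_notMem]
        simp only [mem_Ioi, not_lt]
        exact (not_lt.1 he).trans (sq_nonneg z)
    simp_rw [e2]
    rw [lintegral_indicator measurableSet_Ioi, lintegral_mul_const _ (by
      refine Measurable.ite (measurableSet_lt (by fun_prop) measurable_const) ?_ ?_ <;> fun_prop),
      setLIntegral_Ioi_sq, hN]
    congr 1
    rw [← lintegral_const_mul _ (by fun_prop), ← lintegral_indicator measurableSet_Ioi,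
      ← lintegral_indicator measurableSet_Ioo]
    refine lintegral_congr fun s => ?_
    by_cases hs : 0 < s
    · by_cases h1 : s < 1
      · simp only [indicator, mem_Ioi, hs, mem_Ioo, h1, Real.sqrt_sq hs.le, and_self, if_true]
        rw [← ENNReal.ofReal_mul (by positivity), show (2 : ℝ≥0∞) = ENNReal.ofReal 2 by simp,
          ← ENNReal.ofReal_mul (by positivity)]
        congr 1; ring
      · simp [indicator, hs, h1, Real.sqrt_sq hs.le]
    · simp [indicator, hs]
  have := lintegral_cylindrical hu hk
  rw [hleft, hright] at this
  have h2 : N * (ENNReal.ofReal (2 * Real.pi) * ∫⁻ c in Ioo (0 : ℝ) 1, g c)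
      = ENNReal.ofReal Real.pi * (2 * N * ∫⁻ c in Ioo (0 : ℝ) 1, g c) := by
    rw [ENNReal.ofReal_mul (by norm_num)]
    simp only [ENNReal.ofReal_ofNat]
    ring
  rw [← h2] at this
  exact (ENNReal.mul_right_inj hN0 hNt).1 this

/-! ### Algebra of the collision rule -/

theorem ae_state_pos : ∀ᵐ x ∂stateMeasure, 0 < x.2 := by
  have : ∀ᵐ I ∂(volume : Measure ℝ).restrict (Ioi 0), 0 < I := ae_restrict_mem measurableSet_Ioi
  exact Measure.quasiMeasurePreserving_snd.ae this

theorem ae_vel_ne (x : State) : ∀ᵐ y ∂stateMeasure, x.1 ≠ y.1 := by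
  have : ∀ᵐ v ∂(volume : Measure Vel), x.1 ≠ v := by
    filter_upwards [compl_mem_ae_iff.2 (measure_singleton (μ := (volume : Measure Vel)) x.1)]
      with v hv h
    exact hv h.symm
  exact Measure.quasiMeasurePreserving_fst.ae this

theorem ae_param_mem :
    ∀ᵐ p ∂paramMeasure, p.2.1 ∈ Ioo (0 : ℝ) 1 ∧ p.2.2 ∈ Ioo (0 : ℝ) 1 := by
  have h : ∀ᵐ r ∂(volume : Measure ℝ).restrict (Ioo 0 1), r ∈ Ioo (0 : ℝ) 1 :=
    ae_restrict_mem measurableSet_Ioo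
  have h2 : ∀ᵐ q ∂((volume : Measure ℝ).restrict (Ioo 0 1)).prod
      ((volume : Measure ℝ).restrict (Ioo 0 1)), q.1 ∈ Ioo (0 : ℝ) 1 ∧ q.2 ∈ Ioo (0 : ℝ) 1 :=
    (Measure.quasiMeasurePreserving_fst.ae h).and (Measure.quasiMeasurePreserving_snd.ae h)
  exact Measure.quasiMeasurePreserving_snd.ae h2

section Algebra

variable {m : ℝ}

theorem bracket_sq (hm : 0 < m) {x : State} (hx : 0 ≤ x.2) :
    bracket m x ^ 2 = 1 + ‖x.1‖ ^ 2 / 2 + x.2 / m :=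
  Real.sq_sqrt (by positivity)

theorem bracket_nonneg (m : ℝ) (x : State) : 0 ≤ bracket m x := Real.sqrt_nonneg _

theorem one_le_bracket (hm : 0 < m) {x : State} (hx : 0 ≤ x.2) : 1 ≤ bracket m x := by
  have h := bracket_sq hm hx
  have h1 : 0 ≤ x.2 / m := by positivity
  nlinarith [bracket_nonneg m x, sq_nonneg ‖x.1‖]

theorem collEnergy_nonneg (hm : 0 < m) {x y : State} (hx : 0 ≤ x.2) (hy : 0 ≤ y.2) :
    0 ≤ collEnergy m x y := by
  unfold collEnergy; positivity

theorem collEnergy_pos (hm : 0 < m) {x y : State} (hx : 0 < x.2) (hy : 0 < y.2) :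
    0 < collEnergy m x y := by
  unfold collEnergy; positivity

theorem post_eq_outState (x y : State) (p : Param) :
    post m x y p = outState m ((1 / 2 : ℝ) • (x.1 + y.1)) (collEnergy m x y) p := rfl

theorem postStar_eq_outStateStar (x y : State) (p : Param) :
    postStar m x y p = outStateStar m ((1 / 2 : ℝ) • (x.1 + y.1)) (collEnergy m x y) p := rfl

theorem outState_add_outStateStar (V : Vel) (E : ℝ) (q : Param) :
    (1 / 2 : ℝ) • ((outState m V E q).1 + (outStateStar m V E q).1) = V := by
  simp only [outState, outStateStar]
  rw [add_add_sub_cancel, ← two_smul ℝ, smul_smul]; norm_num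

theorem outState_sub_outStateStar (V : Vel) (E : ℝ) (q : Param) :
    (outState m V E q).1 - (outStateStar m V E q).1 = (2 * √(q.2.2 * E / m)) • (q.1 : Vel) := by
  simp only [outState, outStateStar]
  rw [add_sub_sub_cancel, ← two_smul ℝ, smul_smul]

theorem norm_outState_sub (V : Vel) (E : ℝ) (q : Param) :
    ‖(outState m V E q).1 - (outStateStar m V E q).1‖ = 2 * √(q.2.2 * E / m) := by
  rw [outState_sub_outStateStar, norm_smul]
  simp

theorem collEnergy_outState (hm : 0 < m) (V : Vel) {E : ℝ} (hE : 0 ≤ E) {q : Param}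
    (hR : 0 ≤ q.2.2) : collEnergy m (outState m V E q) (outStateStar m V E q) = E := by
  unfold collEnergy
  rw [norm_outState_sub, mul_pow, Real.sq_sqrt (by positivity)]
  simp only [outState, outStateStar]
  field_simp
  ring

theorem post_outState (hm : 0 < m) (V : Vel) {E : ℝ} (hE : 0 ≤ E) {q : Param}
    (hR : 0 ≤ q.2.2) (p : Param) :
    post m (outState m V E q) (outStateStar m V E q) p = outState m V E p := by
  rw [post_eq_outState, outState_add_outStateStar, collEnergy_outState hm V hE hR]

theorem postStar_outState (hm : 0 < m) (V : Vel) {E : ℝ} (hE : 0 ≤ E) {q : Param}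
    (hR : 0 ≤ q.2.2) (p : Param) :
    postStar m (outState m V E q) (outStateStar m V E q) p = outStateStar m V E p := by
  rw [postStar_eq_outStateStar, outState_add_outStateStar, collEnergy_outState hm V hE hR]

theorem cosDev_outState (hm : 0 < m) (V : Vel) {E : ℝ} (hE : 0 < E) {q : Param}
    (hR : 0 < q.2.2) (p : Param) :
    cosDev (outState m V E q) (outStateStar m V E q) p = inner ℝ (q.1 : Vel) (p.1 : Vel) := by
  unfold cosDev
  have h : 0 < √(q.2.2 * E / m) := Real.sqrt_pos.2 (by positivity)
  rw [norm_outState_sub, outState_sub_outStateStar, smul_smul, inv_mul_cancel₀ (by positivity),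
    one_smul]

/-- The pair of squared brackets in terms of the centre of mass velocity and the energy. -/
theorem bracket_sq_add (hm : 0 < m) {x y : State} (hx : 0 ≤ x.2) (hy : 0 ≤ y.2) :
    bracket m x ^ 2 + bracket m y ^ 2
      = 2 + ‖(1 / 2 : ℝ) • (x.1 + y.1)‖ ^ 2 + collEnergy m x y / m := by
  rw [bracket_sq hm hx, bracket_sq hm hy, collEnergy, norm_smul]
  have := parallelogram_law_with_norm ℝ x.1 y.1
  have h2 : ‖x.1 + y.1‖ ^ 2 = 2 * ‖x.1‖ ^ 2 + 2 * ‖y.1‖ ^ 2 - ‖x.1 - y.1‖ ^ 2 := by nlinarith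
  rw [mul_pow, h2]
  field_simp
  norm_num
  ring

theorem outState_snd_nonneg {V : Vel} {E : ℝ} (hE : 0 ≤ E) {p : Param}
    (hr : p.2.1 ∈ Ioo (0 : ℝ) 1) (hR : p.2.2 ∈ Ioo (0 : ℝ) 1) : 0 ≤ (outState m V E p).2 :=
  mul_nonneg (mul_nonneg hr.1.le (sub_nonneg.2 hR.2.le)) hE

theorem outStateStar_snd_nonneg {V : Vel} {E : ℝ} (hE : 0 ≤ E) {p : Param}
    (hr : p.2.1 ∈ Ioo (0 : ℝ) 1) (hR : p.2.2 ∈ Ioo (0 : ℝ) 1) : 0 ≤ (outStateStar m V E p).2 :=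
  mul_nonneg (mul_nonneg (sub_nonneg.2 hr.2.le) (sub_nonneg.2 hR.2.le)) hE

/-- Conservation of energy in a collision. -/
theorem bracket_sq_post_add (hm : 0 < m) {x y : State} (hx : 0 ≤ x.2) (hy : 0 ≤ y.2) {p : Param}
    (hr : p.2.1 ∈ Ioo (0 : ℝ) 1) (hR : p.2.2 ∈ Ioo (0 : ℝ) 1) :
    bracket m (post m x y p) ^ 2 + bracket m (postStar m x y p) ^ 2
      = bracket m x ^ 2 + bracket m y ^ 2 := by
  have hE := collEnergy_nonneg hm hx hy
  rw [bracket_sq_add hm hx hy, post_eq_outState, postStar_eq_outStateStar,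
    bracket_sq_add hm (outState_snd_nonneg hE hr hR) (outStateStar_snd_nonneg hE hr hR),
    outState_add_outStateStar, collEnergy_outState hm _ hE hR.1.le]

/-- Each outgoing molecule takes at least a fixed fraction of the energy of the pair, whatever the
states and the direction `σ`: the quadratic form `(|V| - √R e)² / 2 + ρ (1 - R) e²` in
`(|V|, e)`, `e² = E / m`, is positive definite. -/
theorem fraction_le_bracket_sq (hm : 0 < m) {V : Vel} {E ρ : ℝ} (hE : 0 ≤ E) {R : ℝ}
    (hR : R ∈ Ioo (0 : ℝ) 1) (hρ : 0 < ρ) (hρ1 : ρ ≤ 1) (w : Vel) (hw : ‖w‖ = √(R * E / m)) :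
    ρ * (1 - R) / 6 * (2 + ‖V‖ ^ 2 + E / m) ≤
      1 + ‖V + w‖ ^ 2 / 2 + ρ * (1 - R) * E / m := by
  have h1 : (‖V‖ - ‖w‖) ^ 2 ≤ ‖V + w‖ ^ 2 := by
    have := abs_norm_sub_norm_le V (-w)
    rw [norm_neg, sub_neg_eq_add] at this
    exact sq_le_sq' (by linarith [abs_le.1 this]) (abs_le.1 this).2
  have hw2 : ‖w‖ ^ 2 = R * (E / m) := by
    rw [hw, Real.sq_sqrt (by have := hR.1; positivity)]; ring
  have he : 0 ≤ E / m := by positivity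
  set e := E / m with hedef
  have h2 : ρ * (1 - R) * E / m = ρ * (1 - R) * e := by rw [hedef]; ring
  rw [h2]
  set δ := ρ * (1 - R) with hδ
  have hR0 := hR.1
  have hR1 := hR.2
  have hδ0 : 0 ≤ δ := mul_nonneg hρ.le (by linarith)
  have hδ1 : δ ≤ 1 := by nlinarith
  -- `|V|² ≤ 2 (|V| - |w|)² + 2 |w|²`
  have h3 : ‖V‖ ^ 2 ≤ 2 * (‖V‖ - ‖w‖) ^ 2 + 2 * (R * e) := by
    nlinarith [sq_nonneg (‖V‖ - 2 * ‖w‖)]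
  have h4 : R * e ≤ e := by nlinarith
  have h5 : δ * ‖V‖ ^ 2 ≤ δ * (2 * ‖V + w‖ ^ 2 + 2 * e) := by
    apply mul_le_mul_of_nonneg_left _ hδ0; linarith
  have h6 : δ * ‖V + w‖ ^ 2 ≤ ‖V + w‖ ^ 2 := by nlinarith [sq_nonneg ‖V + w‖]
  nlinarith [mul_nonneg hδ0 he]

/-- The fraction of the energy of the pair which either molecule takes at least. -/
def fraction (r R : ℝ) : ℝ := r * (1 - r) * (1 - R) / 6

theorem fraction_pos {r R : ℝ} (hr : r ∈ Ioo (0 : ℝ) 1) (hR : R ∈ Ioo (0 : ℝ) 1) :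
    0 < fraction r R := by
  have h1 := hr.1; have h2 := sub_pos.2 hr.2; have h3 := sub_pos.2 hR.2
  unfold fraction; positivity

theorem fraction_lt_half {r R : ℝ} (hr : r ∈ Ioo (0 : ℝ) 1) (hR : R ∈ Ioo (0 : ℝ) 1) :
    fraction r R < 1 / 2 := by
  have h1 := hr.1; have h2 := hr.2; have h3 := hR.1; have h4 := hR.2
  unfold fraction
  have : r * (1 - r) ≤ 1 := by nlinarith
  have h5 : 0 ≤ r * (1 - r) := mul_nonneg h1.le (by linarith)
  nlinarith

theorem fraction_mul_le_post (hm : 0 < m) {x y : State} (hx : 0 ≤ x.2) (hy : 0 ≤ y.2) {p : Param}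
    (hr : p.2.1 ∈ Ioo (0 : ℝ) 1) (hR : p.2.2 ∈ Ioo (0 : ℝ) 1) :
    fraction p.2.1 p.2.2 * (bracket m x ^ 2 + bracket m y ^ 2) ≤ bracket m (post m x y p) ^ 2 := by
  have hE := collEnergy_nonneg hm hx hy
  rw [bracket_sq_add hm hx hy, post_eq_outState, bracket_sq hm (outState_snd_nonneg hE hr hR)]
  set V := (1 / 2 : ℝ) • (x.1 + y.1)
  set E := collEnergy m x y
  have h := fraction_le_bracket_sq hm (V := V) hE hR hr.1 hr.2.le (√(p.2.2 * E / m) • (p.1 : Vel))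
    (by rw [norm_smul]; simp)
  refine le_trans ?_ (h.trans_eq rfl)
  refine mul_le_mul_of_nonneg_right ?_ (by positivity)
  unfold fraction
  have h1 := hr.1; have h2 := hr.2; have h3 := sub_pos.2 hR.2
  have : p.2.1 * (1 - p.2.1) ≤ p.2.1 := by nlinarith
  have := mul_le_mul_of_nonneg_right this h3.le
  linarith

theorem fraction_mul_le_postStar (hm : 0 < m) {x y : State} (hx : 0 ≤ x.2) (hy : 0 ≤ y.2)
    {p : Param} (hr : p.2.1 ∈ Ioo (0 : ℝ) 1) (hR : p.2.2 ∈ Ioo (0 : ℝ) 1) :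
    fraction p.2.1 p.2.2 * (bracket m x ^ 2 + bracket m y ^ 2)
      ≤ bracket m (postStar m x y p) ^ 2 := by
  have hE := collEnergy_nonneg hm hx hy
  rw [bracket_sq_add hm hx hy, postStar_eq_outStateStar,
    bracket_sq hm (outStateStar_snd_nonneg hE hr hR)]
  set V := (1 / 2 : ℝ) • (x.1 + y.1)
  set E := collEnergy m x y
  have h1 := hr.1; have h2 := hr.2; have h3 := sub_pos.2 hR.2
  have h := fraction_le_bracket_sq hm (V := V) (ρ := 1 - p.2.1) hE hR (by linarith) (by linarith)
    (-(√(p.2.2 * E / m) • (p.1 : Vel))) (by rw [norm_neg, norm_smul]; simp)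
  rw [← sub_eq_add_neg] at h
  refine le_trans ?_ (h.trans_eq rfl)
  refine mul_le_mul_of_nonneg_right ?_ (by positivity)
  unfold fraction
  have : p.2.1 * (1 - p.2.1) ≤ 1 - p.2.1 := by nlinarith
  have := mul_le_mul_of_nonneg_right this h3.le
  linarith

theorem collEnergy_div_le (hm : 0 < m) {x y : State} (hx : 0 ≤ x.2) (hy : 0 ≤ y.2) :
    collEnergy m x y / m ≤ bracket m x ^ 2 + bracket m y ^ 2 := by
  rw [bracket_sq_add hm hx hy]
  nlinarith [sq_nonneg ‖(1 / 2 : ℝ) • (x.1 + y.1)‖]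

theorem bracket_sq_le_collEnergy (hm : 0 < m) {x y : State} (hx : 0 ≤ x.2) (hy : 0 ≤ y.2) :
    bracket m x ^ 2 ≤ 4 * (collEnergy m x y / m) + 2 * bracket m y ^ 2 := by
  rw [bracket_sq hm hx, bracket_sq hm hy, collEnergy]
  have h1 : ‖x.1‖ ≤ ‖x.1 - y.1‖ + ‖y.1‖ := norm_le_norm_sub_add _ _
  have h2 : ‖x.1‖ ^ 2 ≤ 2 * ‖x.1 - y.1‖ ^ 2 + 2 * ‖y.1‖ ^ 2 := by
    nlinarith [norm_nonneg x.1, sq_nonneg (‖x.1 - y.1‖ - ‖y.1‖)]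
  have h3 : 0 ≤ x.2 / m := by positivity
  have h4 : 0 ≤ y.2 / m := by positivity
  have h5 : (m / 4 * ‖x.1 - y.1‖ ^ 2 + x.2 + y.2) / m
      = ‖x.1 - y.1‖ ^ 2 / 4 + x.2 / m + y.2 / m := by field_simp
  rw [h5]
  linarith

end Algebra

/-! ### Measurability and micro-reversibility -/

theorem measurable_bracket (m : ℝ) : Measurable (bracket m) := by
  unfold bracket; fun_prop

theorem measurable_post (m : ℝ) :
    Measurable fun z : State × State × Param => post m z.1 z.2.1 z.2.2 := by
  unfold post collEnergy; fun_prop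

theorem measurable_postStar (m : ℝ) :
    Measurable fun z : State × State × Param => postStar m z.1 z.2.1 z.2.2 := by
  unfold postStar collEnergy; fun_prop

theorem measurable_cosDev : Measurable fun z : State × State × Param => cosDev z.1 z.2.1 z.2.2 := by
  unfold cosDev; fun_prop

/-- The measure `dv dI dv_* dI_* dσ dr dR` on collisions. -/
def collMeasure : Measure (State × State × Param) :=
  stateMeasure.prod (stateMeasure.prod paramMeasure)

instance : SigmaFinite collMeasure := by unfold collMeasure; infer_instance

theorem lintegral_coll {F : State × State × Param → ℝ≥0∞} (hF : Measurable F) :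
    ∫⁻ z, F z ∂collMeasure
      = ∫⁻ x, ∫⁻ y, ∫⁻ p, F (x, y, p) ∂paramMeasure ∂stateMeasure ∂stateMeasure := by
  unfold collMeasure
  rw [lintegral_prod _ hF.aemeasurable]
  refine lintegral_congr fun x => ?_
  exact lintegral_prod (fun w => F (x, w)) (hF.comp measurable_prodMk_left).aemeasurable

/-- Admissible collisions, which form a set of full measure. -/
def Admissible (z : State × State × Param) : Prop :=
  0 < z.1.2 ∧ 0 < z.2.1.2 ∧ z.2.2.2.1 ∈ Ioo (0 : ℝ) 1 ∧ z.2.2.2.2 ∈ Ioo (0 : ℝ) 1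

theorem ae_admissible : ∀ᵐ z ∂collMeasure, Admissible z := by
  unfold collMeasure
  have h1 : ∀ᵐ z ∂stateMeasure.prod (stateMeasure.prod paramMeasure), 0 < z.1.2 :=
    Measure.quasiMeasurePreserving_fst.ae ae_state_pos
  have h2 : ∀ᵐ z ∂stateMeasure.prod paramMeasure, 0 < z.1.2 :=
    Measure.quasiMeasurePreserving_fst.ae ae_state_pos
  have h3 : ∀ᵐ z ∂stateMeasure.prod paramMeasure,
      z.2.2.1 ∈ Ioo (0 : ℝ) 1 ∧ z.2.2.2 ∈ Ioo (0 : ℝ) 1 :=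
    Measure.quasiMeasurePreserving_snd.ae ae_param_mem
  have h4 : ∀ᵐ z ∂stateMeasure.prod (stateMeasure.prod paramMeasure), 0 < z.2.1.2 ∧
      z.2.2.2.1 ∈ Ioo (0 : ℝ) 1 ∧ z.2.2.2.2 ∈ Ioo (0 : ℝ) 1 :=
    Measure.quasiMeasurePreserving_snd.ae (h2.and h3)
  exact h1.and h4

/-- The exchange of the two molecules on parameters: `(σ, r, R) ↦ (-σ, 1 - r, R)`. -/
def exchangeParam (p : Param) : Param := (-p.1, 1 - p.2.1, p.2.2)

theorem measurePreserving_exchangeParam :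
    MeasurePreserving exchangeParam paramMeasure paramMeasure := by
  have h1 : MeasurePreserving (fun r : ℝ => 1 - r) (volume.restrict (Ioo 0 1))
      (volume.restrict (Ioo 0 1)) := by
    have := (Measure.measurePreserving_sub_left (volume : Measure ℝ) 1).restrict_preimage
      (s := Ioo 0 1) measurableSet_Ioo
    have e : (fun r : ℝ => 1 - r) ⁻¹' Ioo 0 1 = Ioo 0 1 := by
      ext r; simp only [mem_preimage, mem_Ioo]; constructor <;> rintro ⟨a, b⟩ <;>
        constructor <;> linarith
    rwa [e] at this
  exact measurePreserving_neg_sphere.prod (h1.prod (MeasurePreserving.id _))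

theorem post_exchange (m : ℝ) (x y : State) (p : Param) :
    post m y x (exchangeParam p) = postStar m x y p := by
  have hE : collEnergy m y x = collEnergy m x y := by
    unfold collEnergy; rw [norm_sub_rev]; ring
  unfold post postStar exchangeParam
  rw [hE, add_comm y.1]
  simp [sub_eq_add_neg]

theorem postStar_exchange (m : ℝ) (x y : State) (p : Param) :
    postStar m y x (exchangeParam p) = post m x y p := by
  have hE : collEnergy m y x = collEnergy m x y := by
    unfold collEnergy; rw [norm_sub_rev]; ring
  unfold post postStar exchangeParam
  rw [hE, add_comm y.1]
  simp [sub_eq_add_neg]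

theorem cosDev_exchange (x y : State) (p : Param) :
    cosDev y x (exchangeParam p) = cosDev x y p := by
  unfold cosDev exchangeParam
  rw [norm_sub_rev, ← neg_sub x.1 y.1, smul_neg]
  simp

namespace CollisionKernel

variable (K : CollisionKernel)

theorem measurable_angular :
    Measurable fun z : State × State × Param => K.angular z.1 z.2.1 z.2.2 := by
  unfold angular
  exact Measurable.ite (measurableSet_le measurable_const measurable_cosDev)
    (K.b_measurable.comp measurable_cosDev) measurable_const

theorem measurable_dWeight (α : ℝ) : Measurable fun q : ℝ × ℝ => dWeight α q.1 q.2 := by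
  unfold dWeight; fun_prop

theorem measurable_rate :
    Measurable fun z : State × State × Param => K.rate z.1 z.2.1 z.2.2 := by
  unfold rate
  refine ((K.B_measurable.comp (f := fun z : State × State × Param =>
    (z.1, z.2.1, z.2.2.2.1, z.2.2.2.2)) (by fun_prop)).mul K.measurable_angular).mul ?_
  exact (measurable_dWeight K.α).comp (f := fun z : State × State × Param =>
    (z.2.2.2.1, z.2.2.2.2)) (by fun_prop)

theorem dWeight_nonneg {α r R : ℝ} (hr : r ∈ Ioo (0 : ℝ) 1) (hR : R ∈ Ioo (0 : ℝ) 1) :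
    0 ≤ dWeight α r R := by
  have h1 := hr.1; have h2 := sub_pos.2 hr.2; have h3 := sub_pos.2 hR.2
  unfold dWeight; positivity

theorem cosDev_le_one (x y : State) (p : Param) : cosDev x y p ≤ 1 := by
  unfold cosDev
  refine (real_inner_le_norm _ _).trans ?_
  have : ‖‖x.1 - y.1‖⁻¹ • (x.1 - y.1)‖ ≤ 1 := by
    rw [norm_smul, norm_inv, norm_norm]
    exact inv_mul_le_one
  simpa using this

theorem angular_nonneg (x y : State) (p : Param) : 0 ≤ K.angular x y p := by
  unfold angular
  split_ifs with h
  · exact K.b_nonneg _ ⟨h, cosDev_le_one x y p⟩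
  · exact le_rfl

theorem rate_nonneg {x y : State} {p : Param} (hx : 0 < x.2) (hy : 0 < y.2)
    (hr : p.2.1 ∈ Ioo (0 : ℝ) 1) (hR : p.2.2 ∈ Ioo (0 : ℝ) 1) : 0 ≤ K.rate x y p :=
  mul_nonneg (mul_nonneg (K.B_nonneg x y hx hy _ hr _ hR) (K.angular_nonneg x y p))
    (dWeight_nonneg hr hR)

theorem rate_exchange {x y : State} {p : Param} (hx : 0 < x.2) (hy : 0 < y.2)
    (hr : p.2.1 ∈ Ioo (0 : ℝ) 1) (hR : p.2.2 ∈ Ioo (0 : ℝ) 1) :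
    K.rate y x (exchangeParam p) = K.rate x y p := by
  unfold rate angular
  rw [cosDev_exchange]
  have h1 : (exchangeParam p).2.1 = 1 - p.2.1 := rfl
  have h2 : (exchangeParam p).2.2 = p.2.2 := rfl
  rw [h1, h2, K.B_symm x y hx hy _ hr _ hR]
  congr 1
  unfold dWeight
  rw [sub_sub_cancel]; ring

/-- Micro-reversibility in centre of mass coordinates: the kernel, weighted by the Jacobian, is
symmetric under the exchange of incoming and outgoing parameters. -/
theorem rate_reversible {V : Vel} {E : ℝ} (hE : 0 < E) {p q : Param}
    (hpr : p.2.1 ∈ Ioo (0 : ℝ) 1) (hpR : p.2.2 ∈ Ioo (0 : ℝ) 1)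
    (hqr : q.2.1 ∈ Ioo (0 : ℝ) 1) (hqR : q.2.2 ∈ Ioo (0 : ℝ) 1) :
    (((outState K.m V E q).2 * (outStateStar K.m V E q).2) /
        ((outState K.m V E p).2 * (outStateStar K.m V E p).2)) ^ K.α *
      K.rate (outState K.m V E q) (outStateStar K.m V E q) p * paramWeight q
    = K.rate (outState K.m V E p) (outStateStar K.m V E p) q * paramWeight p := by
  have hm := K.m_pos
  have hq1 := hqr.1; have hq2 := sub_pos.2 hqr.2; have hq3 := sub_pos.2 hqR.2; have hq4 := hqR.1
  have hp1 := hpr.1; have hp2 := sub_pos.2 hpr.2; have hp3 := sub_pos.2 hpR.2; have hp4 := hpR.1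
  -- the deviation angle is the same for the reversed collision
  have hang : K.angular (outState K.m V E q) (outStateStar K.m V E q) p
      = K.angular (outState K.m V E p) (outStateStar K.m V E p) q := by
    unfold angular
    rw [cosDev_outState hm V hE hqR.1, cosDev_outState hm V hE hpR.1, real_inner_comm]
  by_cases hc : 0 ≤ cosDev (outState K.m V E q) (outStateStar K.m V E q) p
  swap
  · have h0 : K.angular (outState K.m V E q) (outStateStar K.m V E q) p = 0 := if_neg hc
    have h0' := hang ▸ h0
    unfold rate
    rw [h0, h0']; ring
  have hne : (outState K.m V E q).1 ≠ (outStateStar K.m V E q).1 := by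
    intro h
    have := norm_outState_sub (m := K.m) V E q
    rw [h, sub_self, norm_zero] at this
    have h2 : 0 < √(q.2.2 * E / K.m) := Real.sqrt_pos.2 (by positivity)
    linarith
  have hB := K.B_reversible (outState K.m V E q) (outStateStar K.m V E q)
    (by simp only [outState]; positivity) (by simp only [outStateStar]; positivity)
    hne p hpr hpR hc
  rw [post_outState hm V hE.le hqR.1.le, postStar_outState hm V hE.le hqR.1.le,
    norm_outState_sub, collEnergy_outState hm V hE.le hqR.1.le, mul_pow,
    Real.sq_sqrt (by positivity)] at hB
  have hr : (outState K.m V E q).2 / ((outState K.m V E q).2 + (outStateStar K.m V E q).2)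
      = q.2.1 := by
    simp only [outState, outStateStar]
    have : q.2.1 * (1 - q.2.2) * E + (1 - q.2.1) * (1 - q.2.2) * E = (1 - q.2.2) * E := by ring
    rw [this]; field_simp
  have hR : K.m * (2 ^ 2 * (q.2.2 * E / K.m)) / (4 * E) = q.2.2 := by
    field_simp; norm_num
  rw [hr, hR] at hB
  have hpow : (((outState K.m V E q).2 * (outStateStar K.m V E q).2) /
        ((outState K.m V E p).2 * (outStateStar K.m V E p).2)) ^ K.α
      = (q.2.1 ^ K.α * (1 - q.2.1) ^ K.α * ((1 - q.2.2) ^ K.α * (1 - q.2.2) ^ K.α)) /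
        (p.2.1 ^ K.α * (1 - p.2.1) ^ K.α * ((1 - p.2.2) ^ K.α * (1 - p.2.2) ^ K.α)) := by
    have : ((outState K.m V E q).2 * (outStateStar K.m V E q).2) /
        ((outState K.m V E p).2 * (outStateStar K.m V E p).2)
        = (q.2.1 * (1 - q.2.1) * ((1 - q.2.2) * (1 - q.2.2))) /
          (p.2.1 * (1 - p.2.1) * ((1 - p.2.2) * (1 - p.2.2))) := by
      simp only [outState, outStateStar]
      field_simp
    rw [this, Real.div_rpow (by positivity) (by positivity), Real.mul_rpow (by positivity)
      (by positivity), Real.mul_rpow (by positivity) (by positivity),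
      Real.mul_rpow (by positivity) (by positivity), Real.mul_rpow (by positivity) (by positivity),
      Real.mul_rpow (by positivity) (by positivity), Real.mul_rpow (by positivity) (by positivity)]
  have hpow2 : ∀ R : ℝ, 0 < 1 - R →
      (1 - R) ^ (2 * K.α + 1) = ((1 - R) ^ K.α * (1 - R) ^ K.α) * (1 - R) := by
    intro R hR
    rw [Real.rpow_add hR, Real.rpow_one, two_mul, Real.rpow_add hR]
  unfold rate
  rw [hpow, hang, ← hB]
  unfold dWeight paramWeight
  rw [hpow2 _ hp3, hpow2 _ hq3]
  have e1 : 0 < p.2.1 ^ K.α := by positivity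
  have e2 : 0 < (1 - p.2.1) ^ K.α := by positivity
  have e3 : 0 < (1 - p.2.2) ^ K.α := by positivity
  field_simp

theorem measurable_reversedRate :
    Measurable fun z : State × State × Param =>
      ((z.1.2 * z.2.1.2) / ((post K.m z.1 z.2.1 z.2.2).2 *
        (postStar K.m z.1 z.2.1 z.2.2).2)) ^ K.α * K.rate z.1 z.2.1 z.2.2 := by
  have h1 := measurable_snd.comp (measurable_post K.m)
  have h2 := measurable_snd.comp (measurable_postStar K.m)
  have h3 : Measurable fun z : State × State × Param => z.1.2 * z.2.1.2 := by fun_prop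
  exact ((h3.div (h1.mul h2)).pow_const _).mul K.measurable_rate

/-- The change of variables between incoming and outgoing states, for non-negative integrands: both
sides are double integrals over incoming and outgoing parameters, for a fixed centre of mass
velocity and energy. -/
theorem lintegral_reversible {Ψ : (State × State) × (State × State) → ℝ≥0∞} (hΨ : Measurable Ψ) :
    ∫⁻ z, Ψ ((z.1, z.2.1), (post K.m z.1 z.2.1 z.2.2, postStar K.m z.1 z.2.1 z.2.2)) *
        ENNReal.ofReal (((z.1.2 * z.2.1.2) / ((post K.m z.1 z.2.1 z.2.2).2 *
          (postStar K.m z.1 z.2.1 z.2.2).2)) ^ K.α * K.rate z.1 z.2.1 z.2.2) ∂collMeasure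
      = ∫⁻ z, Ψ ((post K.m z.1 z.2.1 z.2.2, postStar K.m z.1 z.2.1 z.2.2), (z.1, z.2.1)) *
        ENNReal.ofReal (K.rate z.1 z.2.1 z.2.2) ∂collMeasure := by
  have hm := K.m_pos
  have hp := measurable_post K.m
  have hps := measurable_postStar K.m
  have hr := K.measurable_rate
  have hm1 : Measurable fun z : State × State × Param =>
      Ψ ((z.1, z.2.1), (post K.m z.1 z.2.1 z.2.2, postStar K.m z.1 z.2.1 z.2.2)) *
        ENNReal.ofReal (((z.1.2 * z.2.1.2) / ((post K.m z.1 z.2.1 z.2.2).2 *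
          (postStar K.m z.1 z.2.1 z.2.2).2)) ^ K.α * K.rate z.1 z.2.1 z.2.2) :=
    Measurable.mul (hΨ.comp (by fun_prop)) K.measurable_reversedRate.ennreal_ofReal
  have hm2 : Measurable fun z : State × State × Param =>
      Ψ ((post K.m z.1 z.2.1 z.2.2, postStar K.m z.1 z.2.1 z.2.2), (z.1, z.2.1)) *
        ENNReal.ofReal (K.rate z.1 z.2.1 z.2.2) :=
    Measurable.mul (hΨ.comp (by fun_prop)) (by fun_prop)
  rw [lintegral_coll hm1, lintegral_coll hm2]
  have hm1' : Measurable fun w : (State × State) × Param =>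
      Ψ ((w.1.1, w.1.2), (post K.m w.1.1 w.1.2 w.2, postStar K.m w.1.1 w.1.2 w.2)) *
        ENNReal.ofReal (((w.1.1.2 * w.1.2.2) / ((post K.m w.1.1 w.1.2 w.2).2 *
          (postStar K.m w.1.1 w.1.2 w.2).2)) ^ K.α * K.rate w.1.1 w.1.2 w.2) :=
    hm1.comp (f := fun w : (State × State) × Param => (w.1.1, w.1.2, w.2)) (by fun_prop)
  have hm2' : Measurable fun w : (State × State) × Param =>
      Ψ ((post K.m w.1.1 w.1.2 w.2, postStar K.m w.1.1 w.1.2 w.2), (w.1.1, w.1.2)) *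
        ENNReal.ofReal (K.rate w.1.1 w.1.2 w.2) :=
    hm2.comp (f := fun w : (State × State) × Param => (w.1.1, w.1.2, w.2)) (by fun_prop)
  rw [lintegral_pair hm hm1'.lintegral_prod_right', lintegral_pair hm hm2'.lintegral_prod_right']
  refine lintegral_congr fun V => ?_
  refine setLIntegral_congr_fun measurableSet_Ioi fun E hE => ?_
  have hE' : 0 < E := hE
  have hw : 0 ≤ energyWeight K.m E := by unfold energyWeight; positivity
  have hmo : Measurable fun q : Param => outState K.m V E q := by unfold outState; fun_prop
  have hmos : Measurable fun q : Param => outStateStar K.m V E q := by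
    unfold outStateStar; fun_prop
  have hmw : Measurable paramWeight := by unfold paramWeight; fun_prop
  -- the common value: a symmetric double integral over incoming and outgoing parameters
  have hL : ∀ᵐ q ∂paramMeasure, ENNReal.ofReal (energyWeight K.m E * paramWeight q) *
      ∫⁻ p, Ψ ((outState K.m V E q, outStateStar K.m V E q),
          (post K.m (outState K.m V E q) (outStateStar K.m V E q) p,
            postStar K.m (outState K.m V E q) (outStateStar K.m V E q) p)) *
        ENNReal.ofReal ((((outState K.m V E q).2 * (outStateStar K.m V E q).2) /
          ((post K.m (outState K.m V E q) (outStateStar K.m V E q) p).2 *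
          (postStar K.m (outState K.m V E q) (outStateStar K.m V E q) p).2)) ^ K.α *
            K.rate (outState K.m V E q) (outStateStar K.m V E q) p) ∂paramMeasure
      = ∫⁻ p, Ψ ((outState K.m V E q, outStateStar K.m V E q),
          (outState K.m V E p, outStateStar K.m V E p)) *
        ENNReal.ofReal (energyWeight K.m E * (K.rate (outState K.m V E p)
          (outStateStar K.m V E p) q * paramWeight p)) ∂paramMeasure := by
    filter_upwards [ae_param_mem] with q hq
    have hJ : 0 ≤ paramWeight q := mul_nonneg (Real.sqrt_nonneg _) (sub_nonneg.2 hq.2.2.le)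
    rw [← lintegral_const_mul' _ _ ENNReal.ofReal_ne_top]
    refine lintegral_congr_ae ?_
    filter_upwards [ae_param_mem] with p hp
    rw [post_outState hm V hE'.le hq.2.1.le, postStar_outState hm V hE'.le hq.2.1.le,
      ← K.rate_reversible hE' hp.1 hp.2 hq.1 hq.2, mul_left_comm,
        ← ENNReal.ofReal_mul (mul_nonneg hw hJ)]
    congr 2; ring
  have hR : ∀ᵐ q ∂paramMeasure, ENNReal.ofReal (energyWeight K.m E * paramWeight q) *
      ∫⁻ p, Ψ ((post K.m (outState K.m V E q) (outStateStar K.m V E q) p,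
            postStar K.m (outState K.m V E q) (outStateStar K.m V E q) p),
            (outState K.m V E q, outStateStar K.m V E q)) *
        ENNReal.ofReal (K.rate (outState K.m V E q) (outStateStar K.m V E q) p) ∂paramMeasure
      = ∫⁻ p, Ψ ((outState K.m V E p, outStateStar K.m V E p),
          (outState K.m V E q, outStateStar K.m V E q)) *
        ENNReal.ofReal (energyWeight K.m E * (K.rate (outState K.m V E q)
          (outStateStar K.m V E q) p * paramWeight q)) ∂paramMeasure := by
    filter_upwards [ae_param_mem] with q hq
    have hJ : 0 ≤ paramWeight q := mul_nonneg (Real.sqrt_nonneg _) (sub_nonneg.2 hq.2.2.le)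
    rw [← lintegral_const_mul' _ _ ENNReal.ofReal_ne_top]
    refine lintegral_congr_ae ?_
    filter_upwards [ae_param_mem] with p hp
    rw [post_outState hm V hE'.le hq.2.1.le, postStar_outState hm V hE'.le hq.2.1.le,
      mul_left_comm, ← ENNReal.ofReal_mul (mul_nonneg hw hJ)]
    congr 2; ring
  rw [lintegral_congr_ae hL, lintegral_congr_ae hR, lintegral_lintegral_swap]
  refine Measurable.aemeasurable (Measurable.mul (hΨ.comp ?_) ?_)
  · fun_prop
  · have : Measurable fun w : Param × Param => K.rate (outState K.m V E w.2)
        (outStateStar K.m V E w.2) w.1 :=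
      hr.comp (f := fun w : Param × Param => (outState K.m V E w.2, outStateStar K.m V E w.2, w.1))
        (by fun_prop)
    fun_prop

/-- Exchange of the two molecules under the collision integral. -/
theorem lintegral_exchange {Ψ : (State × State) × (State × State) → ℝ≥0∞} (hΨ : Measurable Ψ) :
    ∫⁻ z, Ψ ((z.1, z.2.1), (post K.m z.1 z.2.1 z.2.2, postStar K.m z.1 z.2.1 z.2.2)) *
        ENNReal.ofReal (K.rate z.1 z.2.1 z.2.2) ∂collMeasure
      = ∫⁻ z, Ψ ((z.2.1, z.1), (postStar K.m z.1 z.2.1 z.2.2, post K.m z.1 z.2.1 z.2.2)) *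
        ENNReal.ofReal (K.rate z.1 z.2.1 z.2.2) ∂collMeasure := by
  have hp := measurable_post K.m
  have hps := measurable_postStar K.m
  have hr := K.measurable_rate
  have hm1 : Measurable fun z : State × State × Param =>
      Ψ ((z.1, z.2.1), (post K.m z.1 z.2.1 z.2.2, postStar K.m z.1 z.2.1 z.2.2)) *
        ENNReal.ofReal (K.rate z.1 z.2.1 z.2.2) :=
    Measurable.mul (hΨ.comp (by fun_prop)) (by fun_prop)
  have hm2 : Measurable fun z : State × State × Param =>
      Ψ ((z.2.1, z.1), (postStar K.m z.1 z.2.1 z.2.2, post K.m z.1 z.2.1 z.2.2)) *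
        ENNReal.ofReal (K.rate z.1 z.2.1 z.2.2) :=
    Measurable.mul (hΨ.comp (by fun_prop)) (by fun_prop)
  rw [lintegral_coll hm1, lintegral_coll hm2]
  have hm1' : Measurable fun w : (State × State) × Param =>
      Ψ ((w.1.1, w.1.2), (post K.m w.1.1 w.1.2 w.2, postStar K.m w.1.1 w.1.2 w.2)) *
        ENNReal.ofReal (K.rate w.1.1 w.1.2 w.2) :=
    hm1.comp (f := fun w : (State × State) × Param => (w.1.1, w.1.2, w.2)) (by fun_prop)
  rw [lintegral_lintegral_swap hm1'.lintegral_prod_right'.aemeasurable]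
  refine lintegral_congr_ae ?_
  filter_upwards [ae_state_pos] with x hx
  refine lintegral_congr_ae ?_
  filter_upwards [ae_state_pos] with y hy
  refine (measurePreserving_exchangeParam.lintegral_comp (hm1.comp
    (f := fun p : Param => (y, x, p)) (by fun_prop))).symm.trans ?_
  refine lintegral_congr_ae ?_
  filter_upwards [ae_param_mem] with p hp
  simp only [Function.comp_apply, post_exchange, postStar_exchange]
  rw [K.rate_exchange hx hy hp.1 hp.2]

end CollisionKernel

/-! ### Integrals over the collision parameters -/

/-- The square `(0, 1)²` of the parameters `(r, R)`. -/
abbrev unitSquare : Set (ℝ × ℝ) := Ioo (0 : ℝ) 1 ×ˢ Ioo (0 : ℝ) 1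

theorem measurableSet_unitSquare : MeasurableSet unitSquare :=
  measurableSet_Ioo.prod measurableSet_Ioo

theorem paramMeasure_eq : paramMeasure = (volume : Measure Vel).toSphere.prod
    ((volume : Measure (ℝ × ℝ)).restrict unitSquare) := by
  unfold paramMeasure
  rw [Measure.prod_restrict]; rfl

theorem rpow_eq_sq_rpow {a : ℝ} (ha : 0 ≤ a) (k : ℝ) : a ^ k = (a ^ 2) ^ (k / 2) := by
  rw [← Real.rpow_natCast, ← Real.rpow_mul ha]
  congr 1; push_cast; ring

namespace CollisionKernel

variable (K : CollisionKernel)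

theorem bNorm_nonneg : 0 ≤ K.bNorm := by
  unfold bNorm
  have : 0 ≤ ∫ c in Icc (0 : ℝ) 1, K.b c :=
    setIntegral_nonneg measurableSet_Icc K.b_nonneg
  positivity

/-- The angular factor has the integral `bNorm` over the sphere, for every pair of distinct
velocities. It does not depend on `r` and `R`, for which `0` is inserted. -/
theorem angular_sphere {x y : State} (hxy : x.1 ≠ y.1) :
    Integrable (fun σ => K.angular x y (σ, 0, 0)) (volume : Measure Vel).toSphere ∧
      ∫ σ, K.angular x y (σ, 0, 0) ∂(volume : Measure Vel).toSphere = K.bNorm := by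
  set u : Vel := ‖x.1 - y.1‖⁻¹ • (x.1 - y.1) with hu
  have hu1 : ‖u‖ = 1 := by
    have : ‖x.1 - y.1‖ ≠ 0 := norm_ne_zero_iff.2 (sub_ne_zero.2 hxy)
    rw [hu, norm_smul, norm_inv, norm_norm, inv_mul_cancel₀ this]
  have hmeas : Measurable fun σ => K.angular x y (σ, 0, 0) :=
    K.measurable_angular.comp
      (f := fun σ : Metric.sphere (0 : Vel) 1 => (x, y, σ, (0 : ℝ), (0 : ℝ)))
      (by fun_prop)
  have hl : ∫⁻ σ, ENNReal.ofReal (K.angular x y (σ, 0, 0)) ∂(volume : Measure Vel).toSphere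
      = ENNReal.ofReal K.bNorm := by
    have h := lintegral_sphere_inner hu1 (g := fun c => ENNReal.ofReal (K.b c))
      K.b_measurable.ennreal_ofReal
    have h1 : ∫⁻ c in Ioo (0 : ℝ) 1, ENNReal.ofReal (K.b c)
        = ENNReal.ofReal (∫ c in Icc (0 : ℝ) 1, K.b c) := by
      rw [ofReal_integral_eq_lintegral_ofReal K.b_integrable
        (ae_restrict_of_forall_mem measurableSet_Icc K.b_nonneg),
        Measure.restrict_congr_set Ioo_ae_eq_Icc]
    rw [h1, ← ENNReal.ofReal_mul (by positivity)] at h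
    rw [bNorm, ← h]
    refine lintegral_congr fun σ => ?_
    unfold angular cosDev
    split_ifs <;> simp [hu]
  have hint : Integrable (fun σ => K.angular x y (σ, 0, 0)) (volume : Measure Vel).toSphere := by
    refine ⟨hmeas.aestronglyMeasurable, ?_⟩
    rw [hasFiniteIntegral_iff_ofReal (ae_of_all _ fun σ => K.angular_nonneg x y _), hl]
    exact ENNReal.ofReal_lt_top
  refine ⟨hint, ?_⟩
  rw [integral_eq_lintegral_of_nonneg_ae (ae_of_all _ fun σ => K.angular_nonneg x y _)
    hmeas.aestronglyMeasurable, hl, ENNReal.toReal_ofReal K.bNorm_nonneg]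

theorem integrable_angular_mul {x y : State} (hxy : x.1 ≠ y.1) {G : ℝ × ℝ → ℝ}
    (hG : IntegrableOn G unitSquare) :
    Integrable (fun p : Param => K.angular x y p * G p.2) paramMeasure := by
  rw [paramMeasure_eq]
  exact (K.angular_sphere hxy).1.mul_prod hG

theorem integral_angular_mul {x y : State} (hxy : x.1 ≠ y.1) (G : ℝ × ℝ → ℝ) :
    ∫ p : Param, K.angular x y p * G p.2 ∂paramMeasure = K.bNorm * ∫ q in unitSquare, G q := by
  rw [paramMeasure_eq, ← (K.angular_sphere hxy).2]
  exact integral_prod_mul (fun σ => K.angular x y (σ, 0, 0)) G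

/-- The energy factor `(E / m)^{ζ/2}`. -/
def speed (x y : State) : ℝ := (collEnergy K.m x y / K.m) ^ (K.ζ / 2)

theorem measurable_speed : Measurable fun w : State × State => K.speed w.1 w.2 := by
  unfold speed collEnergy; fun_prop

theorem speed_pos {x y : State} (hx : 0 < x.2) (hy : 0 < y.2) : 0 < K.speed x y :=
  Real.rpow_pos_of_pos (div_pos (collEnergy_pos K.m_pos hx hy) K.m_pos) _

theorem ub_nonneg {r R : ℝ} (hr : r ∈ Ioo (0 : ℝ) 1) (hR : R ∈ Ioo (0 : ℝ) 1) :
    0 ≤ K.ub r R := by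
  have h1 := K.B_nonneg (0, 1) (0, 1) one_pos one_pos r hr R hR
  have h2 := K.le_ub (0, 1) (0, 1) one_pos one_pos r hr R hR
  have h3 : 0 < K.speed (0, 1) (0, 1) := K.speed_pos one_pos one_pos
  exact nonneg_of_mul_nonneg_left (h1.trans h2) h3

theorem rate_le {x y : State} {p : Param} (hx : 0 < x.2) (hy : 0 < y.2)
    (hr : p.2.1 ∈ Ioo (0 : ℝ) 1) (hR : p.2.2 ∈ Ioo (0 : ℝ) 1) :
    K.rate x y p ≤ K.speed x y *
      (K.angular x y p * (K.ub p.2.1 p.2.2 * dWeight K.α p.2.1 p.2.2)) := by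
  have h := K.le_ub x y hx hy _ hr _ hR
  have h2 := mul_le_mul_of_nonneg_right h
    (mul_nonneg (K.angular_nonneg x y p) (dWeight_nonneg (α := K.α) hr hR))
  unfold rate speed
  nlinarith [h2]

theorem le_rate {x y : State} {p : Param} (hx : 0 < x.2) (hy : 0 < y.2)
    (hr : p.2.1 ∈ Ioo (0 : ℝ) 1) (hR : p.2.2 ∈ Ioo (0 : ℝ) 1) :
    K.speed x y * (K.angular x y p * (max (K.lb p.2.1 p.2.2 * dWeight K.α p.2.1 p.2.2) 0))
      ≤ K.rate x y p := by
  have hd := dWeight_nonneg (α := K.α) hr hR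
  rcases le_total (K.lb p.2.1 p.2.2 * dWeight K.α p.2.1 p.2.2) 0 with h0 | h0
  · rw [max_eq_right h0, mul_zero, mul_zero]
    exact K.rate_nonneg hx hy hr hR
  · rw [max_eq_left h0]
    have h := K.lb_le x y hx hy _ hr _ hR
    have h2 := mul_le_mul_of_nonneg_right h (mul_nonneg (K.angular_nonneg x y p) hd)
    unfold rate speed
    nlinarith [h2]

theorem integrable_rate {x y : State} (hx : 0 < x.2) (hy : 0 < y.2) (hxy : x.1 ≠ y.1) :
    Integrable (fun p => K.rate x y p) paramMeasure := by
  refine Integrable.mono' ((K.integrable_angular_mul hxy K.ub_integrable).const_mul (K.speed x y))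
    (K.measurable_rate.comp (f := fun p : Param => (x, y, p)) (by fun_prop)).aestronglyMeasurable ?_
  filter_upwards [ae_param_mem] with p hp
  rw [Real.norm_of_nonneg (K.rate_nonneg hx hy hp.1 hp.2)]
  exact K.rate_le hx hy hp.1 hp.2

/-- The total collision rate of a pair is at most `κ^{ub}` times the energy factor. -/
theorem integral_rate_le {x y : State} (hx : 0 < x.2) (hy : 0 < y.2) (hxy : x.1 ≠ y.1) :
    ∫ p, K.rate x y p ∂paramMeasure ≤ K.kappaUb * K.speed x y := by
  have h := integral_mono_ae (K.integrable_rate hx hy hxy)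
    ((K.integrable_angular_mul hxy K.ub_integrable).const_mul (K.speed x y))
    (by filter_upwards [ae_param_mem] with p hp using K.rate_le hx hy hp.1 hp.2)
  rw [integral_const_mul, K.integral_angular_mul hxy
    (fun q : ℝ × ℝ => K.ub q.1 q.2 * dWeight K.α q.1 q.2)] at h
  unfold kappaUb
  linarith

/-- The factor in the lower bound of the collision rate, weighed by the function `l` of `(r, R)`.
The positive part is taken because the lower bound `lb` of the non-negative kernel may be negative.
-/
def lowerRate (l : ℝ × ℝ → ℝ) : ℝ :=
  K.bNorm * ∫ q in unitSquare, l q * max (K.lb q.1 q.2 * dWeight K.α q.1 q.2) 0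

theorem integrableOn_lowerRate {l : ℝ × ℝ → ℝ} (hl : Measurable l)
    (h01 : ∀ q ∈ unitSquare, l q ∈ Icc (0 : ℝ) 1) :
    IntegrableOn (fun q => l q * max (K.lb q.1 q.2 * dWeight K.α q.1 q.2) 0) unitSquare := by
  refine Integrable.mono' K.lb_integrable.pos_part
    (hl.aestronglyMeasurable.mul K.lb_integrable.pos_part.aestronglyMeasurable) ?_
  refine ae_restrict_of_forall_mem measurableSet_unitSquare fun q hq => ?_
  rw [Real.norm_of_nonneg (mul_nonneg (h01 q hq).1 (le_max_right _ _))]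
  exact mul_le_of_le_one_left (le_max_right _ _) (h01 q hq).2

theorem lowerRate_mul_speed_le {l : ℝ × ℝ → ℝ} (hl : Measurable l)
    (h01 : ∀ q ∈ unitSquare, l q ∈ Icc (0 : ℝ) 1) {x y : State} (hx : 0 < x.2) (hy : 0 < y.2)
    (hxy : x.1 ≠ y.1) :
    K.lowerRate l * K.speed x y ≤ ∫ p, l p.2 * K.rate x y p ∂paramMeasure := by
  have hint : Integrable (fun p : Param => l p.2 * K.rate x y p) paramMeasure := by
    refine Integrable.mono' (K.integrable_rate hx hy hxy) ((hl.comp measurable_snd).mul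
      (K.measurable_rate.comp (f := fun p : Param => (x, y, p))
        (by fun_prop))).aestronglyMeasurable ?_
    filter_upwards [ae_param_mem] with p hp
    have h0 := K.rate_nonneg hx hy hp.1 hp.2
    rw [Real.norm_of_nonneg (mul_nonneg (h01 p.2 hp).1 h0)]
    exact mul_le_of_le_one_left h0 (h01 p.2 hp).2
  have h := integral_mono_ae
    ((K.integrable_angular_mul hxy (K.integrableOn_lowerRate hl h01)).const_mul (K.speed x y)) hint
    (by
      filter_upwards [ae_param_mem] with p hp
      have := mul_le_mul_of_nonneg_left (K.le_rate hx hy hp.1 hp.2) (h01 p.2 hp).1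
      refine le_trans (le_of_eq ?_) this
      ring)
  rw [integral_const_mul, K.integral_angular_mul hxy
    (fun q : ℝ × ℝ => l q * max (K.lb q.1 q.2 * dWeight K.α q.1 q.2) 0)] at h
  unfold lowerRate
  linarith

theorem kappaLb_mul_speed_le {x y : State} (hx : 0 < x.2) (hy : 0 < y.2) (hxy : x.1 ≠ y.1) :
    K.kappaLb * K.speed x y ≤ ∫ p, K.rate x y p ∂paramMeasure := by
  have h := K.lowerRate_mul_speed_le (l := fun _ => 1) measurable_const
    (fun _ _ => ⟨zero_le_one, le_rfl⟩) hx hy hxy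
  simp only [one_mul] at h
  refine le_trans (mul_le_mul_of_nonneg_right ?_ (K.speed_pos hx hy).le) h
  unfold kappaLb lowerRate
  refine mul_le_mul_of_nonneg_left ?_ K.bNorm_nonneg
  simp only [one_mul]
  exact integral_mono K.lb_integrable K.lb_integrable.pos_part fun q => le_max_left _ _

/-- The lower bound `lb` of the kernel has positive integral, hence is positive on a set of positive
measure. -/
theorem lowerRate_pos (hκ : 0 < K.kappaLb) {l : ℝ × ℝ → ℝ} (hl : Measurable l)
    (h01 : ∀ q ∈ unitSquare, l q ∈ Icc (0 : ℝ) 1) (hpos : ∀ q ∈ unitSquare, 0 < l q) :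
    0 < K.lowerRate l := by
  have hb : 0 < K.bNorm := by
    refine lt_of_le_of_ne K.bNorm_nonneg fun h => ?_
    rw [kappaLb, ← h, zero_mul] at hκ
    exact lt_irrefl _ hκ
  have hI : 0 < ∫ q in unitSquare, K.lb q.1 q.2 * dWeight K.α q.1 q.2 :=
    (pos_iff_pos_of_mul_pos hκ).1 hb
  refine mul_pos hb ?_
  have hnn : 0 ≤ᵐ[volume.restrict unitSquare]
      fun q => l q * max (K.lb q.1 q.2 * dWeight K.α q.1 q.2) 0 :=
    ae_restrict_of_forall_mem measurableSet_unitSquare fun q hq =>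
      mul_nonneg (h01 q hq).1 (le_max_right _ _)
  refine lt_of_le_of_ne (integral_nonneg_of_ae hnn) fun h => ?_
  have h0 := (integral_eq_zero_iff_of_nonneg_ae hnn (K.integrableOn_lowerRate hl h01)).1 h.symm
  refine absurd hI (not_lt.2 ?_)
  refine integral_nonpos_of_ae ?_
  filter_upwards [h0, ae_restrict_mem measurableSet_unitSquare] with q hq hqs
  have := (mul_eq_zero.1 hq).resolve_left (hpos q hqs).ne'
  exact (le_max_left _ 0).trans_eq this

theorem kappaLb_le_kappaUb : K.kappaLb ≤ K.kappaUb := by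
  refine mul_le_mul_of_nonneg_left ?_ K.bNorm_nonneg
  refine setIntegral_mono_on K.lb_integrable K.ub_integrable measurableSet_unitSquare fun q hq => ?_
  refine mul_le_mul_of_nonneg_right ?_ (dWeight_nonneg hq.1 hq.2)
  have h1 := K.lb_le (0, 1) (0, 1) one_pos one_pos _ hq.1 _ hq.2
  have h2 := K.le_ub (0, 1) (0, 1) one_pos one_pos _ hq.1 _ hq.2
  exact le_of_mul_le_mul_right (h1.trans h2) (K.speed_pos one_pos one_pos)

theorem kappaUb_nonneg : 0 ≤ K.kappaUb := by
  refine mul_nonneg K.bNorm_nonneg (setIntegral_nonneg measurableSet_unitSquare fun q hq => ?_)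
  exact mul_nonneg (K.ub_nonneg hq.1 hq.2) (dWeight_nonneg hq.1 hq.2)

/-! ### Averaging constants -/

theorem bracket_post_rpow_le {m : ℝ} (hm : 0 < m) {x y : State} (hx : 0 ≤ x.2) (hy : 0 ≤ y.2)
    {p : Param} (hr : p.2.1 ∈ Ioo (0 : ℝ) 1) (hR : p.2.2 ∈ Ioo (0 : ℝ) 1) {k : ℝ} (hk : 0 ≤ k) :
    bracket m (post m x y p) ^ k + bracket m (postStar m x y p) ^ k ≤
      2 * (1 - fraction p.2.1 p.2.2) ^ (k / 2) *
        (bracket m x ^ 2 + bracket m y ^ 2) ^ (k / 2) := by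
  have h1 := bracket_sq_post_add hm hx hy hr hR
  have h2 := fraction_mul_le_post hm hx hy hr hR
  have h3 := fraction_mul_le_postStar hm hx hy hr hR
  have h4 : 0 ≤ 1 - fraction p.2.1 p.2.2 := by linarith [fraction_lt_half hr hR]
  rw [rpow_eq_sq_rpow (bracket_nonneg m _) k, rpow_eq_sq_rpow (bracket_nonneg m _) k, mul_assoc,
    ← Real.mul_rpow h4 (by positivity), two_mul]
  refine add_le_add ?_ ?_ <;>
    refine Real.rpow_le_rpow (sq_nonneg _) ?_ (by positivity) <;> linarith

/-- An explicit family of averaging constants: neither outgoing molecule has more than the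
proportion `1 - fraction r R < 1` of the energy of the pair, so that dominated convergence yields
the decay as `k → ∞`. -/
def averagingConst (k : ℝ) : ℝ :=
  2 * (K.bNorm * ∫ q in unitSquare, (1 - fraction q.1 q.2) ^ (k / 2) *
    (K.ub q.1 q.2 * dWeight K.α q.1 q.2))

theorem measurable_fraction : Measurable fun q : ℝ × ℝ => fraction q.1 q.2 := by
  unfold fraction; fun_prop

theorem one_sub_fraction_mem {q : ℝ × ℝ} (hq : q ∈ unitSquare) :
    1 - fraction q.1 q.2 ∈ Ioo (0 : ℝ) 1 :=
  ⟨by linarith [fraction_lt_half hq.1 hq.2], by linarith [fraction_pos hq.1 hq.2]⟩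

theorem integrableOn_averagingConst {k : ℝ} (hk : 0 ≤ k) :
    IntegrableOn (fun q : ℝ × ℝ => (1 - fraction q.1 q.2) ^ (k / 2) *
      (K.ub q.1 q.2 * dWeight K.α q.1 q.2)) unitSquare := by
  have hm : Measurable fun q : ℝ × ℝ => (1 - fraction q.1 q.2) ^ (k / 2) :=
    (measurable_const.sub measurable_fraction).pow_const _
  refine Integrable.mono' K.ub_integrable
    (hm.aestronglyMeasurable.mul K.ub_integrable.aestronglyMeasurable) ?_
  refine ae_restrict_of_forall_mem measurableSet_unitSquare fun q hq => ?_
  have h1 := one_sub_fraction_mem hq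
  have h2 : 0 ≤ K.ub q.1 q.2 * dWeight K.α q.1 q.2 :=
    mul_nonneg (K.ub_nonneg hq.1 hq.2) (dWeight_nonneg hq.1 hq.2)
  rw [Real.norm_of_nonneg (mul_nonneg (Real.rpow_nonneg h1.1.le _) h2)]
  exact mul_le_of_le_one_left h2 (Real.rpow_le_one h1.1.le h1.2.le (by positivity))

/-- The decay as `k → ∞` is by dominated convergence, the bound itself holds for each `(r, R)`. -/
theorem isAveragingConst_averagingConst : K.IsAveragingConst K.averagingConst where
  nonneg k hk := by
    refine mul_nonneg zero_le_two (mul_nonneg K.bNorm_nonneg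
      (setIntegral_nonneg measurableSet_unitSquare fun q hq => ?_))
    exact mul_nonneg (Real.rpow_nonneg (one_sub_fraction_mem hq).1.le _)
      (mul_nonneg (K.ub_nonneg hq.1 hq.2) (dWeight_nonneg hq.1 hq.2))
  antitone := by
    intro k hk l hl hkl
    refine mul_le_mul_of_nonneg_left (mul_le_mul_of_nonneg_left ?_ K.bNorm_nonneg) zero_le_two
    refine setIntegral_mono_on (K.integrableOn_averagingConst hl)
      (K.integrableOn_averagingConst hk) measurableSet_unitSquare fun q hq => ?_
    refine mul_le_mul_of_nonneg_right ?_
      (mul_nonneg (K.ub_nonneg hq.1 hq.2) (dWeight_nonneg hq.1 hq.2))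
    exact Real.rpow_le_rpow_of_exponent_ge (one_sub_fraction_mem hq).1
      (one_sub_fraction_mem hq).2.le (by linarith)
  tendsto := by
    have h : Tendsto (fun k : ℝ => ∫ q in unitSquare, (1 - fraction q.1 q.2) ^ (k / 2) *
        (K.ub q.1 q.2 * dWeight K.α q.1 q.2)) atTop (𝓝 (∫ q in unitSquare, (0 : ℝ))) := by
      refine tendsto_integral_filter_of_dominated_convergence
        (fun q => K.ub q.1 q.2 * dWeight K.α q.1 q.2) ?_ ?_ K.ub_integrable ?_
      · filter_upwards [eventually_ge_atTop 0] with k hk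
        exact (K.integrableOn_averagingConst hk).aestronglyMeasurable
      · filter_upwards [eventually_ge_atTop 0] with k hk
        refine ae_restrict_of_forall_mem measurableSet_unitSquare fun q hq => ?_
        have h1 := one_sub_fraction_mem hq
        have h2 : 0 ≤ K.ub q.1 q.2 * dWeight K.α q.1 q.2 :=
          mul_nonneg (K.ub_nonneg hq.1 hq.2) (dWeight_nonneg hq.1 hq.2)
        rw [Real.norm_of_nonneg (mul_nonneg (Real.rpow_nonneg h1.1.le _) h2)]
        exact mul_le_of_le_one_left h2 (Real.rpow_le_one h1.1.le h1.2.le (by positivity))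
      · refine ae_restrict_of_forall_mem measurableSet_unitSquare fun q hq => ?_
        have h1 := one_sub_fraction_mem hq
        have h3 : Tendsto (fun k : ℝ => (1 - fraction q.1 q.2) ^ (k / 2)) atTop (𝓝 0) :=
          (tendsto_rpow_atTop_of_base_lt_one _ (by linarith [h1.1]) h1.2).comp
            (tendsto_id.atTop_div_const two_pos)
        simpa using h3.mul_const (K.ub q.1 q.2 * dWeight K.α q.1 q.2)
    have h2 := (h.const_mul K.bNorm).const_mul 2
    simp only [integral_zero, mul_zero] at h2
    exact h2
  bound := by
    intro k hk x y hx hy hxy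
    have hint := K.integrable_angular_mul hxy (K.integrableOn_averagingConst hk)
    set S := (bracket K.m x ^ 2 + bracket K.m y ^ 2) ^ (k / 2) with hS
    have hS0 : 0 ≤ S := by positivity
    have h1 : K.avg k x y ≤ ∫ p, 2 * S * (K.angular x y p *
        ((1 - fraction p.2.1 p.2.2) ^ (k / 2) *
          (K.ub p.2.1 p.2.2 * dWeight K.α p.2.1 p.2.2))) ∂paramMeasure := by
      refine integral_mono_of_nonneg ?_ (hint.const_mul (2 * S)) ?_
      · filter_upwards [ae_param_mem] with p hp
        exact mul_nonneg (mul_nonneg (mul_nonneg (add_nonneg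
          (Real.rpow_nonneg (bracket_nonneg _ _) _) (Real.rpow_nonneg (bracket_nonneg _ _) _))
          (K.angular_nonneg x y p)) (K.ub_nonneg hp.1 hp.2)) (dWeight_nonneg hp.1 hp.2)
      · filter_upwards [ae_param_mem] with p hp
        have h := bracket_post_rpow_le K.m_pos hx.le hy.le hp.1 hp.2 hk
        have h0 : 0 ≤ K.angular x y p * (K.ub p.2.1 p.2.2 * dWeight K.α p.2.1 p.2.2) :=
          mul_nonneg (K.angular_nonneg x y p)
            (mul_nonneg (K.ub_nonneg hp.1 hp.2) (dWeight_nonneg hp.1 hp.2))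
        have h2 := mul_le_mul_of_nonneg_right h h0
        refine le_trans (le_of_eq ?_) (h2.trans (le_of_eq ?_))
        · ring
        · rw [← hS]; ring
    refine h1.trans (le_of_eq ?_)
    rw [integral_const_mul, K.integral_angular_mul hxy (fun q : ℝ × ℝ =>
      (1 - fraction q.1 q.2) ^ (k / 2) * (K.ub q.1 q.2 * dWeight K.α q.1 q.2)), averagingConst]
    ring

theorem exists_isThreshold (hκ : 0 < K.kappaLb) {C : ℝ → ℝ} (hC : K.IsAveragingConst C) :
    ∃ kstar, K.IsThreshold C kstar := by
  obtain ⟨a, ha⟩ := eventually_atTop.1 (hC.tendsto.eventually_lt_const hκ)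
  exact ⟨max a 3, lt_max_of_lt_right (by norm_num), fun k hk => ha k ((le_max_left _ _).trans hk)⟩

end CollisionKernel

/-! ### The weak form of the collision operator -/

/-- The measure `dv dI dv_* dI_*` on pairs of molecules. -/
def pairMeasure : Measure (State × State) := stateMeasure.prod stateMeasure

instance : SigmaFinite pairMeasure := by unfold pairMeasure; infer_instance

theorem ae_pair_admissible :
    ∀ᵐ w ∂pairMeasure, 0 < w.1.2 ∧ 0 < w.2.2 ∧ w.1.1 ≠ w.2.1 := by
  have h1 : ∀ᵐ w ∂pairMeasure, 0 < w.1.2 := Measure.quasiMeasurePreserving_fst.ae ae_state_pos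
  have h2 : ∀ᵐ w ∂pairMeasure, 0 < w.2.2 := Measure.quasiMeasurePreserving_snd.ae ae_state_pos
  have h3 : ∀ᵐ w ∂pairMeasure, w.1.1 ≠ w.2.1 := by
    refine (Measure.ae_prod_iff_ae_ae ?_).2 (ae_of_all _ fun x => ae_vel_ne x)
    exact (measurableSet_eq_fun (measurable_fst.comp measurable_fst)
      (measurable_fst.comp measurable_snd)).compl
  filter_upwards [h1, h2, h3] with w a b c using ⟨a, b, c⟩

theorem measurePreserving_assoc :
    MeasurePreserving (MeasurableEquiv.prodAssoc : (State × State) × Param ≃ᵐ State × State × Param)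
      (pairMeasure.prod paramMeasure) collMeasure :=
  measurePreserving_prodAssoc _ _ _

theorem integrable_coll_iff {F : State × State × Param → ℝ} :
    Integrable F collMeasure ↔
      Integrable (fun w : (State × State) × Param => F (w.1.1, w.1.2, w.2))
        (pairMeasure.prod paramMeasure) :=
  (measurePreserving_assoc.integrable_comp_emb (MeasurableEquiv.measurableEmbedding _)).symm

theorem integral_coll {F : State × State × Param → ℝ} (hF : Integrable F collMeasure) :
    ∫ z, F z ∂collMeasure = ∫ w, ∫ p, F (w.1, w.2, p) ∂paramMeasure ∂pairMeasure := by
  rw [← measurePreserving_assoc.integral_comp (MeasurableEquiv.measurableEmbedding _)]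
  exact integral_prod _ (integrable_coll_iff.1 hF)

theorem integral_coll_le {F : State × State × Param → ℝ} {U : State × State → ℝ}
    (hF : Integrable F collMeasure) (hU : Integrable U pairMeasure)
    (h : ∀ᵐ w ∂pairMeasure, ∫ p, F (w.1, w.2, p) ∂paramMeasure ≤ U w) :
    ∫ z, F z ∂collMeasure ≤ ∫ w, U w ∂pairMeasure := by
  rw [integral_coll hF]
  exact integral_mono_ae (integrable_coll_iff.1 hF).integral_prod_left hU h

namespace CollisionKernel

variable (K : CollisionKernel)

/-- A collision integrand is integrable once it is dominated by the collision rate times a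
function of the incoming pair which is integrable against the energy factor. -/
theorem integrable_coll_of_le {F : State × State × Param → ℝ} (hF : Measurable F)
    {g : State × State → ℝ} (hg : Integrable (fun w => g w * K.speed w.1 w.2) pairMeasure)
    (hg0 : ∀ w : State × State, 0 < w.1.2 → 0 < w.2.2 → 0 ≤ g w)
    (h : ∀ z, Admissible z → |F z| ≤ g (z.1, z.2.1) * K.rate z.1 z.2.1 z.2.2) :
    Integrable F collMeasure ∧
      ∫ z, |F z| ∂collMeasure ≤ K.kappaUb * ∫ w, g w * K.speed w.1 w.2 ∂pairMeasure := by
  have hb : ∀ᵐ w ∂pairMeasure, Integrable (fun p => F (w.1, w.2, p)) paramMeasure ∧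
      ∫ p, ‖F (w.1, w.2, p)‖ ∂paramMeasure ≤ K.kappaUb * (g w * K.speed w.1 w.2) := by
    filter_upwards [ae_pair_admissible] with w hw
    have hr := K.integrable_rate hw.1 hw.2.1 hw.2.2
    have hle : ∀ᵐ p ∂paramMeasure, ‖F (w.1, w.2, p)‖ ≤ g w * K.rate w.1 w.2 p := by
      filter_upwards [ae_param_mem] with p hp
      exact h (w.1, w.2, p) ⟨hw.1, hw.2.1, hp.1, hp.2⟩
    have hi : Integrable (fun p => F (w.1, w.2, p)) paramMeasure :=
      (hr.const_mul (g w)).mono' (hF.comp (f := fun p : Param => (w.1, w.2, p))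
        (by fun_prop)).aestronglyMeasurable hle
    refine ⟨hi, ?_⟩
    refine (integral_mono_ae hi.norm (hr.const_mul (g w)) hle).trans ?_
    rw [integral_const_mul]
    have := mul_le_mul_of_nonneg_left (K.integral_rate_le hw.1 hw.2.1 hw.2.2)
      (hg0 w hw.1 hw.2.1)
    linarith
  have hF' : AEStronglyMeasurable (fun w : (State × State) × Param => F (w.1.1, w.1.2, w.2))
      (pairMeasure.prod paramMeasure) :=
    (hF.comp (f := fun w : (State × State) × Param => (w.1.1, w.1.2, w.2))
      (by fun_prop)).aestronglyMeasurable
  have hI : Integrable F collMeasure := by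
    rw [integrable_coll_iff, integrable_prod_iff hF']
    refine ⟨hb.mono fun w hw => hw.1, ?_⟩
    refine (hg.const_mul K.kappaUb).mono' hF'.norm.integral_prod_right' ?_
    filter_upwards [hb] with w hw
    rw [Real.norm_of_nonneg (integral_nonneg fun _ => norm_nonneg _)]
    exact hw.2
  refine ⟨hI, ?_⟩
  rw [← integral_const_mul]
  exact integral_coll_le hI.abs (hg.const_mul _) (hb.mono fun w hw => hw.2)

/-- The integrand of the gain operator, as a function of collisions. -/
def gainIntegrand (f g : State → ℝ) (z : State × State × Param) : ℝ :=
  f (post K.m z.1 z.2.1 z.2.2) * g (postStar K.m z.1 z.2.1 z.2.2)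
    * ((z.1.2 * z.2.1.2) / ((post K.m z.1 z.2.1 z.2.2).2 * (postStar K.m z.1 z.2.1 z.2.2).2)) ^ K.α
    * K.rate z.1 z.2.1 z.2.2

theorem post_snd_pos {m : ℝ} (hm : 0 < m) {x y : State} {p : Param} (hx : 0 < x.2) (hy : 0 < y.2)
    (hr : p.2.1 ∈ Ioo (0 : ℝ) 1) (hR : p.2.2 ∈ Ioo (0 : ℝ) 1) :
    0 < (post m x y p).2 ∧ 0 < (postStar m x y p).2 := by
  have hE := collEnergy_pos hm hx hy
  have h1 := hr.1; have h2 := sub_pos.2 hr.2; have h3 := sub_pos.2 hR.2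
  exact ⟨by unfold post; positivity, by unfold postStar; positivity⟩

section WeakForm

variable {f φ : State → ℝ} {u : State × State → ℝ}

/-- `u` dominates the test function `φ` before and after collisions, and the corresponding
collision integral of `f` is finite. -/
structure Dominates (f φ : State → ℝ) (u : State × State → ℝ) : Prop where
  le : ∀ z, Admissible z → φ z.1 ≤ u (z.1, z.2.1) ∧ φ z.2.1 ≤ u (z.1, z.2.1) ∧
    φ (post K.m z.1 z.2.1 z.2.2) ≤ u (z.1, z.2.1) ∧
    φ (postStar K.m z.1 z.2.1 z.2.2) ≤ u (z.1, z.2.1)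
  integrable : Integrable (fun w => f w.1 * f w.2 * u w * K.speed w.1 w.2) pairMeasure
  nonneg : ∀ w : State × State, 0 < w.1.2 → 0 < w.2.2 → 0 ≤ u w

theorem integrable_coll_testFun (hf : Measurable f) (hf0 : ∀ x, 0 ≤ f x)
    (hdom : K.Dominates f φ u) {ψ : State × State × Param → ℝ} (hψ : Measurable ψ)
    (hψ0 : ∀ z, 0 ≤ ψ z) (hψu : ∀ z, Admissible z → ψ z ≤ u (z.1, z.2.1)) :
    Integrable (fun z => f z.1 * f z.2.1 * ψ z * K.rate z.1 z.2.1 z.2.2) collMeasure ∧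
      ∫ z, f z.1 * f z.2.1 * ψ z * K.rate z.1 z.2.1 z.2.2 ∂collMeasure ≤
        K.kappaUb * ∫ w, f w.1 * f w.2 * u w * K.speed w.1 w.2 ∂pairMeasure := by
  have hr := K.measurable_rate
  have hm : Measurable fun z : State × State × Param =>
      f z.1 * f z.2.1 * ψ z * K.rate z.1 z.2.1 z.2.2 := by fun_prop
  have h := K.integrable_coll_of_le hm hdom.integrable
    (fun w h1 h2 => mul_nonneg (mul_nonneg (hf0 _) (hf0 _)) (hdom.nonneg w h1 h2))
    (fun z hz => by
      have h0 := K.rate_nonneg hz.1 hz.2.1 hz.2.2.1 hz.2.2.2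
      have hff := mul_nonneg (hf0 z.1) (hf0 z.2.1)
      rw [abs_of_nonneg (mul_nonneg (mul_nonneg hff (hψ0 z)) h0)]
      exact mul_le_mul_of_nonneg_right (mul_le_mul_of_nonneg_left (hψu z hz) hff) h0)
  exact ⟨h.1, (integral_mono h.1 h.1.abs fun z => le_abs_self _).trans h.2⟩

/-- The second molecule contributes to the collision integral as much as the first one:
`lintegral_exchange` for test functions. -/
theorem integral_coll_exchange (hf : Measurable f) (hf0 : ∀ x, 0 ≤ f x)
    {Ψ : State × State → State × State → ℝ}
    (hΨ : Measurable fun q : (State × State) × (State × State) => Ψ q.1 q.2)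
    (hΨ0 : ∀ w w', 0 ≤ Ψ w w') :
    ∫ z, f z.1 * f z.2.1 * Ψ (z.1, z.2.1) (post K.m z.1 z.2.1 z.2.2, postStar K.m z.1 z.2.1 z.2.2)
        * K.rate z.1 z.2.1 z.2.2 ∂collMeasure
      = ∫ z, f z.1 * f z.2.1 *
        Ψ (z.2.1, z.1) (postStar K.m z.1 z.2.1 z.2.2, post K.m z.1 z.2.1 z.2.2)
        * K.rate z.1 z.2.1 z.2.2 ∂collMeasure := by
  have hr := K.measurable_rate
  have hp := measurable_post K.m
  have hps := measurable_postStar K.m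
  have hΨ1 : Measurable fun z : State × State × Param => Ψ (z.1, z.2.1)
      (post K.m z.1 z.2.1 z.2.2, postStar K.m z.1 z.2.1 z.2.2) :=
    hΨ.comp (f := fun z : State × State × Param => ((z.1, z.2.1),
      (post K.m z.1 z.2.1 z.2.2, postStar K.m z.1 z.2.1 z.2.2))) (by fun_prop)
  have hΨ2 : Measurable fun z : State × State × Param => Ψ (z.2.1, z.1)
      (postStar K.m z.1 z.2.1 z.2.2, post K.m z.1 z.2.1 z.2.2) :=
    hΨ.comp (f := fun z : State × State × Param => ((z.2.1, z.1),
      (postStar K.m z.1 z.2.1 z.2.2, post K.m z.1 z.2.1 z.2.2))) (by fun_prop)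
  have hnn : ∀ Φ : State × State × Param → ℝ, (∀ z, 0 ≤ Φ z) → 0 ≤ᵐ[collMeasure]
      fun z => f z.1 * f z.2.1 * Φ z * K.rate z.1 z.2.1 z.2.2 := fun Φ hΦ => by
    filter_upwards [ae_admissible] with z hz
    exact mul_nonneg (mul_nonneg (mul_nonneg (hf0 _) (hf0 _)) (hΦ z))
      (K.rate_nonneg hz.1 hz.2.1 hz.2.2.1 hz.2.2.2)
  rw [integral_eq_lintegral_of_nonneg_ae (hnn _ fun z => hΨ0 _ _)
      (Measurable.aestronglyMeasurable (by fun_prop)),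
    integral_eq_lintegral_of_nonneg_ae (hnn _ fun z => hΨ0 _ _)
      (Measurable.aestronglyMeasurable (by fun_prop))]
  congr 1
  have h := K.lintegral_exchange
    (Ψ := fun q => ENNReal.ofReal (f q.1.1 * f q.1.2 * Ψ q.1 q.2)) (by fun_prop)
  refine Eq.trans (lintegral_congr fun z => ?_) (h.trans (lintegral_congr fun z => ?_))
  · rw [ENNReal.ofReal_mul (mul_nonneg (mul_nonneg (hf0 _) (hf0 _)) (hΨ0 _ _))]
  · rw [← ENNReal.ofReal_mul (mul_nonneg (mul_nonneg (hf0 _) (hf0 _)) (hΨ0 _ _)),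
      mul_comm (f z.2.1)]

theorem measurable_gainIntegrand (hf : Measurable f) : Measurable (K.gainIntegrand f f) := by
  have h1 := hf.comp (measurable_post K.m)
  have h2 := hf.comp (measurable_postStar K.m)
  have h3 := (h1.mul h2).mul K.measurable_reversedRate
  convert h3 using 1
  ext z
  simp only [gainIntegrand, Pi.mul_apply, Function.comp_apply]
  ring

/-- The gain term tested with `φ`: by the reversal of collisions, `φ` is evaluated at the outgoing
state of the first molecule. -/
theorem gainIntegrand_mul (hf : Measurable f) (hf0 : ∀ x, 0 ≤ f x) (hφ : Measurable φ)
    (hφ0 : ∀ x, 0 ≤ φ x) (hdom : K.Dominates f φ u) :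
    Integrable (fun z => K.gainIntegrand f f z * φ z.1) collMeasure ∧
      ∫ z, K.gainIntegrand f f z * φ z.1 ∂collMeasure
        = ∫ z, f z.1 * f z.2.1 * φ (post K.m z.1 z.2.1 z.2.2) * K.rate z.1 z.2.1 z.2.2
          ∂collMeasure := by
  have hr := K.measurable_rate
  have hp := measurable_post K.m
  have hI := (K.integrable_coll_testFun hf hf0 hdom (hφ.comp hp) (fun z => hφ0 _)
    (fun z hz => (hdom.le z hz).2.2.1)).1
  have hg := K.measurable_gainIntegrand hf
  have hm : Measurable fun z => K.gainIntegrand f f z * φ z.1 := by fun_prop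
  have hnn : 0 ≤ᵐ[collMeasure] fun z => K.gainIntegrand f f z * φ z.1 := by
    filter_upwards [ae_admissible] with z hz
    have h1 := post_snd_pos K.m_pos hz.1 hz.2.1 hz.2.2.1 hz.2.2.2
    exact mul_nonneg (mul_nonneg (mul_nonneg (mul_nonneg (hf0 _) (hf0 _)) (Real.rpow_nonneg
      (div_nonneg (mul_nonneg hz.1.le hz.2.1.le) (mul_nonneg h1.1.le h1.2.le)) _))
      (K.rate_nonneg hz.1 hz.2.1 hz.2.2.1 hz.2.2.2)) (hφ0 _)
  have hnn2 : 0 ≤ᵐ[collMeasure] fun z =>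
      f z.1 * f z.2.1 * φ (post K.m z.1 z.2.1 z.2.2) * K.rate z.1 z.2.1 z.2.2 := by
    filter_upwards [ae_admissible] with z hz
    exact mul_nonneg (mul_nonneg (mul_nonneg (hf0 _) (hf0 _)) (hφ0 _))
      (K.rate_nonneg hz.1 hz.2.1 hz.2.2.1 hz.2.2.2)
  have hl : ∫⁻ z, ENNReal.ofReal (K.gainIntegrand f f z * φ z.1) ∂collMeasure
      = ∫⁻ z, ENNReal.ofReal (f z.1 * f z.2.1 * φ (post K.m z.1 z.2.1 z.2.2) *
        K.rate z.1 z.2.1 z.2.2) ∂collMeasure := by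
    have h := K.lintegral_reversible
      (Ψ := fun q => ENNReal.ofReal (f q.2.1 * f q.2.2 * φ q.1.1)) (by fun_prop)
    refine Eq.trans (lintegral_congr fun z => ?_) (h.trans (lintegral_congr fun z => ?_))
    · rw [← ENNReal.ofReal_mul (mul_nonneg (mul_nonneg (hf0 _) (hf0 _)) (hφ0 _))]
      congr 1
      unfold gainIntegrand; ring
    · rw [← ENNReal.ofReal_mul (mul_nonneg (mul_nonneg (hf0 _) (hf0 _)) (hφ0 _))]
  constructor
  · refine ⟨hm.aestronglyMeasurable, ?_⟩
    rw [hasFiniteIntegral_iff_ofReal hnn, hl, ← hasFiniteIntegral_iff_ofReal hnn2]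
    exact hI.2
  · rw [integral_eq_lintegral_of_nonneg_ae hnn hm.aestronglyMeasurable, hl,
      ← integral_eq_lintegral_of_nonneg_ae hnn2 hI.1]

/-- The change of `φ + φ_*` in a collision. -/
def collDiff (φ : State → ℝ) (z : State × State × Param) : ℝ :=
  φ (post K.m z.1 z.2.1 z.2.2) + φ (postStar K.m z.1 z.2.1 z.2.2) - φ z.1 - φ z.2.1

/-- The weak form of the collision operator, and an absolute bound on the average of a test
function, in which gain and loss are not set off against each other. -/
theorem collOp_weakForm (hf : Measurable f) (hf0 : ∀ x, 0 ≤ f x) (hφ : Measurable φ)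
    (hφ0 : ∀ x, 0 ≤ φ x) (hdom : K.Dominates f φ u) :
    Integrable (fun x => K.collOp f f x * φ x) stateMeasure ∧
    Integrable (fun z => f z.1 * f z.2.1 * K.collDiff φ z * K.rate z.1 z.2.1 z.2.2) collMeasure ∧
    ∫ x, K.collOp f f x * φ x ∂stateMeasure = 1 / 2 *
      ∫ z, f z.1 * f z.2.1 * K.collDiff φ z * K.rate z.1 z.2.1 z.2.2 ∂collMeasure ∧
    ∫ x, |K.collOp f f x * φ x| ∂stateMeasure ≤
      2 * (K.kappaUb * ∫ w, f w.1 * f w.2 * u w * K.speed w.1 w.2 ∂pairMeasure) := by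
  have hp := measurable_post K.m
  have hps := measurable_postStar K.m
  have I1 := K.integrable_coll_testFun hf hf0 hdom (hφ.comp measurable_fst) (fun z => hφ0 _)
    (fun z hz => (hdom.le z hz).1)
  have I2 := K.integrable_coll_testFun hf hf0 hdom
    (hφ.comp (measurable_fst.comp measurable_snd)) (fun z => hφ0 _)
    (fun z hz => (hdom.le z hz).2.1)
  have I3 := K.integrable_coll_testFun hf hf0 hdom (hφ.comp hp) (fun z => hφ0 _)
    (fun z hz => (hdom.le z hz).2.2.1)
  have I4 := K.integrable_coll_testFun hf hf0 hdom (hφ.comp hps) (fun z => hφ0 _)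
    (fun z hz => (hdom.le z hz).2.2.2)
  simp only [Function.comp_apply] at I1 I2 I3 I4
  have e12 := K.integral_coll_exchange hf hf0 (Ψ := fun w _ => φ w.1) (by fun_prop)
    (fun _ _ => hφ0 _)
  have e34 := K.integral_coll_exchange hf hf0 (Ψ := fun _ w => φ w.1) (by fun_prop)
    (fun _ _ => hφ0 _)
  simp only at e12 e34
  have G := K.gainIntegrand_mul hf hf0 hφ hφ0 hdom
  have hgain : ∀ x, K.gain f f x * φ x
      = ∫ q, K.gainIntegrand f f (x, q) * φ x ∂(stateMeasure.prod paramMeasure) := fun x =>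
    (integral_mul_const _ _).symm
  have hfreq : ∀ x, f x * K.freq f x * φ x
      = ∫ q : State × Param, f x * f q.1 * φ x * K.rate x q.1 q.2
        ∂(stateMeasure.prod paramMeasure) := fun x => by
    unfold freq
    rw [← integral_const_mul, ← integral_mul_const]
    congr 1; ext q; ring
  have hGi : Integrable (fun x => K.gain f f x * φ x) stateMeasure := by
    simp_rw [hgain]; exact G.1.integral_prod_left
  have hFi : Integrable (fun x => f x * K.freq f x * φ x) stateMeasure := by
    simp_rw [hfreq]; exact I1.1.integral_prod_left
  have hGe : ∫ x, K.gain f f x * φ x ∂stateMeasure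
      = ∫ z, f z.1 * f z.2.1 * φ (post K.m z.1 z.2.1 z.2.2) * K.rate z.1 z.2.1 z.2.2
          ∂collMeasure := by
    rw [← G.2]
    simp_rw [hgain]
    exact (integral_prod _ G.1).symm
  have hFe : ∫ x, f x * K.freq f x * φ x ∂stateMeasure
      = ∫ z, f z.1 * f z.2.1 * φ z.1 * K.rate z.1 z.2.1 z.2.2 ∂collMeasure := by
    simp_rw [hfreq]
    exact (integral_prod _ I1.1).symm
  have hsplit : (fun x => K.collOp f f x * φ x)
      = fun x => K.gain f f x * φ x - f x * K.freq f x * φ x := by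
    ext x; unfold collOp; ring
  have hQi : Integrable (fun x => K.collOp f f x * φ x) stateMeasure := by
    rw [hsplit]; exact hGi.sub hFi
  have hdiff : (fun z => f z.1 * f z.2.1 * K.collDiff φ z * K.rate z.1 z.2.1 z.2.2)
      = fun z => f z.1 * f z.2.1 * φ (post K.m z.1 z.2.1 z.2.2) * K.rate z.1 z.2.1 z.2.2
        + f z.1 * f z.2.1 * φ (postStar K.m z.1 z.2.1 z.2.2) * K.rate z.1 z.2.1 z.2.2
        - f z.1 * f z.2.1 * φ z.1 * K.rate z.1 z.2.1 z.2.2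
        - f z.1 * f z.2.1 * φ z.2.1 * K.rate z.1 z.2.1 z.2.2 := by
    ext z; unfold collDiff; ring
  have hDi : Integrable (fun z => f z.1 * f z.2.1 * K.collDiff φ z * K.rate z.1 z.2.1 z.2.2)
      collMeasure := by
    rw [hdiff]; exact ((I3.1.add I4.1).sub I1.1).sub I2.1
  have S1 : Integrable (fun z : State × State × Param =>
      f z.1 * f z.2.1 * φ (post K.m z.1 z.2.1 z.2.2) * K.rate z.1 z.2.1 z.2.2
        + f z.1 * f z.2.1 * φ (postStar K.m z.1 z.2.1 z.2.2) * K.rate z.1 z.2.1 z.2.2)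
      collMeasure := I3.1.add I4.1
  have S2 : Integrable (fun z : State × State × Param =>
      f z.1 * f z.2.1 * φ (post K.m z.1 z.2.1 z.2.2) * K.rate z.1 z.2.1 z.2.2
        + f z.1 * f z.2.1 * φ (postStar K.m z.1 z.2.1 z.2.2) * K.rate z.1 z.2.1 z.2.2
        - f z.1 * f z.2.1 * φ z.1 * K.rate z.1 z.2.1 z.2.2)
      collMeasure := S1.sub I1.1
  refine ⟨hQi, hDi, ?_, ?_⟩
  · rw [hdiff, integral_sub S2 I2.1, integral_sub S1 I1.1,
      integral_add I3.1 I4.1, ← e12, ← e34, hsplit, integral_sub hGi hFi, hGe, hFe]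
    ring
  · have hGn : ∀ᵐ x ∂stateMeasure, 0 ≤ K.gain f f x * φ x := by
      have hz : ∀ᵐ x ∂stateMeasure, ∀ᵐ q ∂(stateMeasure.prod paramMeasure), Admissible (x, q) :=
        Measure.ae_ae_of_ae_prod ae_admissible
      filter_upwards [hz] with x hx
      rw [hgain]
      refine integral_nonneg_of_ae ?_
      filter_upwards [hx] with q hz
      have h1 := post_snd_pos K.m_pos hz.1 hz.2.1 hz.2.2.1 hz.2.2.2
      exact mul_nonneg (mul_nonneg (mul_nonneg (mul_nonneg (hf0 _) (hf0 _)) (Real.rpow_nonneg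
        (div_nonneg (mul_nonneg hz.1.le hz.2.1.le) (mul_nonneg h1.1.le h1.2.le)) _))
        (K.rate_nonneg hz.1 hz.2.1 hz.2.2.1 hz.2.2.2)) (hφ0 _)
    have hFn : ∀ᵐ x ∂stateMeasure, 0 ≤ f x * K.freq f x * φ x := by
      have hz : ∀ᵐ x ∂stateMeasure, ∀ᵐ q ∂(stateMeasure.prod paramMeasure), Admissible (x, q) :=
        Measure.ae_ae_of_ae_prod ae_admissible
      filter_upwards [hz] with x hx
      rw [hfreq]
      refine integral_nonneg_of_ae ?_
      filter_upwards [hx] with q hz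
      exact mul_nonneg (mul_nonneg (mul_nonneg (hf0 _) (hf0 _)) (hφ0 _))
        (K.rate_nonneg hz.1 hz.2.1 hz.2.2.1 hz.2.2.2)
    have hle : ∫ x, |K.collOp f f x * φ x| ∂stateMeasure
        ≤ ∫ x, (K.gain f f x * φ x + f x * K.freq f x * φ x) ∂stateMeasure := by
      refine integral_mono_ae hQi.abs (hGi.add hFi) ?_
      filter_upwards [hGn, hFn] with x h1 h2
      have : K.collOp f f x * φ x = K.gain f f x * φ x - f x * K.freq f x * φ x := by
        unfold collOp; ring
      rw [this, abs_le]
      constructor <;> linarith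
    rw [integral_add hGi hFi, hGe, hFe] at hle
    linarith [I1.2, I3.2]

end WeakForm

end CollisionKernel

/-! ### Truncated powers and pointwise inequalities -/

/-- The power `z ^ p`, continued linearly in `z` beyond `n` (with a kink at `n`). -/
def truncPow (p n z : ℝ) : ℝ := z * min z n ^ (p - 1)

section TruncPow

variable {p n : ℝ}

theorem measurable_truncPow (p n : ℝ) : Measurable (truncPow p n) := by
  unfold truncPow; fun_prop

theorem truncPow_nonneg (hn : 0 ≤ n) {z : ℝ} (hz : 0 ≤ z) : 0 ≤ truncPow p n z :=
  mul_nonneg hz (Real.rpow_nonneg (le_min hz hn) _)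

theorem rpow_eq_mul_rpow_sub_one {z : ℝ} (hz : 0 < z) (p : ℝ) : z ^ p = z * z ^ (p - 1) := by
  conv_lhs => rw [show p = 1 + (p - 1) by ring, Real.rpow_add hz, Real.rpow_one]

theorem truncPow_of_le {z : ℝ} (hz : 0 < z) (hzn : z ≤ n) : truncPow p n z = z ^ p := by
  rw [truncPow, min_eq_left hzn, ← rpow_eq_mul_rpow_sub_one hz]

theorem truncPow_le_rpow (hp : 1 ≤ p) (hn : 0 ≤ n) {z : ℝ} (hz : 0 < z) :
    truncPow p n z ≤ z ^ p := by
  rw [truncPow, rpow_eq_mul_rpow_sub_one hz]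
  exact mul_le_mul_of_nonneg_left (Real.rpow_le_rpow (le_min hz.le hn) (min_le_left _ _)
    (by linarith)) hz.le

theorem truncPow_add_le (hp : 1 ≤ p) (hn : 0 ≤ n) {x y : ℝ} (hx : 0 ≤ x) (hy : 0 ≤ y) :
    truncPow p n x + truncPow p n y ≤ truncPow p n (x + y) := by
  unfold truncPow
  rw [add_mul]
  have h : ∀ z, 0 ≤ z → z ≤ x + y → min z n ^ (p - 1) ≤ min (x + y) n ^ (p - 1) := fun z hz hzx =>
    Real.rpow_le_rpow (le_min hz hn) (min_le_min_right _ hzx) (by linarith)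
  exact add_le_add (mul_le_mul_of_nonneg_left (h x hx (by linarith)) hx)
    (mul_le_mul_of_nonneg_left (h y hy (by linarith)) hy)

theorem truncPow_mul_le (hp : 1 ≤ p) (hn : 0 ≤ n) {s z : ℝ} (hs : 1 ≤ s) (hz : 0 ≤ z) :
    truncPow p n (s * z) ≤ s ^ p * truncPow p n z := by
  have hs0 : 0 < s := by linarith
  have h1 : min (s * z) n ≤ s * min z n := by
    rcases le_total z n with h | h
    · rw [min_eq_left h]; exact min_le_left _ _
    · rw [min_eq_right h]
      exact (min_le_right _ _).trans (by nlinarith)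
  have h2 : min (s * z) n ^ (p - 1) ≤ s ^ (p - 1) * min z n ^ (p - 1) := by
    rw [← Real.mul_rpow hs0.le (le_min hz hn)]
    exact Real.rpow_le_rpow (le_min (by positivity) hn) h1 (by linarith)
  unfold truncPow
  rw [rpow_eq_mul_rpow_sub_one hs0 p]
  calc s * z * min (s * z) n ^ (p - 1) ≤ s * z * (s ^ (p - 1) * min z n ^ (p - 1)) := by gcongr
    _ = _ := by ring

/-- The defect `n^{p-1} z - truncPow p n z` is bounded: it vanishes for `z ≥ n`. -/
theorem truncPow_defect (hp : 1 ≤ p) (hn : 0 ≤ n) {z : ℝ} (hz : 0 ≤ z) :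
    0 ≤ n ^ (p - 1) * z - truncPow p n z ∧ n ^ (p - 1) * z - truncPow p n z ≤ n ^ (p - 1) * n := by
  have h0 := truncPow_nonneg (p := p) hn hz
  have hnp : 0 ≤ n ^ (p - 1) := Real.rpow_nonneg hn _
  constructor
  · have : min z n ^ (p - 1) ≤ n ^ (p - 1) :=
      Real.rpow_le_rpow (le_min hz hn) (min_le_right _ _) (by linarith)
    unfold truncPow
    nlinarith
  · rcases le_total z n with h | h
    · have := mul_le_mul_of_nonneg_left h hnp
      linarith
    · have : truncPow p n z = n ^ (p - 1) * z := by
        rw [truncPow, min_eq_right h, mul_comm]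
      rw [this, sub_self]; positivity

theorem one_add_rpow_le (hp : 1 ≤ p) {t : ℝ} (ht0 : 0 ≤ t) (ht1 : t ≤ 1) :
    (1 + t) ^ p ≤ 1 + 2 ^ p * t := by
  have h := (convexOn_rpow hp).2 (by simp : (1 : ℝ) ∈ Ici (0 : ℝ))
    (by simp : (2 : ℝ) ∈ Ici (0 : ℝ)) (sub_nonneg.2 ht1) ht0 (sub_add_cancel 1 t)
  simp only [smul_eq_mul, Real.one_rpow] at h
  rw [show (1 - t) * 1 + t * 2 = 1 + t by ring] at h
  linarith

/-- The case `b ≤ a` of `truncPow_povzner`: the increment of `truncPow` from `a²` to `a² + b²` is at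
most of the order `(b / a)²` of its value, which outweighs the factor `a ^ ζ` as `ζ ≤ 2`. -/
theorem truncPow_povzner_aux (hp : 1 ≤ p) (hn : 0 ≤ n) {ζ : ℝ} (hζ : 0 ≤ ζ) (hζ2 : ζ ≤ 2)
    {a b : ℝ} (ha : 1 ≤ a) (hb : 1 ≤ b) (hba : b ≤ a) :
    (a ^ ζ + b ^ ζ) *
      (truncPow p n (a ^ 2 + b ^ 2) - truncPow p n (a ^ 2) - truncPow p n (b ^ 2)) ≤
      2 ^ (p + 1) * (truncPow p n (a ^ 2) * b ^ 2) := by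
  have ha0 : 0 < a := by linarith
  have hb0 : 0 < b := by linarith
  have e : a ^ 2 + b ^ 2 = (1 + b ^ 2 / a ^ 2) * a ^ 2 := by field_simp
  have ht : b ^ 2 / a ^ 2 ≤ 1 := (div_le_one (by positivity)).2 (by nlinarith)
  have ht0 : 0 ≤ b ^ 2 / a ^ 2 := by positivity
  have hT := truncPow_nonneg (p := p) hn (sq_nonneg a)
  have h1 : truncPow p n (a ^ 2 + b ^ 2) ≤
      (1 + 2 ^ p * (b ^ 2 / a ^ 2)) * truncPow p n (a ^ 2) := by
    rw [e]
    refine (truncPow_mul_le hp hn (by linarith) (sq_nonneg a)).trans ?_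
    exact mul_le_mul_of_nonneg_right (one_add_rpow_le hp ht0 ht) hT
  have h2 : truncPow p n (a ^ 2 + b ^ 2) - truncPow p n (a ^ 2) - truncPow p n (b ^ 2)
      ≤ 2 ^ p * (b ^ 2 / a ^ 2) * truncPow p n (a ^ 2) := by
    have := truncPow_nonneg (p := p) hn (sq_nonneg b)
    linarith
  have h3 : a ^ ζ ≤ a ^ 2 := by
    rw [← Real.rpow_natCast]; exact Real.rpow_le_rpow_of_exponent_le ha (by exact_mod_cast hζ2)
  have h4 : b ^ ζ ≤ a ^ ζ := Real.rpow_le_rpow hb0.le hba hζ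
  calc (a ^ ζ + b ^ ζ) *
        (truncPow p n (a ^ 2 + b ^ 2) - truncPow p n (a ^ 2) - truncPow p n (b ^ 2))
      ≤ (a ^ ζ + b ^ ζ) * (2 ^ p * (b ^ 2 / a ^ 2) * truncPow p n (a ^ 2)) := by gcongr
    _ ≤ (2 * a ^ 2) * (2 ^ p * (b ^ 2 / a ^ 2) * truncPow p n (a ^ 2)) := by
        refine mul_le_mul_of_nonneg_right (by linarith) (by positivity)
    _ = 2 ^ (p + 1) * (truncPow p n (a ^ 2) * b ^ 2) := by
        rw [Real.rpow_add two_pos, Real.rpow_one]; field_simp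

/-- The Povzner-type bound for the part of the collision which increases moments. -/
theorem truncPow_povzner (hp : 1 ≤ p) (hn : 0 ≤ n) {ζ : ℝ} (hζ : 0 ≤ ζ) (hζ2 : ζ ≤ 2)
    {a b : ℝ} (ha : 1 ≤ a) (hb : 1 ≤ b) :
    (a ^ ζ + b ^ ζ) *
      (truncPow p n (a ^ 2 + b ^ 2) - truncPow p n (a ^ 2) - truncPow p n (b ^ 2)) ≤
      2 ^ (p + 1) * (truncPow p n (a ^ 2) * b ^ 2 + a ^ 2 * truncPow p n (b ^ 2)) := by
  have hTa := truncPow_nonneg (p := p) hn (sq_nonneg a)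
  have hTb := truncPow_nonneg (p := p) hn (sq_nonneg b)
  have h2 : (0 : ℝ) ≤ 2 ^ (p + 1) := by positivity
  rcases le_total b a with h | h
  · have := truncPow_povzner_aux hp hn hζ hζ2 ha hb h
    nlinarith [mul_nonneg h2 (mul_nonneg (sq_nonneg a) hTb)]
  · have := truncPow_povzner_aux hp hn hζ hζ2 hb ha h
    rw [add_comm (b ^ 2)] at this
    nlinarith [mul_nonneg h2 (mul_nonneg hTa (sq_nonneg b))]

/-- The case of `truncPow_povzner` in which the truncation is not effective. -/
theorem rpow_povzner {k : ℝ} (hk : 2 ≤ k) {ζ : ℝ} (hζ : 0 ≤ ζ) (hζ2 : ζ ≤ 2)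
    {a b : ℝ} (ha : 1 ≤ a) (hb : 1 ≤ b) :
    (a ^ ζ + b ^ ζ) * ((a ^ 2 + b ^ 2) ^ (k / 2) - a ^ k - b ^ k) ≤
      2 ^ (k / 2 + 1) * (a ^ k * b ^ 2 + a ^ 2 * b ^ k) := by
  have ha0 : 0 < a := by linarith
  have hb0 : 0 < b := by linarith
  have h := truncPow_povzner (p := k / 2) (n := a ^ 2 + b ^ 2) (by linarith) (by positivity)
    hζ hζ2 ha hb
  rw [truncPow_of_le (by positivity) le_rfl, truncPow_of_le (by positivity) (by nlinarith),
    truncPow_of_le (by positivity) (by nlinarith), ← rpow_eq_sq_rpow ha0.le,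
    ← rpow_eq_sq_rpow hb0.le] at h
  exact h

theorem rpow_add_rpow_le {k : ℝ} (hk : 2 ≤ k) {a b : ℝ} (ha : 0 < a) (hb : 0 < b) :
    a ^ k + b ^ k ≤ (a ^ 2 + b ^ 2) ^ (k / 2) := by
  have h := truncPow_add_le (p := k / 2) (n := a ^ 2 + b ^ 2) (by linarith) (by positivity)
    (sq_nonneg a) (sq_nonneg b)
  rwa [truncPow_of_le (by positivity) le_rfl, truncPow_of_le (by positivity) (by nlinarith),
    truncPow_of_le (by positivity) (by nlinarith), ← rpow_eq_sq_rpow ha.le,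
    ← rpow_eq_sq_rpow hb.le] at h

/-- Strict convexity: if the energy `S` is shared and neither part exceeds `(1 - δ) S`, then the sum
of the `p`-th powers is smaller than `S ^ p` by a fixed factor. -/
theorem rpow_add_rpow_le_of_fraction (hp : 1 ≤ p) {x y δ : ℝ} (hx : 0 < x) (hy : 0 < y)
    (hδ : δ ≤ 1) (h1 : δ * (x + y) ≤ x) (h2 : δ * (x + y) ≤ y) :
    x ^ p + y ^ p ≤ (1 - δ) ^ (p - 1) * (x + y) ^ p := by
  have hS : 0 < x + y := by linarith
  have h : ∀ z, 0 < z → z ≤ (1 - δ) * (x + y) →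
      z ^ p ≤ z * ((1 - δ) ^ (p - 1) * (x + y) ^ (p - 1)) := by
    intro z hz hzx
    rw [rpow_eq_mul_rpow_sub_one hz p, ← Real.mul_rpow (by linarith) hS.le]
    exact mul_le_mul_of_nonneg_left (Real.rpow_le_rpow hz.le hzx (by linarith)) hz.le
  have hx' := h x hx (by linarith)
  have hy' := h y hy (by linarith)
  rw [rpow_eq_mul_rpow_sub_one hS p]
  calc x ^ p + y ^ p ≤ _ := add_le_add hx' hy'
    _ = _ := by ring

end TruncPow

namespace CollisionKernel

variable (K : CollisionKernel)

theorem speed_le {x y : State} (hx : 0 < x.2) (hy : 0 < y.2) :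
    K.speed x y ≤ bracket K.m x ^ K.ζ + bracket K.m y ^ K.ζ := by
  have hζ := K.ζ_pos
  have h1 := collEnergy_div_le K.m_pos hx.le hy.le
  have h0 : 0 ≤ collEnergy K.m x y / K.m := (div_pos (collEnergy_pos K.m_pos hx hy) K.m_pos).le
  rw [rpow_eq_sq_rpow (bracket_nonneg K.m x), rpow_eq_sq_rpow (bracket_nonneg K.m y)]
  refine (Real.rpow_le_rpow h0 h1 (by positivity)).trans ?_
  exact Real.rpow_add_le_add_rpow (sq_nonneg _) (sq_nonneg _) (by positivity)
    (by linarith [K.ζ_le])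

/-- A fast molecule meets a slow one at high speed. This is where the dissipation of moments comes
from. -/
theorem le_speed {x y : State} (hx : 0 < x.2) (hy : 0 < y.2) :
    2 ^ (-K.ζ) * bracket K.m x ^ K.ζ - bracket K.m y ^ K.ζ ≤ K.speed x y := by
  have hζ := K.ζ_pos
  have h0 : 0 ≤ collEnergy K.m x y / K.m := (div_pos (collEnergy_pos K.m_pos hx hy) K.m_pos).le
  have h1 := bracket_sq_le_collEnergy K.m_pos hx.le hy.le
  have hb : 0 ≤ bracket K.m y ^ K.ζ := Real.rpow_nonneg (bracket_nonneg _ _) _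
  have h2 : bracket K.m x ^ K.ζ ≤ 2 ^ K.ζ * K.speed x y + 2 ^ (K.ζ / 2) * bracket K.m y ^ K.ζ := by
    rw [rpow_eq_sq_rpow (bracket_nonneg K.m x), rpow_eq_sq_rpow (bracket_nonneg K.m y)]
    refine (Real.rpow_le_rpow (sq_nonneg _) h1 (by positivity)).trans ?_
    refine (Real.rpow_add_le_add_rpow (by positivity) (by positivity) (by positivity)
      (by linarith [K.ζ_le])).trans (le_of_eq ?_)
    rw [Real.mul_rpow (by norm_num) h0, Real.mul_rpow (by norm_num) (sq_nonneg _),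
      rpow_eq_sq_rpow (by norm_num : (0 : ℝ) ≤ 2) K.ζ]
    norm_num [speed]
  have h3 : (2 : ℝ) ^ (-K.ζ) * 2 ^ K.ζ = 1 := by
    rw [← Real.rpow_add two_pos]; simp
  have h4 : (2 : ℝ) ^ (-K.ζ) * 2 ^ (K.ζ / 2) ≤ 1 := by
    rw [← Real.rpow_add two_pos]
    exact Real.rpow_le_one_of_one_le_of_nonpos one_le_two (by linarith)
  have h5 : (0 : ℝ) < 2 ^ (-K.ζ) := by positivity
  have h6 := mul_le_mul_of_nonneg_left h2 h5.le
  have h7 := mul_le_mul_of_nonneg_right h4 hb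
  calc 2 ^ (-K.ζ) * bracket K.m x ^ K.ζ - bracket K.m y ^ K.ζ
      ≤ (2 ^ (-K.ζ) * 2 ^ K.ζ) * K.speed x y
        + (2 ^ (-K.ζ) * 2 ^ (K.ζ / 2) * bracket K.m y ^ K.ζ) - bracket K.m y ^ K.ζ := by
        linarith
    _ ≤ K.speed x y := by rw [h3]; linarith

end CollisionKernel

/-! ### Moments -/

section Moments

variable {m : ℝ} {f : State → ℝ}

theorem ae_one_le_bracket (hm : 0 < m) : ∀ᵐ x ∂stateMeasure, 1 ≤ bracket m x := by
  filter_upwards [ae_state_pos] with x hx using one_le_bracket hm hx.le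

theorem MemL1.mono (hm : 0 < m) (hf : Measurable f) {k l : ℝ} (hkl : k ≤ l) (h : MemL1 m l f) :
    MemL1 m k f := by
  have hb := measurable_bracket m
  refine Integrable.mono h (Measurable.aestronglyMeasurable (by fun_prop)) ?_
  filter_upwards [ae_one_le_bracket hm] with x hx
  rw [norm_mul, norm_mul]
  refine mul_le_mul_of_nonneg_left ?_ (norm_nonneg _)
  rw [Real.norm_of_nonneg (Real.rpow_nonneg (bracket_nonneg _ _) _),
    Real.norm_of_nonneg (Real.rpow_nonneg (bracket_nonneg _ _) _)]
  exact Real.rpow_le_rpow_of_exponent_le hx hkl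

theorem normL1_nonneg (m k : ℝ) (f : State → ℝ) : 0 ≤ normL1 m k f :=
  integral_nonneg fun _ => mul_nonneg (abs_nonneg _) (Real.rpow_nonneg (bracket_nonneg _ _) _)

theorem normL1_eq (hf0 : ∀ x, 0 ≤ f x) (k : ℝ) :
    normL1 m k f = ∫ x, f x * bracket m x ^ k ∂stateMeasure := by
  unfold normL1; simp_rw [abs_of_nonneg (hf0 _)]

theorem normL1_mono (hm : 0 < m) (hf : Measurable f) (hf0 : ∀ x, 0 ≤ f x) {k l : ℝ} (hkl : k ≤ l)
    (h : MemL1 m l f) : normL1 m k f ≤ normL1 m l f := by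
  rw [normL1_eq hf0, normL1_eq hf0]
  refine integral_mono_ae (h.mono hm hf hkl) h ?_
  filter_upwards [ae_one_le_bracket hm] with x hx
  exact mul_le_mul_of_nonneg_left (Real.rpow_le_rpow_of_exponent_le hx hkl) (hf0 x)

/-- Interpolation between moments. -/
theorem normL1_interpolation (hm : 0 < m) (hf : Measurable f) (hf0 : ∀ x, 0 ≤ f x) {j k l θ : ℝ}
    (hθ0 : 0 ≤ θ) (hθ1 : θ ≤ 1) (hk : k = (1 - θ) * j + θ * l) (hjl : j ≤ l) (h : MemL1 m l f)
    (hpos : 0 < normL1 m j f) :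
    normL1 m k f ≤ normL1 m j f ^ (1 - θ) * normL1 m l f ^ θ := by
  have hj : MemL1 m j f := h.mono hm hf hjl
  have hkl : k ≤ l := by rw [hk]; nlinarith
  have hposl : 0 < normL1 m l f := hpos.trans_le (normL1_mono hm hf hf0 hjl h)
  set A := normL1 m j f with hA
  set B := normL1 m l f with hB
  have hAθ : 0 < A ^ (1 - θ) := by positivity
  have hBθ : 0 < B ^ θ := by positivity
  -- the weighted AM-GM inequality for the normalised densities
  have hpt : ∀ᵐ x ∂stateMeasure, f x * bracket m x ^ k ≤ A ^ (1 - θ) * B ^ θ *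
      ((1 - θ) * (A⁻¹ * (f x * bracket m x ^ j)) + θ * (B⁻¹ * (f x * bracket m x ^ l))) := by
    filter_upwards [ae_one_le_bracket hm] with x hx
    have hb0 : 0 < bracket m x := by linarith
    have hg := Real.geom_mean_le_arith_mean2_weighted (w₁ := 1 - θ) (w₂ := θ)
      (p₁ := A⁻¹ * (f x * bracket m x ^ j)) (p₂ := B⁻¹ * (f x * bracket m x ^ l))
      (by linarith) hθ0 (by have := hf0 x; positivity) (by have := hf0 x; positivity) (by ring)
    have hfx : f x ^ (1 - θ) * f x ^ θ = f x := by
      rcases (hf0 x).eq_or_lt with h0 | h0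
      · rw [← h0]
        rcases hθ0.eq_or_lt with h1 | h1
        · rw [← h1]; simp
        · rw [Real.zero_rpow h1.ne', mul_zero]
      · rw [← Real.rpow_add h0]; simp
    have hbx : (bracket m x ^ j) ^ (1 - θ) * (bracket m x ^ l) ^ θ = bracket m x ^ k := by
      rw [← Real.rpow_mul hb0.le, ← Real.rpow_mul hb0.le, ← Real.rpow_add hb0, hk]
      congr 1; ring
    have e : A ^ (1 - θ) * B ^ θ * ((A⁻¹ * (f x * bracket m x ^ j)) ^ (1 - θ) *
        (B⁻¹ * (f x * bracket m x ^ l)) ^ θ) = f x * bracket m x ^ k := by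
      have hf := hf0 x
      rw [Real.mul_rpow (by positivity) (by positivity), Real.mul_rpow hf (by positivity),
        Real.mul_rpow (by positivity) (by positivity), Real.mul_rpow hf (by positivity),
        Real.inv_rpow hpos.le, Real.inv_rpow hposl.le]
      calc _ = (A ^ (1 - θ) * (A ^ (1 - θ))⁻¹) * (B ^ θ * (B ^ θ)⁻¹) * (f x ^ (1 - θ) * f x ^ θ) *
            ((bracket m x ^ j) ^ (1 - θ) * (bracket m x ^ l) ^ θ) := by ring
        _ = _ := by
          rw [mul_inv_cancel₀ hAθ.ne', mul_inv_cancel₀ hBθ.ne', hfx, hbx]; ring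
    rw [← e]
    exact mul_le_mul_of_nonneg_left hg (by positivity)
  have hi1 : Integrable (fun x => (1 - θ) * (A⁻¹ * (f x * bracket m x ^ j))) stateMeasure :=
    (hj.const_mul _).const_mul _
  have hi2 : Integrable (fun x => θ * (B⁻¹ * (f x * bracket m x ^ l))) stateMeasure :=
    (h.const_mul _).const_mul _
  rw [normL1_eq hf0]
  refine (integral_mono_ae (h.mono hm hf hkl) ((hi1.add hi2).const_mul _) hpt).trans (le_of_eq ?_)
  simp only [Pi.add_apply]
  rw [integral_const_mul, integral_add hi1 hi2, integral_const_mul, integral_const_mul,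
    integral_const_mul, integral_const_mul, ← normL1_eq hf0, ← normL1_eq hf0, ← hA, ← hB,
    inv_mul_cancel₀ hpos.ne', inv_mul_cancel₀ hposl.ne']
  ring

theorem integrable_pair_mul {g h : State → ℝ} (hg : Integrable g stateMeasure)
    (hh : Integrable h stateMeasure) :
    Integrable (fun w : State × State => g w.1 * h w.2) pairMeasure :=
  hg.mul_prod hh

theorem integral_pair_mul (g h : State → ℝ) :
    ∫ w : State × State, g w.1 * h w.2 ∂pairMeasure
      = (∫ x, g x ∂stateMeasure) * ∫ y, h y ∂stateMeasure :=
  integral_prod_mul g h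

end Moments

/-! ### The a priori estimate on the Dirichlet form -/

namespace CollisionKernel

variable (K : CollisionKernel)

theorem energy_sq_rpow_le {a b l : ℝ} (ha : 0 < a) (hb : 0 < b) (hl : 0 ≤ l) :
    (a ^ 2 + b ^ 2) ^ (l / 2) ≤ 2 ^ (l / 2) * (a ^ l + b ^ l) := by
  have h : ∀ c d : ℝ, 0 < c → 0 < d → d ≤ c →
      (c ^ 2 + d ^ 2) ^ (l / 2) ≤ 2 ^ (l / 2) * (c ^ l + d ^ l) := by
    intro c d hc hd hdc
    have h1 : (c ^ 2 + d ^ 2) ^ (l / 2) ≤ (2 * c ^ 2) ^ (l / 2) :=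
      Real.rpow_le_rpow (by positivity) (by nlinarith) (by positivity)
    rw [Real.mul_rpow two_pos.le (sq_nonneg c), ← rpow_eq_sq_rpow hc.le] at h1
    refine h1.trans (mul_le_mul_of_nonneg_left ?_ (by positivity))
    have : 0 < d ^ l := by positivity
    linarith
  rcases le_total b a with hba | hba
  · exact h a b ha hb hba
  · have := h b a hb ha hba
    rwa [add_comm (b ^ 2), add_comm (b ^ l)] at this

variable {f : State → ℝ}

theorem integrable_pair_bracket {p q : ℝ} (hp : MemL1 K.m p f)
    (hq : MemL1 K.m q f) :
    Integrable (fun w : State × State =>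
      f w.1 * f w.2 * (bracket K.m w.1 ^ p * bracket K.m w.2 ^ q)) pairMeasure := by
  refine (integrable_pair_mul hp hq).congr (ae_of_all _ fun w => ?_)
  ring

theorem integral_pair_bracket (hf0 : ∀ x, 0 ≤ f x) (p q : ℝ) :
    ∫ w : State × State, f w.1 * f w.2 * (bracket K.m w.1 ^ p * bracket K.m w.2 ^ q) ∂pairMeasure
      = normL1 K.m p f * normL1 K.m q f := by
  rw [normL1_eq hf0, normL1_eq hf0, ← integral_pair_mul]
  congr 1; ext w; ring

theorem speed_mul_energy_le {x y : State} (hx : 0 < x.2) (hy : 0 < y.2) {k : ℝ} (hk : 0 ≤ k) :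
    (bracket K.m x ^ 2 + bracket K.m y ^ 2) ^ (k / 2) * K.speed x y ≤
      2 ^ ((k + K.ζ) / 2) * (bracket K.m x ^ (k + K.ζ) + bracket K.m y ^ (k + K.ζ)) := by
  have hζ := K.ζ_pos
  have ha : 0 < bracket K.m x := by linarith [one_le_bracket K.m_pos hx.le]
  have hb : 0 < bracket K.m y := by linarith [one_le_bracket K.m_pos hy.le]
  have h0 : 0 ≤ collEnergy K.m x y / K.m := (div_pos (collEnergy_pos K.m_pos hx hy) K.m_pos).le
  have h1 : K.speed x y ≤ (bracket K.m x ^ 2 + bracket K.m y ^ 2) ^ (K.ζ / 2) :=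
    Real.rpow_le_rpow h0 (collEnergy_div_le K.m_pos hx.le hy.le) (by positivity)
  refine (mul_le_mul_of_nonneg_left h1 (by positivity)).trans ?_
  rw [← Real.rpow_add (by positivity), ← add_div]
  exact energy_sq_rpow_le ha hb (by positivity)

theorem integral_energy_speed (hf : Measurable f) (hf0 : ∀ x, 0 ≤ f x) {k : ℝ} (hk : 0 ≤ k)
    (h : MemL1 K.m (k + K.ζ) f) :
    Integrable (fun w : State × State => f w.1 * f w.2 *
      (bracket K.m w.1 ^ 2 + bracket K.m w.2 ^ 2) ^ (k / 2) * K.speed w.1 w.2) pairMeasure ∧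
    ∫ w : State × State, f w.1 * f w.2 *
      (bracket K.m w.1 ^ 2 + bracket K.m w.2 ^ 2) ^ (k / 2) * K.speed w.1 w.2 ∂pairMeasure
      ≤ 2 ^ ((k + K.ζ) / 2) * (2 * (normL1 K.m 0 f * normL1 K.m (k + K.ζ) f)) := by
  have hζ := K.ζ_pos
  have h0 : MemL1 K.m 0 f := h.mono K.m_pos hf (by positivity)
  have i1 := K.integrable_pair_bracket h h0
  have i2 := K.integrable_pair_bracket h0 h
  have hb := measurable_bracket K.m
  have hs := K.measurable_speed
  have hle : ∀ᵐ w ∂pairMeasure, f w.1 * f w.2 *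
      (bracket K.m w.1 ^ 2 + bracket K.m w.2 ^ 2) ^ (k / 2) * K.speed w.1 w.2 ≤
      2 ^ ((k + K.ζ) / 2) * (f w.1 * f w.2 * (bracket K.m w.1 ^ (k + K.ζ) * bracket K.m w.2 ^ (0:ℝ))
        + f w.1 * f w.2 * (bracket K.m w.1 ^ (0:ℝ) * bracket K.m w.2 ^ (k + K.ζ))) := by
    filter_upwards [ae_pair_admissible] with w hw
    have := mul_le_mul_of_nonneg_left (K.speed_mul_energy_le hw.1 hw.2.1 hk)
      (mul_nonneg (hf0 w.1) (hf0 w.2))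
    refine le_trans (le_of_eq (by ring)) (this.trans (le_of_eq ?_))
    simp only [Real.rpow_zero]; ring
  have hI : Integrable (fun w : State × State => f w.1 * f w.2 *
      (bracket K.m w.1 ^ 2 + bracket K.m w.2 ^ 2) ^ (k / 2) * K.speed w.1 w.2) pairMeasure := by
    refine Integrable.mono' ((i1.add i2).const_mul (2 ^ ((k + K.ζ) / 2)))
      (Measurable.aestronglyMeasurable (by fun_prop)) ?_
    filter_upwards [hle, ae_pair_admissible] with w h1 h2
    rw [Real.norm_of_nonneg]
    · exact h1
    · exact mul_nonneg (mul_nonneg (mul_nonneg (hf0 _) (hf0 _)) (by positivity))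
        (K.speed_pos h2.1 h2.2.1).le
  refine ⟨hI, (integral_mono_ae hI ((i1.add i2).const_mul _) hle).trans (le_of_eq ?_)⟩
  simp only [Pi.add_apply]
  rw [integral_const_mul, integral_add i1 i2, K.integral_pair_bracket hf0,
    K.integral_pair_bracket hf0]
  ring

/-- Powers of the bracket are controlled along collisions by the conserved energy of the pair. -/
theorem dominates_bracket (hf : Measurable f) (hf0 : ∀ x, 0 ≤ f x) {k : ℝ} (hk : 0 ≤ k)
    (h : MemL1 K.m (k + K.ζ) f) :
    K.Dominates f (fun x => bracket K.m x ^ k)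
      (fun w => (bracket K.m w.1 ^ 2 + bracket K.m w.2 ^ 2) ^ (k / 2)) where
  le z hz := by
    have hc := bracket_sq_post_add K.m_pos hz.1.le hz.2.1.le hz.2.2.1 hz.2.2.2
    have hle : ∀ x, bracket K.m x ^ 2 ≤ bracket K.m z.1 ^ 2 + bracket K.m z.2.1 ^ 2 →
        bracket K.m x ^ k ≤ (bracket K.m z.1 ^ 2 + bracket K.m z.2.1 ^ 2) ^ (k / 2) := by
      intro x hx
      rw [rpow_eq_sq_rpow (bracket_nonneg _ _)]
      exact Real.rpow_le_rpow (sq_nonneg _) hx (by positivity)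
    refine ⟨hle _ ?_, hle _ ?_, hle _ ?_, hle _ ?_⟩ <;>
      nlinarith [sq_nonneg (bracket K.m z.1), sq_nonneg (bracket K.m z.2.1),
        sq_nonneg (bracket K.m (post K.m z.1 z.2.1 z.2.2)),
        sq_nonneg (bracket K.m (postStar K.m z.1 z.2.1 z.2.2))]
  integrable := (K.integral_energy_speed hf hf0 hk h).1
  nonneg w _ _ := by positivity

/-- Averaging over the collision parameters yields the Povzner estimate with constant `𝒞_k`. -/
theorem integral_collDiff_le {C : ℝ → ℝ} (hC : K.IsAveragingConst C) {k : ℝ} (hk : 2 < k)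
    {x y : State} (hx : 0 < x.2) (hy : 0 < y.2) (hxy : x.1 ≠ y.1)
    (hCk : C k < K.kappaLb) :
    ∫ p, K.collDiff (fun x => bracket K.m x ^ k) (x, y, p) * K.rate x y p ∂paramMeasure ≤
      -((K.kappaLb - C k) * 2 ^ (-K.ζ)) *
        (bracket K.m x ^ (k + K.ζ) + bracket K.m y ^ (k + K.ζ))
      + (C k * 2 ^ (k / 2 + 1) + (K.kappaLb - C k)) *
        (bracket K.m x ^ k * bracket K.m y ^ (2 : ℝ) +
          bracket K.m x ^ (2 : ℝ) * bracket K.m y ^ k) := by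
  have hζ := K.ζ_pos
  have hζ2 := K.ζ_le
  have ha1 := one_le_bracket K.m_pos hx.le
  have hb1 := one_le_bracket K.m_pos hy.le
  have hX := K.speed_pos hx hy
  have hCn := hC.nonneg k (by linarith)
  have hr := K.integrable_rate hx hy hxy
  have hmr : Measurable fun p => K.rate x y p :=
    K.measurable_rate.comp (f := fun p : Param => (x, y, p)) (by fun_prop)
  have hma : Measurable fun p => K.angular x y p :=
    K.measurable_angular.comp (f := fun p : Param => (x, y, p)) (by fun_prop)
  have hmp : Measurable fun p => bracket K.m (post K.m x y p) := (measurable_bracket K.m).comp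
    ((measurable_post K.m).comp (f := fun p : Param => (x, y, p)) (by fun_prop))
  have hmps : Measurable fun p => bracket K.m (postStar K.m x y p) := (measurable_bracket K.m).comp
    ((measurable_postStar K.m).comp (f := fun p : Param => (x, y, p)) (by fun_prop))
  have hbound := hC.bound k (by linarith) x y hx hy hxy
  set a := bracket K.m x with ha
  set b := bracket K.m y with hb
  set S := (a ^ 2 + b ^ 2) ^ (k / 2) with hS
  have hS0 : 0 ≤ S := by positivity
  have hφ : ∀ p : Param, p.2.1 ∈ Ioo (0 : ℝ) 1 → p.2.2 ∈ Ioo (0 : ℝ) 1 →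
      bracket K.m (post K.m x y p) ^ k + bracket K.m (postStar K.m x y p) ^ k ≤ 2 * S := by
    intro p h1 h2
    have hc := bracket_sq_post_add K.m_pos hx.le hy.le h1 h2
    have h3 : ∀ z, bracket K.m z ^ 2 ≤ a ^ 2 + b ^ 2 → bracket K.m z ^ k ≤ S := by
      intro z hz
      rw [rpow_eq_sq_rpow (bracket_nonneg _ _)]
      exact Real.rpow_le_rpow (sq_nonneg _) hz (by linarith)
    have h4 := h3 (post K.m x y p) (by nlinarith [sq_nonneg (bracket K.m (postStar K.m x y p))])
    have h5 := h3 (postStar K.m x y p) (by nlinarith [sq_nonneg (bracket K.m (post K.m x y p))])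
    linarith
  have hφ0 : ∀ p : Param, 0 ≤ bracket K.m (post K.m x y p) ^ k +
      bracket K.m (postStar K.m x y p) ^ k := fun p => add_nonneg
    (Real.rpow_nonneg (bracket_nonneg _ _) _) (Real.rpow_nonneg (bracket_nonneg _ _) _)
  have i1 : Integrable (fun p => (bracket K.m (post K.m x y p) ^ k +
      bracket K.m (postStar K.m x y p) ^ k) * K.rate x y p) paramMeasure := by
    refine (hr.const_mul (2 * S)).mono' (Measurable.aestronglyMeasurable (by fun_prop)) ?_
    filter_upwards [ae_param_mem] with p hp
    have h0 := K.rate_nonneg hx hy hp.1 hp.2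
    rw [Real.norm_of_nonneg (mul_nonneg (hφ0 p) h0)]
    exact mul_le_mul_of_nonneg_right (hφ p hp.1 hp.2) h0
  have hub := K.integrable_angular_mul hxy K.ub_integrable
  have i2 : Integrable (fun p => (bracket K.m (post K.m x y p) ^ k +
      bracket K.m (postStar K.m x y p) ^ k) *
        (K.angular x y p * (K.ub p.2.1 p.2.2 * dWeight K.α p.2.1 p.2.2))) paramMeasure := by
    refine (hub.const_mul (2 * S)).mono'
      ((Measurable.aestronglyMeasurable (by fun_prop)).mul hub.aestronglyMeasurable) ?_
    filter_upwards [ae_param_mem] with p hp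
    have h0 : 0 ≤ K.angular x y p * (K.ub p.2.1 p.2.2 * dWeight K.α p.2.1 p.2.2) :=
      mul_nonneg (K.angular_nonneg x y p)
        (mul_nonneg (K.ub_nonneg hp.1 hp.2) (dWeight_nonneg hp.1 hp.2))
    rw [Real.norm_of_nonneg (mul_nonneg (hφ0 p) h0)]
    exact mul_le_mul_of_nonneg_right (hφ p hp.1 hp.2) h0
  have h1 : ∫ p, (bracket K.m (post K.m x y p) ^ k +
      bracket K.m (postStar K.m x y p) ^ k) * K.rate x y p ∂paramMeasure
      ≤ K.speed x y * K.avg k x y := by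
    have h := integral_mono_ae i1 (i2.const_mul (K.speed x y)) (by
      filter_upwards [ae_param_mem] with p hp
      have := mul_le_mul_of_nonneg_left (K.rate_le hx hy hp.1 hp.2) (hφ0 p)
      refine this.trans (le_of_eq ?_)
      ring)
    rw [integral_const_mul] at h
    refine h.trans (le_of_eq ?_)
    unfold avg
    congr 2; ext p; ring
  have h2 := K.kappaLb_mul_speed_le hx hy hxy
  have h3 : ∫ p, K.collDiff (fun x => bracket K.m x ^ k) (x, y, p) * K.rate x y p ∂paramMeasure
      = ∫ p, (bracket K.m (post K.m x y p) ^ k +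
      bracket K.m (postStar K.m x y p) ^ k) * K.rate x y p ∂paramMeasure
        - (a ^ k + b ^ k) * ∫ p, K.rate x y p ∂paramMeasure := by
    rw [← integral_const_mul, ← integral_sub i1 (hr.const_mul _)]
    congr 1; ext p
    simp only [collDiff, ← ha, ← hb]; ring
  have h4 : K.speed x y * K.avg k x y ≤ K.speed x y * (C k * S) :=
    mul_le_mul_of_nonneg_left hbound hX.le
  have hak : 0 < a ^ k := by positivity
  have hbk : 0 < b ^ k := by positivity
  have h5 : (a ^ k + b ^ k) * (K.kappaLb * K.speed x y) ≤
      (a ^ k + b ^ k) * ∫ p, K.rate x y p ∂paramMeasure :=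
    mul_le_mul_of_nonneg_left h2 (by positivity)
  have h6 := rpow_povzner hk.le hζ.le hζ2 ha1 hb1
  have h7 : 0 ≤ S - a ^ k - b ^ k := by
    have := rpow_add_rpow_le hk.le (show 0 < a by linarith) (show 0 < b by linarith)
    linarith
  -- the gain is split as `S = (S - a ^ k - b ^ k) + (a ^ k + b ^ k)`; only the second part, which
  -- competes with the loss, is of the top order
  have h8 : K.speed x y * (S - a ^ k - b ^ k) ≤
      2 ^ (k / 2 + 1) * (a ^ k * b ^ 2 + a ^ 2 * b ^ k) :=
    (mul_le_mul_of_nonneg_right (K.speed_le hx hy) h7).trans h6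
  have h9 := mul_le_mul_of_nonneg_left h8 hCn
  have hs1 := K.le_speed hx hy
  have hs2 := K.le_speed hy hx
  have hsym : K.speed y x = K.speed x y := by
    unfold speed collEnergy; rw [norm_sub_rev]; ring_nf
  rw [hsym] at hs2
  have hb2 : b ^ K.ζ ≤ b ^ (2 : ℝ) := Real.rpow_le_rpow_of_exponent_le hb1 hζ2
  have ha2 : a ^ K.ζ ≤ a ^ (2 : ℝ) := Real.rpow_le_rpow_of_exponent_le ha1 hζ2
  have t1 : 2 ^ (-K.ζ) * (a ^ k * a ^ K.ζ) - a ^ k * b ^ (2 : ℝ) ≤ a ^ k * K.speed x y := by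
    have : a ^ k * (2 ^ (-K.ζ) * a ^ K.ζ - b ^ (2 : ℝ)) ≤ a ^ k * K.speed x y :=
      mul_le_mul_of_nonneg_left (by linarith) hak.le
    linarith
  have t2 : 2 ^ (-K.ζ) * (b ^ k * b ^ K.ζ) - a ^ (2 : ℝ) * b ^ k ≤ b ^ k * K.speed x y := by
    have : b ^ k * (2 ^ (-K.ζ) * b ^ K.ζ - a ^ (2 : ℝ)) ≤ b ^ k * K.speed x y :=
      mul_le_mul_of_nonneg_left (by linarith) hbk.le
    linarith
  have t3 := mul_le_mul_of_nonneg_left (add_le_add t1 t2) (sub_nonneg.2 hCk.le)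
  rw [h3, Real.rpow_add (by linarith : 0 < a), Real.rpow_add (by linarith : 0 < b)]
  rw [← Real.rpow_natCast a 2, ← Real.rpow_natCast b 2] at h9
  norm_num at h9
  norm_num at t3 ⊢
  linarith

/-- The moment of order `k` in the interpolation inequality between the orders `2` and `k + ζ`. -/
theorem normL1_rpow_le (hf : Measurable f) (hf0 : ∀ x, 0 ≤ f x) {k : ℝ} (hk : 2 < k)
    (h : MemL1 K.m (k + K.ζ) f) (hpos : 0 < normL1 K.m 2 f) :
    normL1 K.m 2 f ^ (-K.ζ / (k - 2)) * normL1 K.m k f ^ (1 + K.ζ / (k - 2)) ≤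
      normL1 K.m (k + K.ζ) f := by
  have hζ := K.ζ_pos
  have hk2 : 0 < k - 2 := by linarith
  set θ := (k - 2) / (k - 2 + K.ζ) with hθ
  have h0 : 0 < θ := by positivity
  have h1 : θ ≤ 1 := (div_le_one (by positivity)).2 (by linarith)
  have hi := normL1_interpolation (j := 2) (k := k) (l := k + K.ζ) (θ := θ) K.m_pos hf hf0 h0.le h1
    (by rw [hθ]; field_simp; ring) (by linarith) h hpos
  set A := normL1 K.m 2 f
  set B := normL1 K.m (k + K.ζ) f
  have hB : 0 ≤ B := normL1_nonneg _ _ _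
  have he : 0 < 1 + K.ζ / (k - 2) := by positivity
  have h2 := Real.rpow_le_rpow (normL1_nonneg _ _ _) hi he.le
  rw [Real.mul_rpow (by positivity) (by positivity), ← Real.rpow_mul hpos.le,
    ← Real.rpow_mul hB] at h2
  have e1 : θ * (1 + K.ζ / (k - 2)) = 1 := by rw [hθ]; field_simp
  have e2 : (1 - θ) * (1 + K.ζ / (k - 2)) = K.ζ / (k - 2) := by
    rw [sub_mul, e1]; ring
  rw [e1, e2, Real.rpow_one] at h2
  have h3 := mul_le_mul_of_nonneg_left h2 (Real.rpow_nonneg hpos.le (-K.ζ / (k - 2)))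
  rw [← mul_assoc, ← Real.rpow_add hpos] at h3
  have e3 : -K.ζ / (k - 2) + K.ζ / (k - 2) = 0 := by ring
  rw [e3, Real.rpow_zero, one_mul] at h3
  exact h3

/-- A lower moment is absorbed by a small multiple of a higher one. -/
theorem normL1_absorb (hf : Measurable f) (hf0 : ∀ x, 0 ≤ f x) {k ε : ℝ} (hk : 2 < k) (hε : 0 < ε)
    (h : MemL1 K.m (k + K.ζ) f) :
    normL1 K.m k f ≤ ε * normL1 K.m (k + K.ζ) f + (ε⁻¹) ^ ((k - 2) / K.ζ) * normL1 K.m 2 f := by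
  have hζ := K.ζ_pos
  rw [normL1_eq hf0, normL1_eq hf0, normL1_eq hf0, ← integral_const_mul, ← integral_const_mul,
    ← integral_add (h.const_mul ε) ((h.mono K.m_pos hf (by linarith)).const_mul _)]
  refine integral_mono_ae (h.mono K.m_pos hf (by linarith))
    ((h.const_mul ε).add ((h.mono K.m_pos hf (by linarith)).const_mul _)) ?_
  filter_upwards [ae_one_le_bracket K.m_pos] with x hx
  set a := bracket K.m x
  have ha : 0 < a := by linarith
  have key : a ^ k ≤ ε * a ^ (k + K.ζ) + (ε⁻¹) ^ ((k - 2) / K.ζ) * a ^ (2 : ℝ) := by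
    rcases le_total 1 (ε * a ^ K.ζ) with h1 | h1
    · have : a ^ k ≤ ε * a ^ (k + K.ζ) := by
        rw [Real.rpow_add ha]
        have := mul_le_mul_of_nonneg_left h1 (Real.rpow_nonneg ha.le k)
        linarith
      have h2 : 0 ≤ (ε⁻¹) ^ ((k - 2) / K.ζ) * a ^ (2 : ℝ) := by positivity
      linarith
    · have h2 : a ^ K.ζ ≤ ε⁻¹ := by
        rw [← one_div, le_div_iff₀ hε]; linarith
      have h3 := Real.rpow_le_rpow (by positivity) h2 (show 0 ≤ (k - 2) / K.ζ by
        apply div_nonneg <;> linarith)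
      rw [← Real.rpow_mul ha.le, mul_div_cancel₀ _ hζ.ne'] at h3
      have h4 := mul_le_mul_of_nonneg_right h3 (Real.rpow_nonneg ha.le 2)
      rw [← Real.rpow_add ha, sub_add_cancel] at h4
      have h5 : 0 ≤ ε * a ^ (k + K.ζ) := by positivity
      linarith
  have := mul_le_mul_of_nonneg_left key (hf0 x)
  linarith

/-- The Povzner estimate integrated against `f f_*`: the moment of order `k + ζ` is dissipated, up
to the moment of order `k`. -/
theorem dirichlet_le {C : ℝ → ℝ} (hC : K.IsAveragingConst C) {k : ℝ} (hk : 2 < k)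
    (hCk : C k < K.kappaLb) (hf : Measurable f) (hf0 : ∀ x, 0 ≤ f x)
    (h : MemL1 K.m (k + K.ζ) f) :
    K.dirichlet k f ≤ -((K.kappaLb - C k) * 2 ^ (-K.ζ)) *
        (normL1 K.m 0 f * normL1 K.m (k + K.ζ) f)
      + (C k * 2 ^ (k / 2 + 1) + (K.kappaLb - C k)) * (normL1 K.m 2 f * normL1 K.m k f) := by
  have hζ := K.ζ_pos
  have hb := measurable_bracket K.m
  have hw := K.collOp_weakForm hf hf0 (φ := fun x => bracket K.m x ^ k) (by fun_prop)
    (fun x => Real.rpow_nonneg (bracket_nonneg _ _) _)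
    (K.dominates_bracket hf hf0 (by linarith) h)
  have h0 : MemL1 K.m 0 f := h.mono K.m_pos hf (by linarith)
  have h2 : MemL1 K.m 2 f := h.mono K.m_pos hf (by linarith)
  have hkk : MemL1 K.m k f := h.mono K.m_pos hf (by linarith)
  have i1 := K.integrable_pair_bracket h h0
  have i2 := K.integrable_pair_bracket h0 h
  have i3 := K.integrable_pair_bracket hkk h2
  have i4 := K.integrable_pair_bracket h2 hkk
  set c1 := -((K.kappaLb - C k) * 2 ^ (-K.ζ)) with hc1
  set c2 := C k * 2 ^ (k / 2 + 1) + (K.kappaLb - C k) with hc2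
  have j1 : Integrable (fun w : State × State =>
      c1 * (f w.1 * f w.2 * (bracket K.m w.1 ^ (k + K.ζ) * bracket K.m w.2 ^ (0 : ℝ))
        + f w.1 * f w.2 * (bracket K.m w.1 ^ (0 : ℝ) * bracket K.m w.2 ^ (k + K.ζ)))) pairMeasure :=
    (i1.add i2).const_mul c1
  have j2 : Integrable (fun w : State × State =>
      c2 * (f w.1 * f w.2 * (bracket K.m w.1 ^ k * bracket K.m w.2 ^ (2 : ℝ))
        + f w.1 * f w.2 * (bracket K.m w.1 ^ (2 : ℝ) * bracket K.m w.2 ^ k))) pairMeasure :=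
    (i3.add i4).const_mul c2
  have hle := integral_coll_le hw.2.1 (j1.add j2) (by
    filter_upwards [ae_pair_admissible] with w hw
    have hp := K.integral_collDiff_le hC hk hw.1 hw.2.1 hw.2.2 hCk
    have := mul_le_mul_of_nonneg_left hp (mul_nonneg (hf0 w.1) (hf0 w.2))
    rw [← integral_const_mul] at this
    refine le_trans (le_of_eq ?_) (this.trans (le_of_eq ?_))
    · congr 1; ext p; ring
    · simp only [Pi.add_apply, Real.rpow_zero]; rw [← hc1, ← hc2]; ring)
  simp only [Pi.add_apply] at hle
  rw [integral_add j1 j2, integral_const_mul, integral_const_mul, integral_add i1 i2,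
    integral_add i3 i4, K.integral_pair_bracket hf0, K.integral_pair_bracket hf0,
    K.integral_pair_bracket hf0, K.integral_pair_bracket hf0] at hle
  unfold dirichlet
  rw [hw.2.2.1]
  linarith

theorem constA_pos {C : ℝ → ℝ} {k M₀ M₂ : ℝ} (hCk : C k < K.kappaLb) (h0 : 0 < M₀) (h2 : 0 < M₂) :
    0 < K.constA C k M₀ M₂ := by
  have : 0 < K.kappaLb - C k := by linarith
  unfold constA constATilde
  have h1 : (0 : ℝ) < min 1 (2 ^ (1 - K.ζ)) := lt_min one_pos (by positivity)
  positivity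

/-- In the Povzner estimate the moment of order `k` is absorbed by half of the dissipation; the
other half is the power of `‖g‖_{L¹_k}` in the claim, by interpolation. -/
theorem dirichletBounds_nonempty {C : ℝ → ℝ} (hC : K.IsAveragingConst C) {k M₀ M₂ : ℝ}
    (hk : 2 < k) (hCk : C k < K.kappaLb) (hM₀ : 0 < M₀) :
    (K.dirichletBounds C k M₀ M₂).Nonempty := by
  have hζ := K.ζ_pos
  have hd : 0 < K.kappaLb - C k := by linarith
  have hCn := hC.nonneg k (by linarith)
  rcases le_or_gt M₂ 0 with hM₂ | hM₂
  · -- no density has positive mass and vanishing energy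
    refine ⟨0, le_rfl, fun g hg hg0 hgk e0 e2 => ?_⟩
    have := normL1_mono K.m_pos hg hg0 (k := 0) (l := 2) (by norm_num)
      (hgk.mono K.m_pos hg (by linarith))
    linarith
  set c1 := (K.kappaLb - C k) * 2 ^ (-K.ζ) with hc1
  set c2 := C k * 2 ^ (k / 2 + 1) + (K.kappaLb - C k) with hc2
  have hc1p : 0 < c1 := by positivity
  have hc2p : 0 < c2 := by positivity
  -- half of the dissipation absorbs the moment of order `k`
  set ε := c1 * M₀ / (2 * c2 * M₂) with hε
  have hεp : 0 < ε := by positivity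
  refine ⟨c2 * M₂ * ((ε⁻¹) ^ ((k - 2) / K.ζ) * M₂), by positivity, fun g hg hg0 hgk e0 e2 => ?_⟩
  have h1 := K.dirichlet_le hC hk hCk hg hg0 hgk
  have h2 := K.normL1_absorb hg hg0 hk hεp hgk
  have h3 := K.normL1_rpow_le hg hg0 hk hgk (by rw [e2]; exact hM₂)
  rw [e0, e2] at h1
  rw [e2] at h2 h3
  set P := normL1 K.m (k + K.ζ) g
  set Y := normL1 K.m k g
  have hP : 0 ≤ P := normL1_nonneg _ _ _
  have h4 := mul_le_mul_of_nonneg_left h2 (mul_pos hc2p hM₂).le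
  have h5 : c2 * M₂ * (ε * P) = c1 * M₀ / 2 * P := by rw [hε]; field_simp
  have h6 : K.constA C k M₀ M₂ * Y ^ (1 + K.ζ / (k - 2)) ≤ c1 * M₀ / 2 * P := by
    have hA : K.constATilde C k ≤ c1 / 2 := by
      have hmin : min 1 ((2 : ℝ) ^ (1 - K.ζ)) ≤ 1 := min_le_left _ _
      have h2z : (0 : ℝ) < 2 ^ (-K.ζ) := by positivity
      unfold constATilde
      rw [hc1]
      have := mul_le_mul_of_nonneg_left hmin (mul_pos h2z hd).le
      linarith
    have hA0 : 0 ≤ c1 / 2 * M₀ := by positivity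
    calc K.constA C k M₀ M₂ * Y ^ (1 + K.ζ / (k - 2))
        = K.constATilde C k * M₀ * (M₂ ^ (-K.ζ / (k - 2)) * Y ^ (1 + K.ζ / (k - 2))) := by
          unfold constA; ring
      _ ≤ c1 / 2 * M₀ * (M₂ ^ (-K.ζ / (k - 2)) * Y ^ (1 + K.ζ / (k - 2))) := by
          refine mul_le_mul_of_nonneg_right (mul_le_mul_of_nonneg_right hA hM₀.le) ?_
          exact mul_nonneg (by positivity) (Real.rpow_nonneg (normL1_nonneg _ _ _) _)
      _ ≤ c1 / 2 * M₀ * P := mul_le_mul_of_nonneg_left h3 hA0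
      _ = c1 * M₀ / 2 * P := by ring
  linarith

/-- The infimum in the definition of `B_k` is attained. -/
theorem constB_mem {C : ℝ → ℝ} {k M₀ M₂ : ℝ} (h : (K.dirichletBounds C k M₀ M₂).Nonempty) :
    K.constB C k M₀ M₂ ∈ K.dirichletBounds C k M₀ M₂ := by
  refine ⟨le_csInf h fun β hβ => hβ.1, fun g hg hg0 hgk e0 e2 => ?_⟩
  have : K.dirichlet k g + K.constA C k M₀ M₂ * normL1 K.m k g ^ (1 + K.ζ / (k - 2))
      ≤ K.constB C k M₀ M₂ :=
    le_csInf h fun β hβ => by have := hβ.2 g hg hg0 hgk e0 e2; linarith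
  linarith

end CollisionKernel

/-! ### Truncated moments -/

/-- The bounded test function `n^{p-1} ⟨v, I⟩² - truncPow p n ⟨v, I⟩²`. As the energy is conserved,
testing with it amounts to testing with the unbounded function `truncPow p n ⟨v, I⟩²`. -/
def truncDefect (m p n : ℝ) (x : State) : ℝ :=
  n ^ (p - 1) * bracket m x ^ 2 - truncPow p n (bracket m x ^ 2)

theorem measurable_truncPow_bracket (m p n : ℝ) :
    Measurable fun x => truncPow p n (bracket m x ^ 2) :=
  (measurable_truncPow p n).comp ((measurable_bracket m).pow_const 2)

theorem measurable_truncDefect (m p n : ℝ) : Measurable (truncDefect m p n) :=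
  (((measurable_bracket m).pow_const 2).const_mul _).sub (measurable_truncPow_bracket m p n)

/-- The part of `⟨v, I⟩^l` where `⟨v, I⟩² ≤ n/2`. -/
def lowPow (m l n : ℝ) (x : State) : ℝ :=
  {x | bracket m x ^ 2 ≤ n / 2}.indicator (fun x => bracket m x ^ l) x

theorem measurable_lowPow (m l n : ℝ) : Measurable (lowPow m l n) :=
  ((measurable_bracket m).pow_const l).indicator
    (measurableSet_le ((measurable_bracket m).pow_const 2) measurable_const)

theorem lowPow_nonneg (m l n : ℝ) (x : State) : 0 ≤ lowPow m l n x :=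
  indicator_nonneg (fun _ _ => Real.rpow_nonneg (bracket_nonneg _ _) _) x

theorem lowPow_of_le {m n : ℝ} {x : State} (h : bracket m x ^ 2 ≤ n / 2) (l : ℝ) :
    lowPow m l n x = bracket m x ^ l :=
  indicator_of_mem (s := {x | bracket m x ^ 2 ≤ n / 2}) h _

theorem lowPow_of_not_le {m n : ℝ} {x : State} (h : ¬ bracket m x ^ 2 ≤ n / 2) (l : ℝ) :
    lowPow m l n x = 0 :=
  indicator_of_notMem (s := {x | bracket m x ^ 2 ≤ n / 2}) h _

theorem lowPow_le {m l n : ℝ} (hl : 0 ≤ l) (hn : 0 ≤ n) (x : State) :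
    lowPow m l n x ≤ (n / 2) ^ (l / 2) := by
  by_cases h : bracket m x ^ 2 ≤ n / 2
  · rw [lowPow_of_le h, rpow_eq_sq_rpow (bracket_nonneg _ _)]
    exact Real.rpow_le_rpow (sq_nonneg _) h (by positivity)
  · rw [lowPow_of_not_le h]; positivity

theorem lowPow_mono {m l n n' : ℝ} (h : n ≤ n') (x : State) : lowPow m l n x ≤ lowPow m l n' x := by
  by_cases hx : bracket m x ^ 2 ≤ n / 2
  · rw [lowPow_of_le hx, lowPow_of_le (hx.trans (by linarith))]
  · rw [lowPow_of_not_le hx]; exact lowPow_nonneg _ _ _ _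

/-- The truncated moment of order `2p`. -/
def truncMoment (m p n : ℝ) (g : State → ℝ) : ℝ :=
  ∫ x, g x * truncPow p n (bracket m x ^ 2) ∂stateMeasure

theorem truncMoment_nonneg {m p n : ℝ} {g : State → ℝ} (hg : ∀ x, 0 ≤ g x)
    (hn : 0 ≤ n) : 0 ≤ truncMoment m p n g :=
  integral_nonneg fun x => mul_nonneg (hg x) (truncPow_nonneg hn (sq_nonneg _))

namespace CollisionKernel

variable (K : CollisionKernel) {f : State → ℝ}

/-- Bounded test functions are admissible in the weak form. -/
theorem dominates_of_le (hf : Measurable f) (hf0 : ∀ x, 0 ≤ f x) (h : MemL1 K.m 2 f)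
    {φ : State → ℝ} {c : ℝ} (hc : 0 ≤ c) (hφ : ∀ x, φ x ≤ c) : K.Dominates f φ fun _ => c where
  le z _ := ⟨hφ _, hφ _, hφ _, hφ _⟩
  integrable := by
    have := (K.integral_energy_speed hf hf0 le_rfl
      (h.mono K.m_pos hf (by linarith [K.ζ_le]))).1.const_mul c
    refine this.congr (ae_of_all _ fun w => ?_)
    simp only [zero_div, Real.rpow_zero]; ring
  nonneg _ _ _ := hc

theorem collDiff_truncDefect {p n : ℝ} {z : State × State × Param} (hz : Admissible z) :
    K.collDiff (truncDefect K.m p n) z =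
      -K.collDiff (fun x => truncPow p n (bracket K.m x ^ 2)) z := by
  have := bracket_sq_post_add K.m_pos hz.1.le hz.2.1.le hz.2.2.1 hz.2.2.2
  unfold collDiff truncDefect
  linear_combination n ^ (p - 1) * this

/-- The proportion of `(⟨x⟩² + ⟨y⟩²)^{k/2}` that is lost in a collision with parameters `(r, R)`. -/
def lossFraction (k : ℝ) (q : ℝ × ℝ) : ℝ := 1 - (1 - fraction q.1 q.2) ^ (k / 2 - 1)

theorem measurable_lossFraction (k : ℝ) : Measurable (lossFraction k) :=
  measurable_const.sub ((measurable_const.sub measurable_fraction).pow_const _)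

theorem lossFraction_mem {k : ℝ} (hk : 2 < k) {q : ℝ × ℝ} (hq : q ∈ unitSquare) :
    lossFraction k q ∈ Ioo (0 : ℝ) 1 := by
  have h := one_sub_fraction_mem hq
  have h1 := Real.rpow_pos_of_pos h.1 (k / 2 - 1)
  have h2 := Real.rpow_lt_one h.1.le h.2 (show 0 < k / 2 - 1 by linarith)
  unfold lossFraction
  constructor <;> linarith

theorem lowerRate_nonneg {l : ℝ × ℝ → ℝ} (hl : ∀ q ∈ unitSquare, 0 ≤ l q) : 0 ≤ K.lowerRate l :=
  mul_nonneg K.bNorm_nonneg (setIntegral_nonneg measurableSet_unitSquare fun q hq =>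
    mul_nonneg (hl q hq) (le_max_right _ _))

theorem integrable_mul_rate {x y : State} (hx : 0 < x.2) (hy : 0 < y.2) (hxy : x.1 ≠ y.1)
    {ψ : Param → ℝ} (hψ : Measurable ψ) {c : ℝ}
    (hc : ∀ p : Param, p.2.1 ∈ Ioo (0 : ℝ) 1 → p.2.2 ∈ Ioo (0 : ℝ) 1 → |ψ p| ≤ c) :
    Integrable (fun p => ψ p * K.rate x y p) paramMeasure := by
  refine ((K.integrable_rate hx hy hxy).const_mul c).mono' (hψ.mul
    (K.measurable_rate.comp (f := fun p : Param => (x, y, p))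
      (by fun_prop))).aestronglyMeasurable ?_
  filter_upwards [ae_param_mem] with p hp
  have h0 := K.rate_nonneg hx hy hp.1 hp.2
  rw [norm_mul, Real.norm_of_nonneg h0]
  exact mul_le_mul_of_nonneg_right (hc p hp.1 hp.2) h0

/-- The truncated Povzner inequality, averaged over the collision parameters. The last term is
the dissipation, which comes from collisions with pair energy below the truncation level. -/
theorem integral_collDiff_truncPow_le {k n : ℝ} (hk : 2 < k) (hn : 0 < n) {x y : State}
    (hx : 0 < x.2) (hy : 0 < y.2) (hxy : x.1 ≠ y.1) {c : ℝ} (hc0 : 0 ≤ c)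
    (hc : c ≤ K.lowerRate (lossFraction k)) :
    ∫ p, K.collDiff (fun x => truncPow (k / 2) n (bracket K.m x ^ 2)) (x, y, p) * K.rate x y p
        ∂paramMeasure ≤
      2 ^ (k / 2 + 1) * K.kappaUb *
        (truncPow (k / 2) n (bracket K.m x ^ 2) * bracket K.m y ^ 2
          + bracket K.m x ^ 2 * truncPow (k / 2) n (bracket K.m y ^ 2))
      + c * (truncPow (k / 2) n (bracket K.m x ^ 2) * bracket K.m y ^ 2)
      - c * 2 ^ (-K.ζ) * (lowPow K.m (k + K.ζ) n x * lowPow K.m 0 n y) := by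
  have hζ := K.ζ_pos
  have hp : 1 ≤ k / 2 := by linarith
  have ha1 := one_le_bracket K.m_pos hx.le
  have hb1 := one_le_bracket K.m_pos hy.le
  have hX := K.speed_pos hx hy
  have hr := K.integrable_rate hx hy hxy
  have hmp : Measurable fun p => post K.m x y p :=
    (measurable_post K.m).comp (f := fun p : Param => (x, y, p)) (by fun_prop)
  have hmps : Measurable fun p => postStar K.m x y p :=
    (measurable_postStar K.m).comp (f := fun p : Param => (x, y, p)) (by fun_prop)
  have hκ := K.kappaUb_nonneg
  have hrate := K.integral_rate_le hx hy hxy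
  have hpov := truncPow_povzner hp hn.le hζ.le K.ζ_le ha1 hb1
  have hspeed := K.speed_le hx hy
  have hlow := K.le_speed hx hy
  have hcons := fun (p : Param) h1 h2 =>
    bracket_sq_post_add K.m_pos hx.le hy.le (p := p) h1 h2
  have hTm := measurable_truncPow_bracket K.m (k / 2) n
  unfold collDiff
  simp only
  set a := bracket K.m x with ha
  set b := bracket K.m y with hb
  set S := a ^ 2 + b ^ 2 with hS
  set T := truncPow (k / 2) n with hT
  have hT0 : ∀ z, 0 ≤ z → 0 ≤ T z := fun z hz => truncPow_nonneg hn.le hz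
  have hTa := hT0 _ (sq_nonneg a)
  have hTb := hT0 _ (sq_nonneg b)
  have hP0 : 0 ≤ T S - T (a ^ 2) - T (b ^ 2) := by
    have := truncPow_add_le hp hn.le (sq_nonneg a) (sq_nonneg b)
    rw [← hT, ← hS] at this; linarith
  have hsum : ∀ p : Param, p.2.1 ∈ Ioo (0 : ℝ) 1 → p.2.2 ∈ Ioo (0 : ℝ) 1 →
      T (bracket K.m (post K.m x y p) ^ 2) + T (bracket K.m (postStar K.m x y p) ^ 2) ≤ T S := by
    intro p h1 h2
    have := truncPow_add_le hp hn.le (sq_nonneg (bracket K.m (post K.m x y p)))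
      (sq_nonneg (bracket K.m (postStar K.m x y p)))
    rwa [hcons p h1 h2] at this
  have hi : Integrable (fun p => (T (bracket K.m (post K.m x y p) ^ 2)
      + T (bracket K.m (postStar K.m x y p) ^ 2) - T (a ^ 2) - T (b ^ 2)) * K.rate x y p)
      paramMeasure := by
    refine K.integrable_mul_rate hx hy hxy
      ((((hTm.comp hmp).add (hTm.comp hmps)).sub_const _).sub_const _) (c := T S) ?_
    intro p h1 h2
    have h3 := hsum p h1 h2
    have h4 := hT0 _ (sq_nonneg (bracket K.m (post K.m x y p)))
    have h5 := hT0 _ (sq_nonneg (bracket K.m (postStar K.m x y p)))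
    rw [abs_le]
    constructor <;> linarith
  -- the bound without dissipation
  have hgain : (T S - T (a ^ 2) - T (b ^ 2)) * ∫ p, K.rate x y p ∂paramMeasure ≤
      2 ^ (k / 2 + 1) * K.kappaUb * (T (a ^ 2) * b ^ 2 + a ^ 2 * T (b ^ 2)) := by
    have h1 := mul_le_mul_of_nonneg_left hrate hP0
    have h2 := mul_le_mul_of_nonneg_right hspeed hP0
    have h3 := mul_le_mul_of_nonneg_left (h2.trans hpov) hκ
    linarith
  have hTab : 0 ≤ T (a ^ 2) * b ^ 2 := by positivity
  -- dissipation is only claimed where no truncation takes place, and the powers are genuine ones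
  rcases le_or_gt S n with hSn | hSn
  · have hTS : T S = S ^ (k / 2) := truncPow_of_le (by positivity) hSn
    have hl := measurable_lossFraction k
    have hlr := K.lowerRate_mul_speed_le hl
      (fun q hq => Ioo_subset_Icc_self (lossFraction_mem hk hq)) hx hy hxy
    have il : Integrable (fun p : Param => lossFraction k p.2 * K.rate x y p) paramMeasure := by
      refine K.integrable_mul_rate hx hy hxy (hl.comp measurable_snd) (c := 1) fun p h1 h2 => ?_
      have := lossFraction_mem hk (q := p.2) ⟨h1, h2⟩
      rw [abs_of_pos this.1]; exact this.2.le
    have hmono := integral_mono_ae hi ((hr.const_mul (T S - T (a ^ 2) - T (b ^ 2))).sub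
      (il.const_mul (S ^ (k / 2)))) (by
        filter_upwards [ae_param_mem] with p hp'
        have h0 := K.rate_nonneg hx hy hp'.1 hp'.2
        have hc' := hcons p hp'.1 hp'.2
        have q1 := fraction_mul_le_post K.m_pos hx.le hy.le hp'.1 hp'.2
        have q2 := fraction_mul_le_postStar K.m_pos hx.le hy.le hp'.1 hp'.2
        have hδ := fraction_pos hp'.1 hp'.2
        have hδ' := fraction_lt_half hp'.1 hp'.2
        rw [← ha, ← hb, ← hS] at q1 q2
        have hS0 : 0 < S := by positivity
        have p1 : 0 < bracket K.m (post K.m x y p) ^ 2 := (mul_pos hδ hS0).trans_le q1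
        have p2 : 0 < bracket K.m (postStar K.m x y p) ^ 2 := (mul_pos hδ hS0).trans_le q2
        have h5 := rpow_add_rpow_le_of_fraction hp p1 p2 (δ := fraction p.2.1 p.2.2)
          (by linarith) (by rwa [hc']) (by rwa [hc'])
        rw [hc', ← truncPow_of_le (n := n) p1 (by linarith),
          ← truncPow_of_le (n := n) p2 (by linarith), ← hT] at h5
        have h6 := mul_le_mul_of_nonneg_right h5 h0
        simp only [Pi.sub_apply, hTS, lossFraction]
        linarith)
    simp only [Pi.sub_apply] at hmono
    rw [integral_sub (hr.const_mul _) (il.const_mul _), integral_const_mul,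
      integral_const_mul] at hmono
    have hSp : 0 ≤ S ^ (k / 2) := by positivity
    have h1 := mul_le_mul_of_nonneg_left (mul_le_mul_of_nonneg_right hc hX.le) hSp
    have h2 := mul_le_mul_of_nonneg_left hlr hSp
    have h3 : 2 ^ (-K.ζ) * (lowPow K.m (k + K.ζ) n x * lowPow K.m 0 n y) - T (a ^ 2) * b ^ 2 ≤
        S ^ (k / 2) * K.speed x y := by
      have hnn : 0 ≤ S ^ (k / 2) * K.speed x y := by positivity
      by_cases hxn : a ^ 2 ≤ n / 2
      · by_cases hyn : b ^ 2 ≤ n / 2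
        · have e1 : lowPow K.m (k + K.ζ) n x = a ^ (k + K.ζ) := lowPow_of_le hxn _
          have e2 : lowPow K.m 0 n y = 1 := by
            rw [lowPow_of_le hyn, Real.rpow_zero]
          have ha0 : 0 < a := by linarith
          have e3 : T (a ^ 2) = a ^ k := by
            rw [hT, truncPow_of_le (by positivity) (by linarith), ← rpow_eq_sq_rpow ha0.le]
          have e4 : a ^ k ≤ S ^ (k / 2) := by
            rw [rpow_eq_sq_rpow ha0.le]
            exact Real.rpow_le_rpow (sq_nonneg _) (by nlinarith) (by linarith)
          have e5 : b ^ K.ζ ≤ b ^ 2 := by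
            rw [← Real.rpow_two]
            exact Real.rpow_le_rpow_of_exponent_le hb1 K.ζ_le
          have hak : 0 ≤ a ^ k := by positivity
          rw [e1, e2, e3, Real.rpow_add ha0]
          have e6 := mul_le_mul_of_nonneg_right e4 hX.le
          have e7 := mul_le_mul_of_nonneg_left hlow hak
          have e8 := mul_le_mul_of_nonneg_left e5 hak
          linarith
        · have : lowPow K.m 0 n y = 0 := lowPow_of_not_le hyn _
          rw [this]; linarith
      · have : lowPow K.m (k + K.ζ) n x = 0 := lowPow_of_not_le hxn _
        rw [this]; linarith
    have h4 := mul_le_mul_of_nonneg_left h3 hc0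
    linarith
  · have hlow0 : lowPow K.m (k + K.ζ) n x * lowPow K.m 0 n y = 0 := by
      by_cases hxn : a ^ 2 ≤ n / 2
      · have : lowPow K.m 0 n y = 0 := lowPow_of_not_le
          (show ¬ b ^ 2 ≤ n / 2 by intro h; linarith) _
        rw [this, mul_zero]
      · have : lowPow K.m (k + K.ζ) n x = 0 := lowPow_of_not_le hxn _
        rw [this, zero_mul]
    have hmono := integral_mono_ae hi (hr.const_mul (T S - T (a ^ 2) - T (b ^ 2))) (by
        filter_upwards [ae_param_mem] with p hp'
        have h0 := K.rate_nonneg hx hy hp'.1 hp'.2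
        exact mul_le_mul_of_nonneg_right (by linarith [hsum p hp'.1 hp'.2]) h0)
    rw [integral_const_mul] at hmono
    have := mul_nonneg hc0 hTab
    rw [hlow0]
    linarith

theorem integrable_mul_of_le (hf : Measurable f) {l c : ℝ} (h : MemL1 K.m l f) {ψ : State → ℝ}
    (hψ : Measurable ψ) (hle : ∀ᵐ x ∂stateMeasure, |ψ x| ≤ c * bracket K.m x ^ l) :
    Integrable (fun x => f x * ψ x) stateMeasure := by
  refine (h.norm.const_mul c).mono' (hf.mul hψ).aestronglyMeasurable ?_
  filter_upwards [hle] with x hx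
  rw [norm_mul, norm_mul, Real.norm_of_nonneg (Real.rpow_nonneg (bracket_nonneg _ _) _)]
  have := mul_le_mul_of_nonneg_left hx (norm_nonneg (f x))
  rw [← Real.norm_eq_abs] at this
  linarith

theorem integrable_mul_bounded (hf : Measurable f) (h : MemL1 K.m 0 f) {ψ : State → ℝ} {c : ℝ}
    (hψ : Measurable ψ) (hle : ∀ x, |ψ x| ≤ c) : Integrable (fun x => f x * ψ x) stateMeasure :=
  K.integrable_mul_of_le hf h hψ (c := c) (ae_of_all _ fun x => by simpa using hle x)

theorem integrable_mul_truncPow (hf : Measurable f) (h : MemL1 K.m 2 f) {p n : ℝ} (hp : 1 ≤ p)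
    (hn : 0 ≤ n) : Integrable (fun x => f x * truncPow p n (bracket K.m x ^ 2)) stateMeasure := by
  refine K.integrable_mul_of_le hf h (measurable_truncPow_bracket _ _ _) (c := n ^ (p - 1))
    (ae_of_all _ fun x => ?_)
  rw [abs_of_nonneg (truncPow_nonneg hn (sq_nonneg _)), Real.rpow_two]
  linarith [(truncPow_defect hp hn (sq_nonneg (bracket K.m x))).1]

theorem truncMoment_le {g : State → ℝ} (hgm : Measurable g) (hg : ∀ x, 0 ≤ g x)
    {k n : ℝ} (hk : 2 ≤ k) (hn : 0 ≤ n) (h : MemL1 K.m k g) :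
    truncMoment K.m (k / 2) n g ≤ normL1 K.m k g := by
  rw [normL1_eq hg]
  refine integral_mono_ae
    (K.integrable_mul_truncPow hgm (h.mono K.m_pos hgm hk) (by linarith) hn) h ?_
  filter_upwards [ae_one_le_bracket K.m_pos] with x hx
  rw [rpow_eq_sq_rpow (bracket_nonneg _ _)]
  exact mul_le_mul_of_nonneg_left
    (truncPow_le_rpow (by linarith) hn (by positivity)) (hg x)

/-- The evolution of truncated moments: growth is at most linear, and there is some dissipation. -/
theorem collOp_truncDefect (hf : Measurable f) (hf0 : ∀ x, 0 ≤ f x) (h : MemL1 K.m 2 f) {k n : ℝ}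
    (hk : 2 < k) (hn : 0 < n) {c : ℝ} (hc0 : 0 ≤ c) (hc : c ≤ K.lowerRate (lossFraction k)) :
    -∫ x, K.collOp f f x * truncDefect K.m (k / 2) n x ∂stateMeasure ≤
      (2 ^ (k / 2 + 1) * K.kappaUb + c) * normL1 K.m 2 f *
        (∫ x, f x * truncPow (k / 2) n (bracket K.m x ^ 2) ∂stateMeasure)
      - c * 2 ^ (-K.ζ) / 2 * ((∫ x, f x * lowPow K.m (k + K.ζ) n x ∂stateMeasure) *
        ∫ x, f x * lowPow K.m 0 n x ∂stateMeasure) := by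
  have hζ := K.ζ_pos
  have hp : 1 ≤ k / 2 := by linarith
  have hd : ∀ x, 0 ≤ truncDefect K.m (k / 2) n x ∧ truncDefect K.m (k / 2) n x ≤
      n ^ (k / 2 - 1) * n := fun x => truncPow_defect hp hn.le (sq_nonneg _)
  have hw := K.collOp_weakForm hf hf0 (measurable_truncDefect _ _ _) (fun x => (hd x).1)
    (K.dominates_of_le hf hf0 h (by positivity) fun x => (hd x).2)
  have hae : (fun z => f z.1 * f z.2.1 * K.collDiff (truncDefect K.m (k / 2) n) z *
      K.rate z.1 z.2.1 z.2.2) =ᵐ[collMeasure] fun z => -(f z.1 * f z.2.1 *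
        K.collDiff (fun x => truncPow (k / 2) n (bracket K.m x ^ 2)) z *
          K.rate z.1 z.2.1 z.2.2) := by
    filter_upwards [ae_admissible] with z hz
    rw [K.collDiff_truncDefect hz]; ring
  have hI := hw.2.1.congr hae
  have hIn := hI.neg
  simp only [Pi.neg_def, neg_neg] at hIn
  have h0 : MemL1 K.m 0 f := h.mono K.m_pos hf (by norm_num)
  have iT := K.integrable_mul_truncPow hf h hp hn.le
  have i2 : Integrable (fun x => f x * bracket K.m x ^ 2) stateMeasure := by
    have := h; unfold MemL1 at this; simpa only [Real.rpow_two] using this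
  have iH := K.integrable_mul_bounded hf h0 (measurable_lowPow K.m (k + K.ζ) n)
    (c := (n / 2) ^ ((k + K.ζ) / 2)) (fun x => by
      rw [abs_of_nonneg (lowPow_nonneg _ _ _ _)]; exact lowPow_le (by linarith) hn.le x)
  have iM := K.integrable_mul_bounded hf h0 (measurable_lowPow K.m 0 n)
    (c := (n / 2) ^ ((0 : ℝ) / 2)) (fun x => by
      rw [abs_of_nonneg (lowPow_nonneg _ _ _ _)]; exact lowPow_le le_rfl hn.le x)
  have j1 := integrable_pair_mul iT i2
  have j2 := integrable_pair_mul i2 iT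
  have j3 := integrable_pair_mul iH iM
  set α := 2 ^ (k / 2 + 1) * K.kappaUb with hα
  set β := c * 2 ^ (-K.ζ) with hβ
  have j4 : Integrable (fun w : State × State => (α + c) *
      ((f w.1 * truncPow (k / 2) n (bracket K.m w.1 ^ 2)) * (f w.2 * bracket K.m w.2 ^ 2)) +
      α * ((f w.1 * bracket K.m w.1 ^ 2) * (f w.2 * truncPow (k / 2) n (bracket K.m w.2 ^ 2))))
      pairMeasure := (j1.const_mul _).add (j2.const_mul _)
  have hle := integral_coll_le hIn (j4.sub (j3.const_mul β)) (by
    filter_upwards [ae_pair_admissible] with w hw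
    have hp := K.integral_collDiff_truncPow_le hk hn hw.1 hw.2.1 hw.2.2 hc0 hc
    have := mul_le_mul_of_nonneg_left hp (mul_nonneg (hf0 w.1) (hf0 w.2))
    rw [← integral_const_mul] at this
    refine le_trans (le_of_eq ?_) (this.trans (le_of_eq ?_))
    · congr 1; ext p; ring
    · simp only [Pi.sub_apply]; rw [← hα, ← hβ]; ring)
  simp only [Pi.sub_apply] at hle
  rw [integral_sub j4 (j3.const_mul _), integral_add (j1.const_mul _) (j2.const_mul _),
    integral_const_mul, integral_const_mul, integral_const_mul,
    integral_pair_mul (fun x => f x * truncPow (k / 2) n (bracket K.m x ^ 2))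
      (fun x => f x * bracket K.m x ^ 2),
    integral_pair_mul (fun x => f x * bracket K.m x ^ 2)
      (fun x => f x * truncPow (k / 2) n (bracket K.m x ^ 2)),
    integral_pair_mul (fun x => f x * lowPow K.m (k + K.ζ) n x)
      (fun x => f x * lowPow K.m 0 n x)] at hle
  rw [hw.2.2.1, integral_congr_ae hae, integral_neg]
  have e2 : normL1 K.m 2 f = ∫ x, f x * bracket K.m x ^ 2 ∂stateMeasure := by
    rw [normL1_eq hf0]; simp only [Real.rpow_two]
  rw [e2]
  set M := ∫ x, f x * bracket K.m x ^ 2 ∂stateMeasure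
  set Y := ∫ x, f x * truncPow (k / 2) n (bracket K.m x ^ 2) ∂stateMeasure
  have hY : 0 ≤ Y := integral_nonneg fun x =>
    mul_nonneg (hf0 x) (truncPow_nonneg hn.le (sq_nonneg _))
  have hM : 0 ≤ M := integral_nonneg fun x => mul_nonneg (hf0 x) (sq_nonneg _)
  have : 0 ≤ c * (M * Y) := by positivity
  linarith

/-- Chebyshev: most of the mass sits below the truncation level. -/
theorem half_mass_le (hf : Measurable f) (hf0 : ∀ x, 0 ≤ f x) (h : MemL1 K.m 2 f) {n : ℝ}
    (hn : 0 < n) (hMn : 4 * normL1 K.m 2 f ≤ n * normL1 K.m 0 f) :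
    normL1 K.m 0 f / 2 ≤ ∫ x, f x * lowPow K.m 0 n x ∂stateMeasure := by
  have h0 : MemL1 K.m 0 f := h.mono K.m_pos hf (by norm_num)
  have iM := K.integrable_mul_bounded hf h0 (measurable_lowPow K.m 0 n)
    (c := (n / 2) ^ ((0 : ℝ) / 2)) (fun x => by
      rw [abs_of_nonneg (lowPow_nonneg _ _ _ _)]; exact lowPow_le le_rfl hn.le x)
  have hm := integral_mono (Integrable.sub h0 (Integrable.const_mul h (2 / n))) iM (fun x => by
    simp only [Pi.sub_apply, lowPow, indicator, Real.rpow_zero, Real.rpow_two]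
    have hx := hf0 x
    split_ifs with hb
    · have : 0 ≤ 2 / n * (f x * bracket K.m x ^ 2) := by positivity
      linarith
    · have hb' : n / 2 < bracket K.m x ^ 2 := not_le.1 hb
      have h1 := mul_le_mul_of_nonneg_left (mul_le_mul_of_nonneg_left hb'.le hx)
        (show 0 ≤ 2 / n by positivity)
      have h2 : 2 / n * (f x * (n / 2)) = f x := by field_simp
      linarith)
  simp only [Pi.sub_apply] at hm
  rw [integral_sub h0 (Integrable.const_mul h _), integral_const_mul, ← normL1_eq hf0,
    ← normL1_eq hf0] at hm
  have : 2 / n * normL1 K.m 2 f ≤ normL1 K.m 0 f / 2 := by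
    rw [div_mul_eq_mul_div, div_le_iff₀ hn]; linarith
  linarith

end CollisionKernel

/-! ### Moments of solutions -/

/-- A form of Fatou's lemma for the Bochner integral. -/
theorem integrable_of_tendsto_of_integral_le {α : Type*} [MeasurableSpace α] {μ : Measure α}
    {F : ℕ → α → ℝ} {G : α → ℝ} {L : ℝ} (hF : ∀ n, Integrable (F n) μ)
    (hF0 : ∀ n, ∀ᵐ x ∂μ, 0 ≤ F n x) (hlim : ∀ᵐ x ∂μ, Tendsto (fun n => F n x) atTop (𝓝 (G x)))
    (hL : ∀ n, ∫ x, F n x ∂μ ≤ L) : Integrable G μ ∧ ∫ x, G x ∂μ ≤ L := by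
  have hL0 : 0 ≤ L := (integral_nonneg_of_ae (hF0 0)).trans (hL 0)
  have hG := aestronglyMeasurable_of_tendsto_ae atTop (fun n => (hF n).1) hlim
  have hG0 : 0 ≤ᵐ[μ] G := by
    filter_upwards [hlim, ae_all_iff.2 hF0] with x h1 h2
    exact ge_of_tendsto' h1 h2
  have hfat : ∫⁻ x, ENNReal.ofReal (G x) ∂μ ≤ ENNReal.ofReal L := by
    have h1 : ∫⁻ x, ENNReal.ofReal (G x) ∂μ
        = ∫⁻ x, liminf (fun n => ENNReal.ofReal (F n x)) atTop ∂μ := by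
      refine lintegral_congr_ae ?_
      filter_upwards [hlim] with x hx
      exact ((ENNReal.continuous_ofReal.tendsto _).comp hx).liminf_eq.symm
    rw [h1]
    refine (lintegral_liminf_le' fun n => (hF n).1.aemeasurable.ennreal_ofReal).trans ?_
    refine liminf_le_of_le (by isBoundedDefault) fun b hb => ?_
    obtain ⟨n, hn⟩ := hb.exists
    refine hn.trans ?_
    rw [← ofReal_integral_eq_lintegral_ofReal (hF n) (hF0 n)]
    exact ENNReal.ofReal_le_ofReal (hL n)
  refine ⟨⟨hG, ?_⟩, ?_⟩
  · rw [hasFiniteIntegral_iff_ofReal hG0]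
    exact hfat.trans_lt ENNReal.ofReal_lt_top
  · rw [integral_eq_lintegral_of_nonneg_ae hG0 hG]
    exact ENNReal.toReal_le_of_le_ofReal hL0 hfat

/-- Grönwall's inequality for a function which is differentiable only after the initial time. -/
theorem le_exp_mul_of_hasDerivAt {y y' : ℝ → ℝ} {a C : ℝ} (hc : ContinuousOn y (Ici a))
    (hd : ∀ t, a < t → HasDerivAt y (y' t) t) (h : ∀ t, a < t → y' t ≤ C * y t) {t : ℝ}
    (ht : a ≤ t) : y t ≤ Real.exp (C * (t - a)) * y a := by
  have hd' : ∀ s, a < s → HasDerivAt (fun s => Real.exp (-(C * s)) * y s)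
      (Real.exp (-(C * s)) * (-(C * 1)) * y s + Real.exp (-(C * s)) * y' s) s := fun s hs =>
    (((hasDerivAt_id s).const_mul C).neg.exp).mul (hd s hs)
  have hanti : AntitoneOn (fun s => Real.exp (-(C * s)) * y s) (Ici a) := by
    refine antitoneOn_of_deriv_nonpos (convex_Ici a) ?_ ?_ ?_
    · exact ContinuousOn.mul (by fun_prop) hc
    · rw [interior_Ici]
      exact fun s hs => (hd' s hs).differentiableAt.differentiableWithinAt
    · rw [interior_Ici]
      intro s hs
      rw [(hd' s hs).deriv]
      have := mul_le_mul_of_nonneg_left (h s hs) (Real.exp_pos (-(C * s))).le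
      linarith
  have := hanti self_mem_Ici ht ht
  simp only at this
  have h2 := mul_le_mul_of_nonneg_left this (Real.exp_pos (C * t)).le
  rw [← mul_assoc, ← mul_assoc, ← Real.exp_add, ← Real.exp_add, add_neg_cancel, Real.exp_zero,
    one_mul] at h2
  rwa [mul_sub, sub_eq_add_neg]

namespace CollisionKernel

variable {K : CollisionKernel}

theorem abs_integral_mul_le {g ψ : State → ℝ} (hg : MemL1 K.m 2 g) {c : ℝ} (hψ : ∀ x, |ψ x| ≤ c)
    (hi : Integrable (fun x => g x * ψ x) stateMeasure) :
    |∫ x, g x * ψ x ∂stateMeasure| ≤ c * normL1 K.m 2 g := by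
  have hc : 0 ≤ c := (abs_nonneg _).trans (hψ (0, 0))
  have hn : Integrable (fun x => |g x| * bracket K.m x ^ (2 : ℝ)) stateMeasure := by
    refine (Integrable.norm hg).congr (ae_of_all _ fun x => ?_)
    simp only [norm_mul, Real.norm_eq_abs,
      abs_of_nonneg (Real.rpow_nonneg (bracket_nonneg K.m x) 2)]
  unfold normL1
  rw [← integral_const_mul]
  refine abs_integral_le_integral_abs.trans (integral_mono_ae hi.abs (hn.const_mul c) ?_)
  filter_upwards [ae_one_le_bracket K.m_pos] with x hx
  simp only [abs_mul]
  have h1 : (1 : ℝ) ≤ bracket K.m x ^ (2 : ℝ) := Real.one_le_rpow hx (by norm_num)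
  have h2 := mul_le_mul_of_nonneg_left (hψ x) (abs_nonneg (g x))
  have h3 := mul_le_mul_of_nonneg_left h1 (mul_nonneg hc (abs_nonneg (g x)))
  linarith

namespace IsSolution

variable {f : ℝ → State → ℝ}

theorem memL1_sub (hf : K.IsSolution f) {s t : ℝ} (hs : 0 ≤ s)
    (ht : 0 ≤ t) : MemL1 K.m 2 fun x => f s x - f t x := by
  refine (Integrable.sub (hf.mem_two s hs) (hf.mem_two t ht)).congr (ae_of_all _ fun x => ?_)
  simp only [Pi.sub_apply]; ring

theorem integrable_mul (hf : K.IsSolution f) {t : ℝ} (ht : 0 ≤ t) {ψ : State → ℝ} {c : ℝ}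
    (hψ : Measurable ψ)
    (hψc : ∀ x, |ψ x| ≤ c) : Integrable (fun x => f t x * ψ x) stateMeasure :=
  K.integrable_mul_bounded (hf.measurable t ht)
    ((hf.mem_two t ht).mono K.m_pos (hf.measurable t ht) (by norm_num)) hψ hψc

/-- Averages of bounded observables are continuous in time. -/
theorem continuousOn_integral_mul (hf : K.IsSolution f) {ψ : State → ℝ} {c : ℝ} (hψ : Measurable ψ)
    (hψc : ∀ x, |ψ x| ≤ c) :
    ContinuousOn (fun t => ∫ x, f t x * ψ x ∂stateMeasure) (Ici 0) := by
  intro t ht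
  refine tendsto_iff_dist_tendsto_zero.2 (squeeze_zero' (Eventually.of_forall fun _ => dist_nonneg)
    ?_ (by simpa using (hf.continuous t ht).const_mul c))
  filter_upwards [self_mem_nhdsWithin] with s hs
  have h1 := hf.integrable_mul hs hψ hψc
  have h2 := hf.integrable_mul ht hψ hψc
  rw [Real.dist_eq, ← integral_sub h1 h2]
  have e : (fun x => f s x * ψ x - f t x * ψ x) = fun x => (f s x - f t x) * ψ x := by
    ext x; ring
  rw [e]
  refine abs_integral_mul_le (hf.memL1_sub hs ht) hψc ?_
  rw [← e]; exact h1.sub h2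

theorem integrable_collOp_mul (hf : K.IsSolution f) {t : ℝ} (ht : 0 ≤ t) {ψ : State → ℝ} {c : ℝ}
    (hψ : Measurable ψ)
    (hψ0 : ∀ x, 0 ≤ ψ x) (hψc : ∀ x, ψ x ≤ c) :
    Integrable (fun x => K.collOp (f t) (f t) x * ψ x) stateMeasure :=
  (K.collOp_weakForm (hf.measurable t ht) (hf.nonneg t ht) hψ hψ0
    (K.dominates_of_le (hf.measurable t ht) (hf.nonneg t ht) (hf.mem_two t ht)
      ((hψ0 (0, 0)).trans (hψc _)) hψc)).1

/-- The evolution of averages of bounded observables. -/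
theorem hasDerivAt_integral_mul (hf : K.IsSolution f) {t : ℝ} (ht : 0 < t) {ψ : State → ℝ} {c : ℝ}
    (hψ : Measurable ψ)
    (hψ0 : ∀ x, 0 ≤ ψ x) (hψc : ∀ x, ψ x ≤ c) :
    HasDerivAt (fun s => ∫ x, f s x * ψ x ∂stateMeasure)
      (∫ x, K.collOp (f t) (f t) x * ψ x ∂stateMeasure) t := by
  have hψa : ∀ x, |ψ x| ≤ c := fun x => by rw [abs_of_nonneg (hψ0 x)]; exact hψc x
  rw [hasDerivAt_iff_tendsto_slope_zero]
  refine tendsto_iff_dist_tendsto_zero.2 (squeeze_zero' (Eventually.of_forall fun _ => dist_nonneg)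
    ?_ (by simpa using (hf.hasDeriv t ht).const_mul c))
  have hev : ∀ᶠ h : ℝ in 𝓝[≠] 0, 0 ≤ t + h := by
    refine nhdsWithin_le_nhds (Filter.Eventually.mono (Ioi_mem_nhds (show -t < 0 by linarith))
      fun h hh => ?_)
    have : -t < h := hh
    linarith
  filter_upwards [hev] with h hh
  have h1 := hf.integrable_mul hh hψ hψa
  have h2 := hf.integrable_mul ht.le hψ hψa
  have h3 := hf.integrable_collOp_mul ht.le hψ hψ0 hψc
  have h4 : Integrable (fun x => h⁻¹ * (f (t + h) x * ψ x - f t x * ψ x)) stateMeasure :=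
    (h1.sub h2).const_mul _
  rw [Real.dist_eq, smul_eq_mul, ← integral_sub h1 h2, ← integral_const_mul, ← integral_sub h4 h3]
  have e : (fun x => h⁻¹ * (f (t + h) x * ψ x - f t x * ψ x) - K.collOp (f t) (f t) x * ψ x)
      = fun x => (h⁻¹ * (f (t + h) x - f t x) - K.collOp (f t) (f t) x) * ψ x := by
    ext x; ring
  rw [e]
  refine abs_integral_mul_le ?_ hψa ?_
  · refine (Integrable.sub (Integrable.const_mul (hf.memL1_sub hh ht.le) h⁻¹)
      (hf.mem_collOp t ht)).congr (ae_of_all _ fun x => ?_)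
    simp only [Pi.sub_apply]; ring
  · rw [← e]; exact ((h1.sub h2).const_mul _).sub h3

/-- The mass is conserved, since the test function `1` is unchanged in collisions. -/
theorem mass_eq (hf : K.IsSolution f) {t : ℝ} (ht : 0 ≤ t) : normL1 K.m 0 (f t) = normL1 K.m 0
    (f 0) := by
  have e : ∀ s, 0 ≤ s → normL1 K.m 0 (f s) = ∫ x, f s x * (fun _ => (1 : ℝ)) x ∂stateMeasure := by
    intro s hs
    rw [normL1_eq (hf.nonneg s hs)]; simp only [Real.rpow_zero]
  rcases ht.eq_or_lt with rfl | ht0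
  · rfl
  have hc := hf.continuousOn_integral_mul (ψ := fun _ => 1) (c := 1) measurable_const
    (fun _ => by simp)
  obtain ⟨s, hs, h⟩ := exists_hasDerivAt_eq_slope
    (fun t => ∫ x, f t x * (fun _ => (1 : ℝ)) x ∂stateMeasure)
    (fun t => ∫ x, K.collOp (f t) (f t) x * (fun _ => (1 : ℝ)) x ∂stateMeasure) ht0
    (hc.mono Icc_subset_Ici_self) (fun s hs => hf.hasDerivAt_integral_mul (c := 1) hs.1
      measurable_const (fun _ => zero_le_one) (fun _ => le_rfl))
  have hw := (K.collOp_weakForm (φ := fun _ => 1) (hf.measurable s hs.1.le) (hf.nonneg s hs.1.le)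
    measurable_const (fun _ => zero_le_one) (K.dominates_of_le (hf.measurable s hs.1.le)
      (hf.nonneg s hs.1.le) (hf.mem_two s hs.1.le) zero_le_one fun _ => le_rfl)).2.2.1
  have hz : K.collDiff (fun _ => (1 : ℝ)) = fun _ => 0 := by
    ext z; unfold collDiff; ring
  rw [hz] at hw
  simp only [mul_zero, zero_mul, integral_zero] at hw
  rw [e t ht, e 0 le_rfl]
  simp only at h ⊢
  rw [hw] at h
  have := (eq_div_iff (by linarith)).1 h
  linarith

theorem mass_le_energy (hf : K.IsSolution f) : normL1 K.m 0 (f 0) ≤ normL1 K.m 2 (f 0) :=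
  normL1_mono K.m_pos (hf.measurable 0 le_rfl) (hf.nonneg 0 le_rfl) (by norm_num)
    (hf.mem_two 0 le_rfl)

/-- By conservation of energy, a truncated moment evolves as the average of a bounded observable,
with the opposite sign. -/
theorem truncMoment_eq (hf : K.IsSolution f) {t p n : ℝ} (ht : 0 ≤ t) (hp : 1 ≤ p) (hn : 0 ≤ n) :
    truncMoment K.m p n (f t) = n ^ (p - 1) * normL1 K.m 2 (f 0)
      - ∫ x, f t x * truncDefect K.m p n x ∂stateMeasure := by
  rw [← hf.energy t ht, normL1_eq (hf.nonneg t ht), ← integral_const_mul, ← integral_sub]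
  · unfold truncMoment truncDefect
    congr 1; ext x; rw [Real.rpow_two]; ring
  · exact Integrable.const_mul (hf.mem_two t ht) _
  · exact hf.integrable_mul ht (measurable_truncDefect _ _ _) (c := n ^ (p - 1) * n) fun x => by
      have := truncPow_defect hp hn (sq_nonneg (bracket K.m x))
      rw [truncDefect, abs_of_nonneg this.1]; exact this.2

theorem continuousOn_truncMoment (hf : K.IsSolution f) {p n : ℝ} (hp : 1 ≤ p) (hn : 0 ≤ n) :
    ContinuousOn (fun t => truncMoment K.m p n (f t)) (Ici 0) := by
  refine ContinuousOn.congr (ContinuousOn.sub continuousOn_const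
    (hf.continuousOn_integral_mul (measurable_truncDefect K.m p n) (c := n ^ (p - 1) * n)
      fun x => ?_)) (fun t ht => hf.truncMoment_eq ht hp hn)
  have := truncPow_defect hp hn (sq_nonneg (bracket K.m x))
  rw [truncDefect, abs_of_nonneg this.1]; exact this.2

theorem hasDerivAt_truncMoment (hf : K.IsSolution f) {p n t : ℝ} (hp : 1 ≤ p) (hn : 0 ≤ n)
    (ht : 0 < t) :
    HasDerivAt (fun t => truncMoment K.m p n (f t))
      (-∫ x, K.collOp (f t) (f t) x * truncDefect K.m p n x ∂stateMeasure) t := by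
  have hd : ∀ x, _ := fun x => truncPow_defect hp hn (sq_nonneg (bracket K.m x))
  have h := (hf.hasDerivAt_integral_mul ht (measurable_truncDefect K.m p n)
    (fun x => (hd x).1) (fun x => (hd x).2)).const_sub (n ^ (p - 1) * normL1 K.m 2 (f 0))
  refine h.congr_of_eventuallyEq ?_
  filter_upwards [Ioi_mem_nhds ht] with s hs
  exact hf.truncMoment_eq (le_of_lt hs) hp hn

/-- Truncated moments grow at most exponentially, at a rate that does not depend on the truncation
level. -/
theorem truncMoment_growth (hf : K.IsSolution f) {k n a t : ℝ} (hk : 2 < k) (hn : 0 < n)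
    (ha : 0 ≤ a) (hat : a ≤ t) :
    truncMoment K.m (k / 2) n (f t) ≤
      Real.exp (K.constD k (normL1 K.m 2 (f 0)) * (t - a)) * truncMoment K.m (k / 2) n (f a) := by
  refine le_exp_mul_of_hasDerivAt (y := fun t => truncMoment K.m (k / 2) n (f t))
    ((hf.continuousOn_truncMoment (by linarith) hn.le).mono (Ici_subset_Ici.2 ha))
    (fun s hs => hf.hasDerivAt_truncMoment (by linarith) hn.le (ha.trans_lt hs))
    (fun s hs => ?_) hat
  have hs0 : 0 < s := ha.trans_lt hs
  have hlr : 0 ≤ K.lowerRate (lossFraction k) := K.lowerRate_nonneg fun q hq =>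
    (lossFraction_mem hk hq).1.le
  have h := K.collOp_truncDefect (hf.measurable s hs0.le) (hf.nonneg s hs0.le) (hf.mem_two s hs0.le)
    hk hn le_rfl hlr
  rw [hf.energy s hs0.le, zero_mul, zero_div, zero_mul, sub_zero, add_zero] at h
  refine h.trans (mul_le_mul_of_nonneg_right ?_ (truncMoment_nonneg (hf.nonneg s hs0.le) hn.le))
  unfold constD
  refine mul_le_mul_of_nonneg_right (mul_le_mul_of_nonneg_right ?_ K.kappaUb_nonneg)
    (normL1_nonneg _ _ _)
  exact Real.rpow_le_rpow_of_exponent_le (by norm_num) (by linarith)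

/-- Finite moments stay finite, and grow at most exponentially. -/
theorem growth (hf : K.IsSolution f) {k a t : ℝ} (hk : 2 < k) (ha : 0 ≤ a) (hat : a ≤ t)
    (h : MemL1 K.m k (f a)) :
    MemL1 K.m k (f t) ∧ normL1 K.m k (f t) ≤
      Real.exp (K.constD k (normL1 K.m 2 (f 0)) * (t - a)) * normL1 K.m k (f a) := by
  have ht := ha.trans hat
  have := integrable_of_tendsto_of_integral_le
    (F := fun n : ℕ => fun x => f t x * truncPow (k / 2) (n + 1) (bracket K.m x ^ 2))
    (G := fun x => f t x * bracket K.m x ^ k)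
    (L := Real.exp (K.constD k (normL1 K.m 2 (f 0)) * (t - a)) * normL1 K.m k (f a))
    (fun n => K.integrable_mul_truncPow (hf.measurable t ht) (hf.mem_two t ht) (by linarith)
      (by positivity))
    (fun n => ae_of_all _ fun x => mul_nonneg (hf.nonneg t ht x)
      (truncPow_nonneg (by positivity) (sq_nonneg _))) ?_
    (fun n => (hf.truncMoment_growth hk (by positivity) ha hat).trans
      (mul_le_mul_of_nonneg_left (K.truncMoment_le (hf.measurable a ha) (hf.nonneg a ha) hk.le
        (by positivity) h) (Real.exp_pos _).le))
  · refine ⟨this.1, ?_⟩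
    rw [normL1_eq (hf.nonneg t ht)]; exact this.2
  · filter_upwards [ae_one_le_bracket K.m_pos] with x hx
    refine tendsto_const_nhds.congr' ?_
    obtain ⟨N, hN⟩ := exists_nat_ge (bracket K.m x ^ 2)
    filter_upwards [eventually_ge_atTop N] with n hn
    have : (N : ℝ) ≤ n := by exact_mod_cast hn
    rw [truncPow_of_le (by positivity) (by linarith), ← rpow_eq_sq_rpow (bracket_nonneg _ _)]

/-- Appearance of moments: between two times at which the moment of order `k` is finite, the
dissipation makes the moment of order `k + ζ` finite at some time. -/
theorem exists_memL1_add (hf : K.IsSolution f) (hκ : 0 < K.kappaLb) {k a b : ℝ} (hk : 2 < k)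
    (ha : 0 ≤ a) (hab : a < b)
    (h : MemL1 K.m k (f a)) : ∃ t ∈ Icc a b, MemL1 K.m (k + K.ζ) (f t) := by
  have hζ := K.ζ_pos
  set M₀ := normL1 K.m 0 (f 0) with hM₀
  set M₂ := normL1 K.m 2 (f 0) with hM₂
  have hM₀p : 0 < M₀ := hf.mass_pos
  have hM₂p : 0 < M₂ := hM₀p.trans_le hf.mass_le_energy
  set c := K.lowerRate (lossFraction k) with hc
  have hcp : 0 < c := K.lowerRate_pos hκ (measurable_lossFraction k)
    (fun q hq => Ioo_subset_Icc_self (lossFraction_mem hk hq))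
    fun q hq => (lossFraction_mem hk hq).1
  set G := (2 ^ (k / 2 + 1) * K.kappaUb + c) * M₂ with hG
  have hκu := K.kappaUb_nonneg
  have hG0 : 0 ≤ G := by positivity
  have hD0 : 0 ≤ K.constD k M₂ := by unfold constD; positivity
  set Z := Real.exp (K.constD k M₂ * (b - a)) * normL1 K.m k (f a) with hZ
  set c' := c * 2 ^ (-K.ζ) / 2 with hc'
  have hc'p : 0 < c' := by positivity
  set N : ℝ := 4 * M₂ / M₀ with hN
  have hNp : 0 < N := by positivity
  have hyZ : ∀ n, 0 < n → ∀ t ∈ Icc a b, truncMoment K.m (k / 2) n (f t) ≤ Z := by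
    intro n hn t ht
    refine (hf.truncMoment_growth hk hn ha ht.1).trans ?_
    refine mul_le_mul (Real.exp_le_exp.2 (mul_le_mul_of_nonneg_left (by linarith [ht.2]) hD0))
      (K.truncMoment_le (hf.measurable a ha) (hf.nonneg a ha) hk.le hn.le h)
      (truncMoment_nonneg (hf.nonneg a ha) hn.le) (Real.exp_pos _).le
  set L := (G * Z + Z / (b - a)) / (c' * (M₀ / 2)) with hL
  set H : ℝ → ℝ → ℝ := fun n t => ∫ x, f t x * lowPow K.m (k + K.ζ) n x ∂stateMeasure with hH
  have hlow : ∀ n : ℝ, 0 ≤ n → ∀ x, |lowPow K.m (k + K.ζ) n x| ≤ (n / 2) ^ ((k + K.ζ) / 2) :=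
    fun n hn x => by
      rw [abs_of_nonneg (lowPow_nonneg _ _ _ _)]; exact lowPow_le (by linarith) hn x
  -- by the mean value theorem the dissipation is bounded at some time, uniformly in the level
  have hex : ∀ n, N ≤ n → ∃ t ∈ Icc a b, H n t ≤ L := by
    intro n hn
    have hn0 : 0 < n := hNp.trans_le hn
    obtain ⟨s, hs, hs'⟩ := exists_hasDerivAt_eq_slope (fun t => truncMoment K.m (k / 2) n (f t))
      (fun t => -∫ x, K.collOp (f t) (f t) x * truncDefect K.m (k / 2) n x ∂stateMeasure) hab
      ((hf.continuousOn_truncMoment (by linarith) hn0.le).mono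
        (Icc_subset_Ici_self.trans (Ici_subset_Ici.2 ha)))
      (fun t ht => hf.hasDerivAt_truncMoment (by linarith) hn0.le (ha.trans_lt ht.1))
    have hs0 : 0 ≤ s := ha.trans hs.1.le
    refine ⟨s, Ioo_subset_Icc_self hs, ?_⟩
    have hest := K.collOp_truncDefect (hf.measurable s hs0) (hf.nonneg s hs0) (hf.mem_two s hs0)
      hk hn0 hcp.le hc.le
    have hmass := K.half_mass_le (hf.measurable s hs0) (hf.nonneg s hs0) (hf.mem_two s hs0) hn0 (by
      rw [hf.energy s hs0, hf.mass_eq hs0]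
      exact (div_le_iff₀ hM₀p).1 hn)
    rw [hf.energy s hs0, ← hM₂, ← hG, ← hc'] at hest
    rw [hf.mass_eq hs0, ← hM₀] at hmass
    rw [hs'] at hest
    have hHn : 0 ≤ H n s := integral_nonneg fun x =>
      mul_nonneg (hf.nonneg s hs0 x) (lowPow_nonneg _ _ _ _)
    have h1 := mul_le_mul_of_nonneg_left hmass (mul_nonneg hc'p.le hHn)
    have h2 := mul_le_mul_of_nonneg_left (hyZ n hn0 s (Ioo_subset_Icc_self hs)) hG0
    have h3 : -(Z / (b - a)) ≤ (truncMoment K.m (k / 2) n (f b) - truncMoment K.m (k / 2) n (f a))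
        / (b - a) := by
      rw [← neg_div]
      refine div_le_div_of_nonneg_right ?_ (by linarith)
      have := hyZ n hn0 a ⟨le_rfl, hab.le⟩
      have := truncMoment_nonneg (m := K.m) (p := k / 2) (hf.nonneg b (by linarith)) hn0.le
      linarith
    rw [hL, le_div_iff₀ (by positivity)]
    change _ ≤ G * truncMoment K.m (k / 2) n (f s) - c' * (H n s * _) at hest
    linarith
  have hcl : ∀ n, 0 ≤ n → IsClosed (Icc a b ∩ H n ⁻¹' Iic L) := fun n hn =>
    ContinuousOn.preimage_isClosed_of_isClosed ((hf.continuousOn_integral_mul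
      (measurable_lowPow _ _ _) (hlow n hn)).mono
        (Icc_subset_Ici_self.trans (Ici_subset_Ici.2 ha))) isClosed_Icc isClosed_Iic
  have hNj : ∀ j : ℕ, 0 ≤ N + j := fun j => by positivity
  -- the compact sets of such times decrease as the level increases
  obtain ⟨t, ht⟩ := IsCompact.nonempty_iInter_of_sequence_nonempty_isCompact_isClosed
    (fun j : ℕ => Icc a b ∩ H (N + j) ⁻¹' Iic L)
    (fun j t ht => by
      have ht0 : 0 ≤ t := ha.trans ht.1.1
      refine ⟨ht.1, le_trans (b := H (N + (j + 1 : ℕ)) t) ?_ ht.2⟩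
      refine integral_mono (hf.integrable_mul ht0 (measurable_lowPow _ _ _) (hlow _ (hNj _)))
        (hf.integrable_mul ht0 (measurable_lowPow _ _ _) (hlow _ (hNj _))) fun x => ?_
      refine mul_le_mul_of_nonneg_left (lowPow_mono ?_ x) (hf.nonneg t ht0 x)
      push_cast; linarith)
    (fun j => by
      obtain ⟨t, ht, htL⟩ := hex (N + j) (by linarith [(Nat.cast_nonneg j : (0 : ℝ) ≤ j)])
      exact ⟨t, ht, htL⟩)
    (isCompact_Icc.of_isClosed_subset (hcl _ (hNj _)) inter_subset_left)
    (fun j => hcl _ (hNj _))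
  rw [mem_iInter] at ht
  have htI := (ht 0).1
  have ht0 : 0 ≤ t := ha.trans htI.1
  refine ⟨t, htI, (integrable_of_tendsto_of_integral_le
    (F := fun j : ℕ => fun x => f t x * lowPow K.m (k + K.ζ) (N + j) x) (L := L)
    (fun j => hf.integrable_mul ht0 (measurable_lowPow _ _ _) (hlow _ (hNj _)))
    (fun j => ae_of_all _ fun x => mul_nonneg (hf.nonneg t ht0 x) (lowPow_nonneg _ _ _ _))
    (ae_of_all _ fun x => ?_) (fun j => (ht j).2)).1⟩
  refine tendsto_const_nhds.congr' ?_
  obtain ⟨J, hJ⟩ := exists_nat_ge (2 * bracket K.m x ^ 2)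
  filter_upwards [eventually_ge_atTop J] with j hj
  have : (J : ℝ) ≤ j := by exact_mod_cast hj
  rw [lowPow_of_le (by linarith)]

/-- All moments are finite at positive times. -/
theorem memL1_of_pos (hf : K.IsSolution f) (hκ : 0 < K.kappaLb) {t : ℝ} (ht : 0 < t)
    (k : ℝ) : MemL1 K.m k (f t) := by
  have hζ := K.ζ_pos
  obtain ⟨ε, hε, h0⟩ := hf.mem_two_plus
  have key : ∀ j : ℕ, ∀ t, 0 < t → MemL1 K.m (2 + ε + j * K.ζ) (f t) := by
    intro j
    induction j with
    | zero =>
      intro t ht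
      rw [Nat.cast_zero, zero_mul, add_zero]
      exact (hf.growth (by linarith) le_rfl ht.le h0).1
    | succ j ih =>
      intro t ht
      have hj : 0 ≤ j * K.ζ := by positivity
      obtain ⟨s, hs, hs'⟩ := hf.exists_memL1_add hκ (b := t) (by linarith) (half_pos ht).le
        (half_lt_self ht) (ih (t / 2) (half_pos ht))
      have e : 2 + ε + ((j + 1 : ℕ) : ℝ) * K.ζ = 2 + ε + j * K.ζ + K.ζ := by push_cast; ring
      rw [e]
      exact (hf.growth (by linarith) ((half_pos ht).le.trans hs.1) hs.2 hs').1
  obtain ⟨j, hj⟩ := exists_nat_ge (k / K.ζ)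
  refine (key j t ht).mono K.m_pos (hf.measurable t ht.le) ?_
  have := (div_le_iff₀ hζ).1 hj
  linarith

/-- The moments are differentiable at positive times: averages of the bounded functions `min (⟨v,
I⟩^k) (n + 1)` are, and their derivatives converge locally uniformly since moments of higher order
are locally bounded. -/
theorem hasDerivAt_normL1 (hf : K.IsSolution f) (hκ : 0 < K.kappaLb) {k t : ℝ} (hk : 2 < k)
    (ht : 0 < t) :
    HasDerivAt (fun s => normL1 K.m k (f s)) (K.dirichlet k (f t)) t := by
  have hζ := K.ζ_pos
  have hb := measurable_bracket K.m
  set l := 2 * k + K.ζ with hl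
  set D := K.constD l (normL1 K.m 2 (f 0)) with hD
  set U := Real.exp (D * (2 * t - t / 2)) * normL1 K.m l (f (t / 2)) with hU
  have hD0 : 0 ≤ D := by
    have := K.kappaUb_nonneg
    have := normL1_nonneg K.m 2 (f 0)
    rw [hD]; unfold constD; positivity
  have hbd : ∀ s ∈ Ioo (t / 2) (2 * t), normL1 K.m l (f s) ≤ U := fun s hs => by
    refine (hf.growth (by linarith) (half_pos ht).le hs.1.le
      (hf.memL1_of_pos hκ (half_pos ht) l)).2.trans ?_
    exact mul_le_mul_of_nonneg_right (Real.exp_le_exp.2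
      (mul_le_mul_of_nonneg_left (by linarith [hs.2]) hD0)) (normL1_nonneg _ _ _)
  set ψ : ℕ → State → ℝ := fun n x => min (bracket K.m x ^ k) (n + 1) with hψ
  have hψm : ∀ n, Measurable (ψ n) := fun n => (hb.pow_const k).min measurable_const
  have hψ0 : ∀ n x, 0 ≤ ψ n x := fun n x =>
    le_min (Real.rpow_nonneg (bracket_nonneg _ _) _) (by positivity)
  have hψ1 : ∀ n x, ψ n x ≤ n + 1 := fun n x => min_le_right _ _
  -- truncation at level `n + 1` costs at most a moment of order `2k` divided by `n + 1`
  have hψd : ∀ n x, |bracket K.m x ^ k - ψ n x| ≤ bracket K.m x ^ (2 * k) / (n + 1) := by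
    intro n x
    have hx := Real.rpow_nonneg (bracket_nonneg K.m x) k
    have hn : (0 : ℝ) < n + 1 := by positivity
    rw [abs_of_nonneg (sub_nonneg.2 (min_le_left _ _)), le_div_iff₀ hn, mul_comm 2 k,
      Real.rpow_mul (bracket_nonneg K.m x), Real.rpow_two]
    simp only [hψ]
    rcases le_total (bracket K.m x ^ k) ((n : ℝ) + 1) with h | h
    · rw [min_eq_left h, sub_self, zero_mul]; positivity
    · rw [min_eq_right h]; nlinarith
  set V := 2 * (K.kappaUb * (2 ^ (l / 2) * (2 * (normL1 K.m 0 (f 0) * U)))) with hV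
  have hunif : ∀ n : ℕ, ∀ s ∈ Ioo (t / 2) (2 * t),
      |K.dirichlet k (f s) - ∫ x, K.collOp (f s) (f s) x * ψ n x ∂stateMeasure| ≤ V / (n + 1) := by
    intro n s hs
    have hs0 : 0 < s := (half_pos ht).trans hs.1
    have hfm := hf.measurable s hs0.le
    have hf0 := hf.nonneg s hs0.le
    have hw := K.collOp_weakForm hfm hf0 (φ := fun x => bracket K.m x ^ (2 * k)) (by fun_prop)
      (fun x => Real.rpow_nonneg (bracket_nonneg _ _) _)
      (K.dominates_bracket hfm hf0 (by linarith) (hf.memL1_of_pos hκ hs0 _))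
    have hwk := K.collOp_weakForm hfm hf0 (φ := fun x => bracket K.m x ^ k) (by fun_prop)
      (fun x => Real.rpow_nonneg (bracket_nonneg _ _) _)
      (K.dominates_bracket hfm hf0 (by linarith) (hf.memL1_of_pos hκ hs0 _))
    have hi := hf.integrable_collOp_mul hs0.le (hψm n) (hψ0 n) (hψ1 n)
    have hen := (K.integral_energy_speed hfm hf0 (show 0 ≤ 2 * k by linarith)
      (hf.memL1_of_pos hκ hs0 _)).2
    rw [← hl, hf.mass_eq hs0.le] at hen
    have hkey : ∫ x, |K.collOp (f s) (f s) x * bracket K.m x ^ (2 * k)| ∂stateMeasure ≤ V := by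
      refine hw.2.2.2.trans (mul_le_mul_of_nonneg_left (mul_le_mul_of_nonneg_left (hen.trans ?_)
        K.kappaUb_nonneg) two_pos.le)
      have := mul_le_mul_of_nonneg_left (hbd s hs) (normL1_nonneg K.m 0 (f 0))
      gcongr
    unfold dirichlet
    rw [← integral_sub hwk.1 hi]
    refine abs_integral_le_integral_abs.trans ?_
    have hm := integral_mono (hwk.1.sub hi).abs (hw.1.abs.div_const ((n : ℝ) + 1)) (fun x => by
      simp only [Pi.sub_apply]
      rw [← mul_sub, abs_mul, abs_mul, mul_div_assoc,
        abs_of_nonneg (Real.rpow_nonneg (bracket_nonneg K.m x) (2 * k))]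
      exact mul_le_mul_of_nonneg_left (hψd n x) (abs_nonneg _))
    refine hm.trans ?_
    rw [integral_div]
    exact div_le_div_of_nonneg_right hkey (by positivity)
  have hzero : Tendsto (fun n : ℕ => V / ((n : ℝ) + 1)) atTop (𝓝 0) := by
    simpa [div_eq_mul_inv] using (tendsto_one_div_add_atTop_nhds_zero_nat (𝕜 := ℝ)).const_mul V
  refine hasDerivAt_of_tendstoUniformlyOn (l := atTop)
    (f := fun (n : ℕ) s => ∫ x, f s x * ψ n x ∂stateMeasure)
    (f' := fun (n : ℕ) s => ∫ x, K.collOp (f s) (f s) x * ψ n x ∂stateMeasure)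
    (g' := fun s => K.dirichlet k (f s)) (s := Ioo (t / 2) (2 * t)) isOpen_Ioo ?_ ?_ ?_
    ⟨by linarith, by linarith⟩
  · rw [Metric.tendstoUniformlyOn_iff]
    intro ε hε
    filter_upwards [hzero.eventually_lt_const hε] with n hn s hs
    exact (hunif n s hs).trans_lt hn
  · exact Eventually.of_forall fun n s hs => hf.hasDerivAt_integral_mul ((half_pos ht).trans hs.1)
      (hψm n) (hψ0 n) (hψ1 n)
  · intro s hs
    have hs0 : 0 < s := (half_pos ht).trans hs.1
    have hf0 := hf.nonneg s hs0.le
    have h2 := hf.memL1_of_pos hκ hs0 (2 * k)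
    have hlim : Tendsto (fun n : ℕ => (∫ x, f s x * bracket K.m x ^ (2 * k) ∂stateMeasure)
        / ((n : ℝ) + 1)) atTop (𝓝 0) := by
      simpa [div_eq_mul_inv] using (tendsto_one_div_add_atTop_nhds_zero_nat (𝕜 := ℝ)).const_mul
        (∫ x, f s x * bracket K.m x ^ (2 * k) ∂stateMeasure)
    refine tendsto_iff_dist_tendsto_zero.2 (squeeze_zero (fun _ => dist_nonneg) (fun n => ?_) hlim)
    have hi := hf.integrable_mul hs0.le (hψm n) (c := n + 1) fun x => by
      rw [abs_of_nonneg (hψ0 n x)]; exact hψ1 n x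
    have hk' : Integrable (fun x => f s x * bracket K.m x ^ k) stateMeasure :=
      hf.memL1_of_pos hκ hs0 k
    rw [dist_comm, Real.dist_eq, normL1_eq hf0, ← integral_sub hk' hi, ← integral_div]
    refine abs_integral_le_integral_abs.trans (integral_mono (hk'.sub hi).abs
      (Integrable.div_const h2 _) fun x => ?_)
    simp only
    rw [← mul_sub, abs_mul, abs_of_nonneg (hf0 x), mul_div_assoc]
    exact mul_le_mul_of_nonneg_left (hψd n x) (hf0 x)

end IsSolution

end CollisionKernel

/-! ### The differential inequality for moments -/

section ODE

variable {y y' : ℝ → ℝ} {s t A E q : ℝ}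

/-- A function stays below a barrier if at each contact its derivative is the smaller one. -/
theorem le_of_hasDerivAt_of_contact {w w' : ℝ → ℝ} (hst : s ≤ t)
    (hy : ∀ τ ∈ Icc s t, HasDerivAt y (y' τ) τ) (hw : ∀ τ ∈ Icc s t, HasDerivAt w (w' τ) τ)
    (hs : y s ≤ w s) (h : ∀ τ ∈ Ico s t, y τ = w τ → y' τ < w' τ) : y t ≤ w t :=
  image_le_of_deriv_right_lt_deriv_boundary'
    (fun τ hτ => (hy τ hτ).continuousAt.continuousWithinAt)
    (fun τ hτ => (hy τ (Ico_subset_Icc_self hτ)).hasDerivWithinAt) hs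
    (fun τ hτ => (hw τ hτ).continuousAt.continuousWithinAt)
    (fun τ hτ => (hw τ (Ico_subset_Icc_self hτ)).hasDerivWithinAt) h ⟨hst, le_rfl⟩

/-- Below the equilibrium `E`, or below its initial value, a solution of the differential
inequality stays. -/
theorem le_max_of_deriv_le (hst : s ≤ t) (hA : 0 < A) (hE : 0 ≤ E) (hq : 0 < q)
    (hy : ∀ τ ∈ Icc s t, HasDerivAt y (y' τ) τ)
    (h : ∀ τ ∈ Icc s t, y' τ ≤ -A * y τ ^ (1 + 1 / q) + A * E ^ (1 + 1 / q)) :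
    y t ≤ max E (y s) := by
  refine le_of_forall_pos_le_add fun η hη => ?_
  refine le_of_hasDerivAt_of_contact (w := fun _ => max E (y s) + η) (w' := fun _ => 0) hst hy
    (fun τ _ => hasDerivAt_const _ _) (by linarith [le_max_right E (y s)]) fun τ hτ hc => ?_
  have h1 := h τ (Ico_subset_Icc_self hτ)
  rw [hc] at h1
  have h2 : E ^ (1 + 1 / q) < (max E (y s) + η) ^ (1 + 1 / q) :=
    Real.rpow_lt_rpow hE (by linarith [le_max_left E (y s)]) (by positivity)
  nlinarith

/-- The differential inequality bounds its solutions independently of their initial value. -/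
theorem le_add_rpow_of_deriv_le (hst : s < t) (hA : 0 < A) (hE : 0 ≤ E) (hq : 0 < q)
    (hy0 : 0 ≤ y s) (hy : ∀ τ ∈ Icc s t, HasDerivAt y (y' τ) τ)
    (h : ∀ τ ∈ Icc s t, y' τ ≤ -A * y τ ^ (1 + 1 / q) + A * E ^ (1 + 1 / q)) :
    y t ≤ E + (A / q * (t - s)) ^ (-q) := by
  refine le_of_forall_pos_le_add fun η hη => ?_
  -- the shift `δ` makes the barrier finite at time `s`, with a value above `y s`
  set δ := (y s + 1) ^ (-(1 / q)) with hδ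
  have hδ0 : 0 < δ := by positivity
  have hb : ∀ τ ∈ Icc s t, 0 < δ + A / q * (τ - s) := fun τ hτ => by
    have := mul_nonneg (div_pos hA hq).le (sub_nonneg.2 hτ.1)
    linarith
  have hbar := le_of_hasDerivAt_of_contact (y := y) (y' := y')
    (w := fun τ => E + η + (δ + A / q * (τ - s)) ^ (-q))
    (w' := fun τ => A / q * 1 * (-q) * (δ + A / q * (τ - s)) ^ (-q - 1)) hst.le hy
    (fun τ hτ => ((((hasDerivAt_id τ).sub_const s).const_mul (A / q)).const_add δ).rpow_const
      (Or.inl (hb τ hτ).ne') |>.const_add (E + η)) ?_ fun τ hτ hc => ?_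
  · refine hbar.trans ?_
    have h1 : (δ + A / q * (t - s)) ^ (-q) ≤ (A / q * (t - s)) ^ (-q) :=
      Real.rpow_le_rpow_of_nonpos (mul_pos (div_pos hA hq) (sub_pos.2 hst)) (by linarith)
        (by linarith)
    linarith
  · have : (δ + A / q * (s - s)) ^ (-q) = y s + 1 := by
      rw [sub_self, mul_zero, add_zero, hδ, ← Real.rpow_mul (by linarith), neg_mul_neg,
        one_div, inv_mul_cancel₀ hq.ne', Real.rpow_one]
    linarith
  · have hτ' := Ico_subset_Icc_self hτ
    have h1 := h τ hτ'
    set z := (δ + A / q * (τ - s)) ^ (-q) with hz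
    have hz0 : 0 < z := Real.rpow_pos_of_pos (hb τ hτ') _
    have hz1 : (δ + A / q * (τ - s)) ^ (-q - 1) = z ^ (1 + 1 / q) := by
      rw [hz, ← Real.rpow_mul (hb τ hτ').le]
      congr 1; field_simp; ring
    have h2 : E ^ (1 + 1 / q) < (E + η) ^ (1 + 1 / q) :=
      Real.rpow_lt_rpow hE (by linarith) (by positivity)
    have h3 := Real.add_rpow_le_rpow_add (show 0 ≤ E + η by linarith) hz0.le
      (show 1 ≤ 1 + 1 / q by have : 0 < 1 / q := by positivity
                             linarith)
    have e : A / q * 1 * -q = -A := by field_simp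
    rw [hz1, e]
    rw [hc] at h1
    have h4 : E ^ (1 + 1 / q) + z ^ (1 + 1 / q) < (E + η + z) ^ (1 + 1 / q) := by linarith
    nlinarith

end ODE

namespace CollisionKernel

variable {K : CollisionKernel}

theorem constE_nonneg {C : ℝ → ℝ} {k M₀ M₂ : ℝ} (hA : 0 ≤ K.constA C k M₀ M₂) :
    0 ≤ K.constE C k M₀ M₂ :=
  Real.rpow_nonneg (div_nonneg (Real.sInf_nonneg fun _ hβ => hβ.1) hA) _

theorem constA_mul_constE {C : ℝ → ℝ} {k M₀ M₂ : ℝ} (hk : 2 < k) (hA : 0 < K.constA C k M₀ M₂) :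
    K.constA C k M₀ M₂ * K.constE C k M₀ M₂ ^ (1 + 1 / ((k - 2) / K.ζ)) = K.constB C k M₀ M₂ := by
  have hζ := K.ζ_pos
  have hk' : 0 < k - 2 := by linarith
  have hB : 0 ≤ K.constB C k M₀ M₂ := Real.sInf_nonneg fun _ hβ => hβ.1
  unfold constE
  rw [← Real.rpow_mul (div_nonneg hB hA.le),
    show (k - 2) / (k - 2 + K.ζ) * (1 + 1 / ((k - 2) / K.ζ)) = 1 by field_simp, Real.rpow_one]
  field_simp

/-- `a_k t^{-(k-2)/ζ}` is the blow-up profile of the differential inequality. -/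
theorem consta_mul {C : ℝ → ℝ} {k M₀ M₂ t : ℝ} (hk : 2 < k) (hA : 0 < K.constA C k M₀ M₂)
    (ht : 0 < t) :
    K.consta C k M₀ M₂ * t ^ (-((k - 2) / K.ζ)) =
      (K.constA C k M₀ M₂ / ((k - 2) / K.ζ) * t) ^ (-((k - 2) / K.ζ)) := by
  have hζ := K.ζ_pos
  have hk' : 0 < k - 2 := by linarith
  unfold consta
  rw [Real.mul_rpow (by positivity) ht.le]
  congr 1
  rw [Real.rpow_neg (by positivity), ← Real.inv_rpow (by positivity)]
  congr 1
  field_simp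

namespace IsSolution

variable {f : ℝ → State → ℝ} {C : ℝ → ℝ} {k t : ℝ}

theorem energy_pos (hf : K.IsSolution f) : 0 < normL1 K.m 2 (f 0) :=
  hf.mass_pos.trans_le hf.mass_le_energy

theorem dirichlet_le (hf : K.IsSolution f) (hκ : 0 < K.kappaLb) (hC : K.IsAveragingConst C)
    (hk : 2 < k) (hCk : C k < K.kappaLb) (ht : 0 < t) :
    K.dirichlet k (f t) ≤ -K.constA C k (normL1 K.m 0 (f 0)) (normL1 K.m 2 (f 0)) *
        normL1 K.m k (f t) ^ (1 + 1 / ((k - 2) / K.ζ))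
      + K.constA C k (normL1 K.m 0 (f 0)) (normL1 K.m 2 (f 0)) *
        K.constE C k (normL1 K.m 0 (f 0)) (normL1 K.m 2 (f 0)) ^ (1 + 1 / ((k - 2) / K.ζ)) := by
  rw [constA_mul_constE hk (K.constA_pos hCk hf.mass_pos hf.energy_pos), one_div_div]
  exact (K.constB_mem (K.dirichletBounds_nonempty hC hk hCk hf.mass_pos)).2 (f t)
    (hf.measurable t ht.le) (hf.nonneg t ht.le) (hf.memL1_of_pos hκ ht _) (hf.mass_eq ht.le)
    (hf.energy t ht.le)

/-- The barrier of `le_add_rpow_of_deriv_le` does not see the moment at the initial time, which may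
be infinite: it is started at a positive time tending to `0`. -/
theorem generation (hf : K.IsSolution f) (hκ : 0 < K.kappaLb) (hC : K.IsAveragingConst C)
    (hk : 2 < k) (hCk : C k < K.kappaLb) (ht : 0 < t) :
    normL1 K.m k (f t) ≤ K.constE C k (normL1 K.m 0 (f 0)) (normL1 K.m 2 (f 0)) +
      K.consta C k (normL1 K.m 0 (f 0)) (normL1 K.m 2 (f 0)) * t ^ (-((k - 2) / K.ζ)) := by
  have hA := K.constA_pos hCk hf.mass_pos hf.energy_pos
  rw [consta_mul hk hA ht]
  set A := K.constA C k (normL1 K.m 0 (f 0)) (normL1 K.m 2 (f 0))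
  set E := K.constE C k (normL1 K.m 0 (f 0)) (normL1 K.m 2 (f 0))
  set q := (k - 2) / K.ζ with hq
  have hq0 : 0 < q := div_pos (by linarith) K.ζ_pos
  have hlim : Tendsto (fun s => E + (A / q * (t - s)) ^ (-q)) (𝓝[>] 0)
      (𝓝 (E + (A / q * t) ^ (-q))) := by
    have : ContinuousAt (fun s => E + (A / q * (t - s)) ^ (-q)) 0 := by
      refine continuousAt_const.add (ContinuousAt.rpow_const (by fun_prop) (Or.inl ?_))
      rw [sub_zero]; positivity
    have h := this.tendsto
    simp only [sub_zero] at h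
    exact h.mono_left nhdsWithin_le_nhds
  refine ge_of_tendsto hlim ?_
  filter_upwards [Ioo_mem_nhdsGT ht] with s hs
  exact le_add_rpow_of_deriv_le (y := fun s => normL1 K.m k (f s)) hs.2 hA (constE_nonneg hA.le)
    hq0 (normL1_nonneg _ _ _)
    (fun τ hτ => hf.hasDerivAt_normL1 hκ hk (hs.1.trans_le hτ.1))
    (fun τ hτ => hf.dirichlet_le hκ hC hk hCk (hs.1.trans_le hτ.1))

/-- At a small positive time the moment is close to its initial value at most, by the growth bound;
from then on it satisfies the differential inequality. -/
theorem propagation (hf : K.IsSolution f) (hκ : 0 < K.kappaLb) (hC : K.IsAveragingConst C)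
    (hk : 2 < k) (hCk : C k < K.kappaLb) (ht : 0 < t) (h0 : MemL1 K.m k (f 0)) :
    normL1 K.m k (f t) ≤ max (K.constE C k (normL1 K.m 0 (f 0)) (normL1 K.m 2 (f 0)))
      (normL1 K.m k (f 0)) := by
  have hA := K.constA_pos hCk hf.mass_pos hf.energy_pos
  set E := K.constE C k (normL1 K.m 0 (f 0)) (normL1 K.m 2 (f 0))
  set D := K.constD k (normL1 K.m 2 (f 0))
  have hlim : Tendsto (fun s => max E (Real.exp (D * (s - 0)) * normL1 K.m k (f 0))) (𝓝[>] 0)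
      (𝓝 (max E (normL1 K.m k (f 0)))) := by
    have : Continuous fun s => max E (Real.exp (D * (s - 0)) * normL1 K.m k (f 0)) := by fun_prop
    have h := this.tendsto 0
    simp only [sub_zero, mul_zero, Real.exp_zero, one_mul] at h
    simpa only [sub_zero] using h.mono_left nhdsWithin_le_nhds
  refine ge_of_tendsto hlim ?_
  filter_upwards [Ioo_mem_nhdsGT ht] with s hs
  refine (le_max_of_deriv_le (y := fun s => normL1 K.m k (f s)) hs.2.le hA (constE_nonneg hA.le)
    (div_pos (by linarith) K.ζ_pos)
    (fun τ hτ => hf.hasDerivAt_normL1 hκ hk (hs.1.trans_le hτ.1))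
    (fun τ hτ => hf.dirichlet_le hκ hC hk hCk (hs.1.trans_le hτ.1))).trans ?_
  exact max_le_max le_rfl (hf.growth hk le_rfl hs.1.le h0).2

/-- Moments of low order are interpolated between the energy and the moment of order `k_* + 1`. -/
theorem generation_low (hf : K.IsSolution f) (hκ : 0 < K.kappaLb) (hC : K.IsAveragingConst C)
    {kstar : ℝ} (hs : K.IsThreshold C kstar) (hk : 2 < k) (hks : k < kstar) (ht : 0 < t) :
    normL1 K.m k (f t) ≤ K.constELow C kstar k (normL1 K.m 0 (f 0)) (normL1 K.m 2 (f 0)) +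
      K.constaLow C kstar k (normL1 K.m 0 (f 0)) (normL1 K.m 2 (f 0)) *
        t ^ (-((k - 2) / K.ζ)) := by
  have hζ := K.ζ_pos
  have hs1 : 0 < kstar - 1 := by linarith
  have hCl : C (kstar + 1) < K.kappaLb := hs.2 _ (by linarith)
  have hA := K.constA_pos hCl hf.mass_pos hf.energy_pos
  have hgen := hf.generation hκ hC (by linarith) hCl ht
  have hE := constE_nonneg hA.le
  have hM := hf.energy_pos
  unfold constELow constaLow
  unfold consta at hgen
  rw [show kstar + 1 - 2 = kstar - 1 by ring] at hgen
  set E := K.constE C (kstar + 1) (normL1 K.m 0 (f 0)) (normL1 K.m 2 (f 0))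
  set A := K.constA C (kstar + 1) (normL1 K.m 0 (f 0)) (normL1 K.m 2 (f 0))
  set X := (kstar - 1) / (K.ζ * A) with hX
  have hX0 : 0 < X := by positivity
  set θ := (k - 2) / (kstar - 1) with hθ
  have hθ0 : 0 ≤ θ := div_nonneg (by linarith) hs1.le
  have hθ1 : θ ≤ 1 := (div_le_one hs1).2 (by linarith)
  have hθ2 : 1 - θ = (kstar - k + 1) / (kstar - 1) := by rw [hθ]; field_simp; ring
  have hint := normL1_interpolation K.m_pos (hf.measurable t ht.le) (hf.nonneg t ht.le) (j := 2)
    (k := k) (l := kstar + 1) hθ0 hθ1 (by rw [hθ]; field_simp; ring) (by linarith)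
    (hf.memL1_of_pos hκ ht _) (by rw [hf.energy t ht.le]; exact hM)
  rw [hf.energy t ht.le, hθ2] at hint
  refine hint.trans ?_
  have h1 : normL1 K.m (kstar + 1) (f t) ^ θ ≤
      E ^ θ + (X ^ ((kstar - 1) / K.ζ) * t ^ (-((kstar - 1) / K.ζ))) ^ θ :=
    (Real.rpow_le_rpow (normL1_nonneg _ _ _) hgen hθ0).trans
      (Real.rpow_add_le_add_rpow hE (by positivity) hθ0 hθ1)
  have h2 : (X ^ ((kstar - 1) / K.ζ) * t ^ (-((kstar - 1) / K.ζ))) ^ θ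
      = X ^ ((k - 2) / K.ζ) * t ^ (-((k - 2) / K.ζ)) := by
    have e : (kstar - 1) / K.ζ * θ = (k - 2) / K.ζ := by rw [hθ]; field_simp
    rw [Real.mul_rpow (by positivity) (by positivity), ← Real.rpow_mul hX0.le,
      ← Real.rpow_mul ht.le, neg_mul, e]
  rw [h2] at h1
  have h3 := mul_le_mul_of_nonneg_left h1 (show 0 ≤ normL1 K.m 2 (f 0) ^
    ((kstar - k + 1) / (kstar - 1)) by positivity)
  linarith

/-- Up to time `1 / D_k` the exponential growth bound is used, later the generation of moments. -/
theorem propagation_low (hf : K.IsSolution f) (hκ : 0 < K.kappaLb) (hC : K.IsAveragingConst C)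
    {kstar : ℝ} (hs : K.IsThreshold C kstar) (hk : 2 < k) (hks : k < kstar) (ht : 0 < t)
    (h0 : MemL1 K.m k (f 0)) :
    normL1 K.m k (f t) ≤ max (K.constETildeLow C kstar k (normL1 K.m 0 (f 0)) (normL1 K.m 2 (f 0)))
      (Real.exp 1 * normL1 K.m k (f 0)) := by
  have hζ := K.ζ_pos
  have hM := hf.energy_pos
  have hκu : 0 < K.kappaUb := hκ.trans_le K.kappaLb_le_kappaUb
  have hD : 0 < K.constD k (normL1 K.m 2 (f 0)) := by unfold constD; positivity
  rcases le_total (K.constD k (normL1 K.m 2 (f 0)) * t) 1 with h | h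
  · refine le_max_of_le_right ((hf.growth hk le_rfl ht.le h0).2.trans ?_)
    rw [sub_zero]
    exact mul_le_mul_of_nonneg_right (Real.exp_le_exp.2 h) (normL1_nonneg _ _ _)
  · refine le_max_of_le_left ((hf.generation_low hκ hC hs hk hks ht).trans ?_)
    have hA := K.constA_pos (hs.2 (kstar + 1) (by linarith)) hf.mass_pos hf.energy_pos
    unfold constETildeLow constaLow
    set D := K.constD k (normL1 K.m 2 (f 0))
    set A := K.constA C (kstar + 1) (normL1 K.m 0 (f 0)) (normL1 K.m 2 (f 0))
    have hX : 0 ≤ (kstar - 1) / (K.ζ * A) := div_nonneg (by linarith) (by positivity)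
    have h1 : t ^ (-((k - 2) / K.ζ)) ≤ D ^ ((k - 2) / K.ζ) := by
      rw [Real.rpow_neg ht.le, ← Real.inv_rpow ht.le]
      refine Real.rpow_le_rpow (by positivity) ?_ (div_nonneg (by linarith) hζ.le)
      rw [inv_le_iff_one_le_mul₀ ht]; exact h
    rw [Real.mul_rpow hX hD.le, add_le_add_iff_left, mul_assoc]
    refine mul_le_mul_of_nonneg_left (mul_le_mul_of_nonneg_left h1 (Real.rpow_nonneg hX _)) ?_
    positivity

end IsSolution

end CollisionKernel

end Polyatomic

end

theorem mainTheorem3 (K : Polyatomic.CollisionKernel) (hκ : 0 < K.kappaLb) :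
    (∃ C : ℝ → ℝ, K.IsAveragingConst C) ∧
    ∀ C : ℝ → ℝ, K.IsAveragingConst C →
      (∃ kstar : ℝ, K.IsThreshold C kstar) ∧
      ∀ kstar : ℝ, K.IsThreshold C kstar →
        (∀ k M₀ M₂ : ℝ, kstar ≤ k → 0 < M₀ → (K.dirichletBounds C k M₀ M₂).Nonempty) ∧
        ∀ f : ℝ → Polyatomic.State → ℝ, K.IsSolution f →
        ∀ M₀ M₂ : ℝ, M₀ = Polyatomic.normL1 K.m 0 (f 0) → M₂ = Polyatomic.normL1 K.m 2 (f 0) →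
          -- generation of moments
          (∀ k t : ℝ, kstar ≤ k → 0 < t →
            Polyatomic.MemL1 K.m k (f t) ∧
            Polyatomic.normL1 K.m k (f t) ≤
              K.constE C k M₀ M₂ + K.consta C k M₀ M₂ * t ^ (-((k - 2) / K.ζ))) ∧
          (∀ k t : ℝ, 2 < k → k < kstar → 0 < t →
            Polyatomic.MemL1 K.m k (f t) ∧
            Polyatomic.normL1 K.m k (f t) ≤
              K.constELow C kstar k M₀ M₂
                + K.constaLow C kstar k M₀ M₂ * t ^ (-((k - 2) / K.ζ))) ∧
          -- propagation of moments
          (∀ k t : ℝ, kstar ≤ k → 0 < t → Polyatomic.MemL1 K.m k (f 0) →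
            Polyatomic.normL1 K.m k (f t) ≤
              max (K.constE C k M₀ M₂) (Polyatomic.normL1 K.m k (f 0))) ∧
          (∀ k t : ℝ, 2 < k → k < kstar → 0 < t → Polyatomic.MemL1 K.m k (f 0) →
            Polyatomic.normL1 K.m k (f t) ≤
              max (K.constETildeLow C kstar k M₀ M₂)
                (Real.exp 1 * Polyatomic.normL1 K.m k (f 0))) := by
  refine ⟨⟨_, K.isAveragingConst_averagingConst⟩, fun C hC => ⟨K.exists_isThreshold hκ hC, ?_⟩⟩
  intro kstar hs
  refine ⟨fun k M₀ M₂ hk hM₀ =>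
    K.dirichletBounds_nonempty hC (hs.1.trans_le hk) (hs.2 k hk) hM₀, ?_⟩
  rintro f hf M₀ M₂ rfl rfl
  refine ⟨fun k t hk ht => ⟨hf.memL1_of_pos hκ ht k, ?_⟩, fun k t hk hks ht =>
    ⟨hf.memL1_of_pos hκ ht k, ?_⟩, fun k t hk ht h0 => ?_, fun k t hk hks ht h0 => ?_⟩
  · exact hf.generation hκ hC (hs.1.trans_le hk) (hs.2 k hk) ht
  · exact hf.generation_low hκ hC hs hk hks ht
  · exact hf.propagation hκ hC (hs.1.trans_le hk) (hs.2 k hk) ht h0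
  · exact hf.propagation_low hκ hC hs hk hks ht h0
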